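/- Let $M>0$ and let $\Sigma=\{(r,\phi): r>2M,\ \phi\in\mathbb{R}/2\pi\mathbb{Z}\}$ be the equatorial plane outside the Schwarzschild horizon, with the optical metric $$ds^2=\frac{dr^2}{(1-2M/r)^2}+\frac{r^2}{1-2M/r}\,d\phi^2 .$$ Regard $\Sigma$ as the subset $\{|z|>2M\}$ of the plane $\mathbb{C}$ through $z=re^{i\phi}$; the disc $\{|z|\le 2M\}$ is called the hole. A geodesic triangle (digon, loop) is a simple closed curve in $\Sigma$ that consists of three (two, one) geodesic arcs, traversed in cyclic order. It bounds a compact region of the plane (the curve together with the bounded components of its complement), and its internal angles, which lie in $(0,2\pi)$, are measured on the side of this region. It encloses the hole if this region contains the hole. It encloses the circular geodesic $r=3M$ if the disc $\{|z|\le 3M\}$ is contained in this region and does not meet the curve; in that case the subscript $0$ denotes the annular region that is left when $\{|z|<3M\}$ is removed. The Gauss curvature $K$ of the optical metric is $$K=-\frac{2M}{r^3}\Bigl(1-\frac{3M}{2r}\Bigr)<0\qquad (r>2M),$$ and the following holds. (i) If a geodesic triangle with bounded region $\Delta$ does not enclose the hole, then its internal angles are positive and satisfy $\alpha+\beta+\gamma=\pi+\int_\Delta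 K\,dA<\pi$. (ii) Every geodesic digon encloses the hole: two geodesic arcs cannot have both endpoints, and no other point, in common unless the hole is inside the digon that they form. If the digon lies in $r\ge 3M$, then its region contains the disc $\{|z|\le 3M\}$. (iii) Every geodesic loop encloses the hole: a geodesic cannot intersect itself in such a way that the resulting loop does not have the hole inside. If the loop lies in $r\ge 3M$, then its region contains the disc $\{|z|\le 3M\}$. (iv) If a geodesic triangle encloses the circle $r=3M$, then its internal angles are positive and satisfy $\alpha+\beta+\gamma=3\pi+\int_{\Delta_0}K\,dA>\pi$. (v) If a geodesic digon encloses the circle $r=3M$, then its internal angles are positive and satisfy $\alpha+\beta=2\pi+\int_{S_0}K\,dA>0$. Such digons exist, even with both internal angles in $(0,\pi)$. (vi) If a geodesic loop encloses the circle $r=3M$, then its internal angle is positive and satisfies $\alpha=\pi+\int_{T_0}K\,dA$. Such loops exist, even with internal angle in $(0,\pi)$. -/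

import Mathlib

/-! ## Riemannian geometry of a metric in two coordinates -/

namespace Surface

/-- A point, or the components of a tangent vector, in two coordinates. -/
abbrev Coord := Fin 2 → ℝ

/-- The partial derivative `∂ₖ f` at `x`. -/
noncomputable def pd (k : Fin 2) (f : Coord → ℝ) (x : Coord) : ℝ :=
  deriv (fun s : ℝ => f (Function.update x k s)) (x k)

/-- The Christoffel symbol `Γⁱⱼₖ` of the metric `g`. -/
noncomputable def christoffel (g : Coord → Matrix (Fin 2) (Fin 2) ℝ) (i j k : Fin 2)
    (x : Coord) : ℝ :=
  (1 / 2) * ∑ l, (g x)⁻¹ i l *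
    (pd j (fun y => g y l k) x + pd k (fun y => g y l j) x - pd l (fun y => g y j k) x)

/-- The component `Rⁱⱼₖₗ` of the Riemann tensor, that is, the `i`-th component of
`R(∂ₖ, ∂ₗ) ∂ⱼ`. -/
noncomputable def riemann (g : Coord → Matrix (Fin 2) (Fin 2) ℝ) (i j k l : Fin 2)
    (x : Coord) : ℝ :=
  pd k (christoffel g i l j) x - pd l (christoffel g i k j) x
    + ∑ m, (christoffel g i k m x * christoffel g m l j x
      - christoffel g i l m x * christoffel g m k j x)

/-- The Gauss curvature `K`, defined by `R₀₁₀₁ = K (g₀₀ g₁₁ - g₀₁ g₁₀)`. -/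
noncomputable def gaussCurvature (g : Coord → Matrix (Fin 2) (Fin 2) ℝ) (x : Coord) : ℝ :=
  (∑ m, g x 0 m * riemann g m 1 0 1 x) / (g x).det

/-- The density `√(det g)` of the area form `dA` with respect to the coordinates. -/
noncomputable def areaDensity (g : Coord → Matrix (Fin 2) (Fin 2) ℝ) (x : Coord) : ℝ :=
  Real.sqrt (g x).det

/-- The second derivative which the geodesic equation `ẍⁱ + Γⁱⱼₖ ẋʲ ẋᵏ = 0` prescribes at the
position `x` and the velocity `v`. -/
noncomputable def geodesicAccel (g : Coord → Matrix (Fin 2) (Fin 2) ℝ) (x v : Coord) : Coord :=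
  fun i => -∑ j, ∑ k, christoffel g i j k x * v j * v k

/-- The signed angle in `(-π, π]` from the tangent vector `u` to the tangent vector `v` at `x`:
the argument of `g(u, v) + i dA(u, v)`. -/
noncomputable def signedAngle (g : Coord → Matrix (Fin 2) (Fin 2) ℝ) (x u v : Coord) : ℝ :=
  Complex.arg ⟨∑ i, ∑ j, g x i j * u i * v j, areaDensity g x * (u 0 * v 1 - u 1 * v 0)⟩

/-- The tangent vector at `x` that is obtained from `v` by a rotation through `+π/2`. -/
noncomputable def leftNormal (g : Coord → Matrix (Fin 2) (Fin 2) ℝ) (x v : Coord) : Coord :=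
  ![-(g x 1 0 * v 0 + g x 1 1 * v 1) / areaDensity g x,
    (g x 0 0 * v 0 + g x 0 1 * v 1) / areaDensity g x]

end Surface

/-! ## The equatorial optical geometry of Schwarzschild -/

namespace Schwarzschild

open Surface

/-- The equatorial optical metric `dr² / (1 - 2M/r)² + r² / (1 - 2M/r) dφ²` in the coordinates
`x = (r, φ)`; it is used for `r > 2M` only. -/
noncomputable def opticalMetric (M : ℝ) (x : Coord) : Matrix (Fin 2) (Fin 2) ℝ :=
  !![1 / (1 - 2 * M / x 0) ^ 2, 0; 0, x 0 ^ 2 / (1 - 2 * M / x 0)]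

/-- The point of the plane with polar coordinates `x = (r, φ)`. The equatorial plane outside the
horizon is `{z : ℂ | 2M < |z|}`; the horizon, with what is inside it, is the closed disc
of radius `2M`. -/
noncomputable def toPlane (x : Coord) : ℂ := (x 0 : ℂ) * Complex.exp ((x 1 : ℂ) * Complex.I)

/-- A geodesic arc of the optical metric, in an affine parameter that runs over `[0, 1]`. It is
given by its polar coordinates `(r, φ)`, where `φ` is a continuous choice of the angle along
the arc. -/
structure GeodesicArc (M : ℝ) where
  pos : ℝ → Coord
  vel : ℝ → Coord
  outside : ∀ t ∈ Set.Icc (0 : ℝ) 1, 2 * M < pos t 0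
  hasDeriv_pos : ∀ t ∈ Set.Icc (0 : ℝ) 1, HasDerivWithinAt pos (vel t) (Set.Icc 0 1) t
  hasDeriv_vel : ∀ t ∈ Set.Icc (0 : ℝ) 1,
    HasDerivWithinAt vel (geodesicAccel (opticalMetric M) (pos t) (vel t)) (Set.Icc 0 1) t
  vel_ne_zero : ∀ t ∈ Set.Icc (0 : ℝ) 1, vel t ≠ 0

/-- A geodesic `n`-gon: `n` geodesic arcs which, traversed in cyclic order, form a simple closed
curve in the equatorial plane outside the horizon. It is a triangle for `n = 3`, a digon for
`n = 2`, and a loop for `n = 1`. -/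
structure GeodesicPolygon (M : ℝ) (n : ℕ) [NeZero n] where
  edge : Fin n → GeodesicArc M
  closed : ∀ i : Fin n, toPlane ((edge i).pos 1) = toPlane ((edge (i + 1)).pos 0)
  simple : ∀ i j : Fin n, ∀ s ∈ Set.Ico (0 : ℝ) 1, ∀ t ∈ Set.Ico (0 : ℝ) 1,
    toPlane ((edge i).pos s) = toPlane ((edge j).pos t) → i = j ∧ s = t

namespace GeodesicPolygon

variable {M : ℝ} {n : ℕ} [NeZero n]

/-- The closed curve formed by the edges. -/
def boundary (P : GeodesicPolygon M n) : Set ℂ :=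
  ⋃ i : Fin n, (fun t => toPlane ((P.edge i).pos t)) '' Set.Icc (0 : ℝ) 1

/-- The closed region of the plane that is bounded by the polygon: the curve together with the
bounded components of its complement. -/
def region (P : GeodesicPolygon M n) : Set ℂ :=
  P.boundary ∪ {w | w ∉ P.boundary ∧ Bornology.IsBounded (connectedComponentIn P.boundaryᶜ w)}

/-- The region bounded by the polygon lies to the left of each edge. -/
def PositivelyOriented (P : GeodesicPolygon M n) : Prop :=
  ∀ i : Fin n, ∀ t ∈ Set.Ioo (0 : ℝ) 1, ∀ᶠ s in nhdsWithin (0 : ℝ) (Set.Ioi 0),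
    toPlane ((P.edge i).pos t
      + s • leftNormal (opticalMetric M) ((P.edge i).pos t) ((P.edge i).vel t)) ∈ P.region

/-- The angle in `(-π, π]` through which the tangent turns to the left at the corner where the
edge `i` ends and the edge `i + 1` begins. -/
noncomputable def exteriorAngle (P : GeodesicPolygon M n) (i : Fin n) : ℝ :=
  signedAngle (opticalMetric M) ((P.edge (i + 1)).pos 0) ((P.edge i).vel 1)
    ((P.edge (i + 1)).vel 0)

/-- The internal angle at that corner, for a positively oriented polygon. It exceeds `π` at a
reflex corner. -/
noncomputable def internalAngle (P : GeodesicPolygon M n) (i : Fin n) : ℝ :=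
  Real.pi - P.exteriorAngle i

/-- The black hole, `r ≤ 2M`, is inside the polygon. -/
def EnclosesHole (P : GeodesicPolygon M n) : Prop :=
  Metric.closedBall (0 : ℂ) (2 * M) ⊆ P.region

/-- The circular geodesic `r = 3M`, and all that is inside it, is in the interior of the
polygon. -/
def EnclosesPhotonCircle (P : GeodesicPolygon M n) : Prop :=
  Metric.closedBall (0 : ℂ) (3 * M) ⊆ P.region \ P.boundary

/-- The annular region between the circle `r = 3M` and the polygon. -/
def regionWithHole (P : GeodesicPolygon M n) : Set ℂ :=
  P.region \ Metric.ball (0 : ℂ) (3 * M)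

end GeodesicPolygon

/-- The part of `D` outside the horizon, in polar coordinates with `-π < φ ≤ π`. -/
def polarRegion (M : ℝ) (D : Set ℂ) : Set Coord :=
  {x | 2 * M < x 0 ∧ x 1 ∈ Set.Ioc (-Real.pi) Real.pi ∧ toPlane x ∈ D}

/-- The density of `K dA` with respect to `dr dφ`. -/
noncomputable def curvatureDensity (M : ℝ) (x : Coord) : ℝ :=
  gaussCurvature (opticalMetric M) x * areaDensity (opticalMetric M) x

/-- `K` is integrable over `D` with respect to `dA`. -/
def CurvatureIntegrable (M : ℝ) (D : Set ℂ) : Prop :=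
  MeasureTheory.IntegrableOn (curvatureDensity M) (polarRegion M D)

/-- The integral `∫_D K dA`. -/
noncomputable def totalCurvature (M : ℝ) (D : Set ℂ) : ℝ :=
  ∫ x in polarRegion M D, curvatureDensity M x

end Schwarzschild

/-! ## Continuous logarithms -/

namespace PlaneCurve

open Complex Set Filter Topology

/-! The theorem is Gauss–Bonnet for a rotationally symmetric metric, proved by counting rotations.
In the orthonormal polar frame the velocity of a geodesic rotates at the rate `-κ φ'`, where `κ = (1
- 3M/r) / √(1 - 2M/r)` and `d(κ dφ) = -K dA`. A simple closed polygon has turning number `m = ±1`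
and winding number `w ∈ {0, m}` around the centre. Comparing the optical frame with the Euclidean
one gives `∑ exterior angles = 2π (m - w) + ∮ κ dφ` (`sum_exteriorAngle`). If `r₀ > 2M` is at most
the least radius on the curve, Stokes gives `∮ κ dφ = 2π w κ(r₀) + m ∫ κ' dr dφ`, the integral
running over the part `r ≥ r₀` of the region (`sum_rotation`).

If the hole is not enclosed, then `w = 0` and the exterior angles sum to `m (2π + ∫ κ')`. For a
triangle this is (i). Each exterior angle is smaller than `π` in absolute value, because a geodesic
that leaves a corner in the opposite direction would retrace the preceding one. So one or two
corners cannot supply `2π`, which is (ii) and (iii). If the circle `r = 3M` is enclosed, then `w =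
m` and `κ(3M) = 0`, so a positively oriented curve has exterior angle sum `∫ κ'` over `r ≥ 3M`.
Since `κ < 1`, this is less than `2π`, which gives (iv) to (vi).

The topology is elementary. Continuous logarithms define winding numbers, and gluing nonvanishing
functions shows that a bounded component has nonzero winding number and that all nonzero winding
numbers agree (`eq_zero_of_bounded_component`). Hopf's logarithm of chords gives the turning number
(`turning_sum`) and ties it to the winding numbers beside the curve (`wind_near`), which forces `m =
±1`. Stokes' theorem for the possibly complicated region is replaced by Fubini for the Cauchy kernel
(`green`).

The examples are `n` congruent arcs of one orbit whose perihelion is so close to `3M` that it can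
wind all the way around the centre (`exists_polygon`). -/

theorem exists_log_of_convex {E : Type*} [NormedAddCommGroup E] [NormedSpace ℝ E] {U : Set E}
    (hU : Convex ℝ U) (hne : U.Nonempty) (ho : IsOpen U) {g : E → ℂ} (hg : ContinuousOn g U)
    (h0 : ∀ x ∈ U, g x ≠ 0) : ∃ f : E → ℂ, ContinuousOn f U ∧ ∀ x ∈ U, exp (f x) = g x := by
  have hs : IsSimplyConnected U := by
    have := hU.contractibleSpace hne
    exact (inferInstance : SimplyConnectedSpace U)
  obtain ⟨f, hf, he⟩ := exists_continuousOn_eqOn_exp_comp hs ho hg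
    (by rintro ⟨x, hx, h⟩; exact h0 x hx h)
  exact ⟨f, hf, he⟩

/-- The difference of two logarithms of one function takes values in the discrete set `2πi ℤ`. This
rigidity is the source of every integer below. -/
theorem log_sub_const {X : Type*} [TopologicalSpace X] {A : Set X} (hA : IsPreconnected A)
    {f g : X → ℂ} (hf : ContinuousOn f A) (hg : ContinuousOn g A)
    (h : ∀ x ∈ A, exp (f x) = exp (g x)) {x y : X} (hx : x ∈ A) (hy : y ∈ A) :
    f x - g x = f y - g y := by
  refine isCoveringMap_exp.constOn_of_comp (g := fun x => f x - g x) hA (hf.sub hg) ?_ hx hy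
  intro a ha b hb
  simp [Complex.exp_sub, h a ha, h b hb]

theorem mem_slitPlane_of_norm_sub_one_lt {q : ℂ} (h : ‖q - 1‖ < 1) : q ∈ slitPlane := by
  have := mem_slitPlane_of_norm_lt_one h
  simpa using this

/-- A continuous closed curve in the plane, consisting of `n` regular arcs `c k` that are
differentiable up to their endpoints, traversed in cyclic order. -/
structure ClosedCurve (n : ℕ) where
  n_pos : 0 < n
  c : ℤ → ℝ → ℂ
  d : ℤ → ℝ → ℂ
  hasDeriv : ∀ k, ∀ t ∈ Icc (0 : ℝ) 1, HasDerivWithinAt (c k) (d k t) (Icc 0 1) t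
  cont_d : ∀ k, ContinuousOn (d k) (Icc 0 1)
  d_ne : ∀ k, ∀ t ∈ Icc (0 : ℝ) 1, d k t ≠ 0
  join : ∀ k, c k 1 = c (k + 1) 0
  per_c : ∀ k, c (k + n) = c k
  per_d : ∀ k, d (k + n) = d k
  inj : ∀ k l, ∀ s ∈ Ico (0 : ℝ) 1, ∀ t ∈ Ico (0 : ℝ) 1, c k s = c l t →
    ∃ j : ℤ, l = k + j * n ∧ s = t
  noCusp : ∀ k, d (k + 1) 0 / d k 1 ∈ slitPlane

/-! ### Parametrization of a simple closed curve, and its winding numbers -/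

namespace ClosedCurve

variable {n : ℕ} (C : ClosedCurve n)

/-- The parametrization of the curve over the real line, with period `n`. -/
noncomputable def path (t : ℝ) : ℂ := C.c ⌊t⌋ (Int.fract t)

theorem cont_c (k : ℤ) : ContinuousOn (C.c k) (Icc 0 1) := fun t ht =>
  (C.hasDeriv k t ht).continuousWithinAt

theorem path_add (k : ℤ) {s : ℝ} (hs : s ∈ Icc (0 : ℝ) 1) : C.path (k + s) = C.c k s := by
  rcases eq_or_lt_of_le hs.2 with rfl | h
  · have : (k : ℝ) + 1 = ((k + 1 : ℤ) : ℝ) := by push_cast; ring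
    rw [this, path, Int.floor_intCast, Int.fract_intCast, C.join]
  · have hf : ⌊(k : ℝ) + s⌋ = k := by
      rw [Int.floor_eq_iff]; constructor <;> linarith [hs.1]
    rw [path, Int.fract, hf]; simp

theorem continuous_path : Continuous C.path := by
  have hloc : LocallyFinite fun k : ℤ => Icc (k : ℝ) (k + 1) := by
    intro x
    refine ⟨Ioo (x - 1) (x + 1), Ioo_mem_nhds (by linarith) (by linarith), ?_⟩
    refine (finite_Icc (⌊x⌋ - 3) (⌊x⌋ + 3)).subset ?_
    rintro k ⟨y, ⟨h1, h2⟩, h3, h4⟩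
    have h5 := Int.floor_le x
    have h6 := Int.lt_floor_add_one x
    constructor
    · have : ((⌊x⌋ - 3 : ℤ) : ℝ) ≤ k := by push_cast; linarith
      exact_mod_cast this
    · have : (k : ℝ) ≤ ((⌊x⌋ + 3 : ℤ) : ℝ) := by push_cast; linarith
      exact_mod_cast this
  refine hloc.continuous ?_ (fun _ => isClosed_Icc) ?_
  · refine eq_univ_of_forall fun x => mem_iUnion.2 ⟨⌊x⌋, Int.floor_le x, (Int.lt_floor_add_one x).le⟩
  · intro k
    have h1 : ContinuousOn (fun t : ℝ => C.c k (t - k)) (Icc (k : ℝ) (k + 1)) := by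
      refine (C.cont_c k).comp (by fun_prop) ?_
      intro t ht
      exact ⟨by linarith [ht.1], by linarith [ht.2]⟩
    refine h1.congr fun t ht => ?_
    have := C.path_add k (s := t - k) ⟨by linarith [ht.1], by linarith [ht.2]⟩
    show C.path t = C.c k (t - k)
    rw [← this]; congr 1; ring

theorem path_periodic (t : ℝ) : C.path (t + n) = C.path t := by
  have : t + n = t + ((n : ℤ) : ℝ) := by simp
  rw [path, path, this, Int.floor_add_intCast, Int.fract_add_intCast, C.per_c]

theorem path_add_mul (t : ℝ) (j : ℤ) : C.path (t + j * n) = C.path t := by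
  have : Function.Periodic C.path (n : ℝ) := C.path_periodic
  simpa using this.int_mul j t

theorem path_inj {s t : ℝ} (h : C.path s = C.path t) : ∃ j : ℤ, t = s + j * n := by
  obtain ⟨j, h1, h2⟩ := C.inj ⌊s⌋ ⌊t⌋ _ ⟨Int.fract_nonneg s, Int.fract_lt_one s⟩ _
    ⟨Int.fract_nonneg t, Int.fract_lt_one t⟩ h
  refine ⟨j, ?_⟩
  have h3 : (⌊t⌋ : ℝ) = ⌊s⌋ + j * n := by exact_mod_cast h1
  have h4 := Int.floor_add_fract s
  have h5 := Int.floor_add_fract t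
  linarith

theorem path_ne {s t : ℝ} (h1 : s < t) (h2 : t < s + n) : C.path t - C.path s ≠ 0 := by
  intro h
  obtain ⟨j, hj⟩ := C.path_inj (sub_eq_zero.1 h).symm
  have hn : (0 : ℝ) < n := by exact_mod_cast C.n_pos
  have h3 : 0 < (j : ℝ) := by by_contra hc; push Not at hc; nlinarith
  have h4 : (j : ℝ) < 1 := by by_contra hc; push Not at hc; nlinarith
  have : 0 < j := by exact_mod_cast h3
  have : j < 1 := by exact_mod_cast h4
  omega

/-- The trace of the curve. -/
def trace : Set ℂ := range C.path

theorem trace_eq_image : C.trace = C.path '' Icc 0 n := by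
  apply Subset.antisymm
  · rintro _ ⟨t, rfl⟩
    have hn : (0 : ℝ) < n := by exact_mod_cast C.n_pos
    refine ⟨t + ((-⌊t / n⌋ : ℤ) : ℝ) * n, ?_, C.path_add_mul _ _⟩
    have h1 := Int.floor_le (t / n)
    have h2 := Int.lt_floor_add_one (t / n)
    rw [le_div_iff₀ hn] at h1
    rw [div_lt_iff₀ hn] at h2
    push_cast
    constructor <;> nlinarith
  · exact image_subset_range _ _

theorem isCompact_trace : IsCompact C.trace := by
  rw [trace_eq_image]; exact isCompact_Icc.image C.continuous_path

theorem mem_trace (t : ℝ) : C.path t ∈ C.trace := mem_range_self t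

theorem c_mem_trace (k : ℤ) {t : ℝ} (ht : t ∈ Icc (0 : ℝ) 1) : C.c k t ∈ C.trace := by
  rw [← C.path_add k ht]; exact C.mem_trace _

theorem path_sub_ne {z : ℂ} (hz : z ∉ C.trace) (t : ℝ) : C.path t - z ≠ 0 := fun h =>
  hz (sub_eq_zero.1 h ▸ C.mem_trace t)

/-- The integral that expresses the winding number around `z`. -/
noncomputable def windInt (z : ℂ) : ℂ :=
  (2 * Real.pi * I)⁻¹ * ∑ k ∈ Finset.range n, ∫ t in (0 : ℝ)..1, C.d k t / (C.c k t - z)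

theorem exists_log {z : ℂ} (hz : z ∉ C.trace) :
    ∃ l : ℝ → ℂ, Continuous l ∧ ∀ t, exp (l t) = C.path t - z := by
  obtain ⟨f, hf, he⟩ := exists_log_of_convex (E := ℝ) convex_univ univ_nonempty isOpen_univ
    (g := fun t => C.path t - z) (C.continuous_path.sub continuous_const).continuousOn
    (fun t _ => C.path_sub_ne hz t)
  exact ⟨f, continuousOn_univ.1 hf, fun t => he t (mem_univ t)⟩

end ClosedCurve

/-- A continuous logarithm of a regular arc is a primitive of the logarithmic derivative. -/
theorem log_arc {c d l : ℝ → ℂ} (hc : ∀ t ∈ Icc (0 : ℝ) 1, HasDerivWithinAt c (d t) (Icc 0 1) t)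
    (hd : ContinuousOn d (Icc 0 1)) (hl : ContinuousOn l (Icc 0 1))
    (he : ∀ t ∈ Icc (0 : ℝ) 1, exp (l t) = c t) {t : ℝ} (ht : t ∈ Icc (0 : ℝ) 1) :
    l t - l 0 = ∫ s in (0 : ℝ)..t, d s / c s := by
  have h0 : ∀ t ∈ Icc (0 : ℝ) 1, c t ≠ 0 := fun t ht => he t ht ▸ exp_ne_zero _
  have hcc : ContinuousOn c (Icc 0 1) := fun t ht => (hc t ht).continuousWithinAt
  have hq : ContinuousOn (fun s => d s / c s) (Icc 0 1) := hd.div hcc h0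
  let J : ℝ → ℂ := fun t => ∫ s in (0 : ℝ)..t, d s / c s
  have hJ : ∀ t ∈ Icc (0 : ℝ) 1, HasDerivWithinAt J (d t / c t) (Icc 0 1) t := by
    intro t ht
    have hi : IntervalIntegrable (fun s => d s / c s) MeasureTheory.volume 0 t :=
      (hq.mono (by rw [uIcc_of_le ht.1]; exact Icc_subset_Icc_right ht.2)).intervalIntegrable
    have : Fact (t ∈ Icc (0 : ℝ) 1) := ⟨ht⟩
    refine intervalIntegral.integral_hasDerivWithinAt_right hi ?_ (hq t ht)
    exact hq.stronglyMeasurableAtFilter_nhdsWithin measurableSet_Icc t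
  -- `exp (-J) c` has derivative zero, so `J` differs from a logarithm of `c` by a constant.
  have hexp : ∀ t ∈ Icc (0 : ℝ) 1, exp (-J t) * c t = exp (-J 0) * c 0 := by
    have hder : ∀ t ∈ Icc (0 : ℝ) 1,
        HasDerivWithinAt (fun t => exp (-J t) * c t) 0 (Icc 0 1) t := by
      intro t ht
      have := ((hJ t ht).neg.cexp).mul (hc t ht)
      convert! this using 1
      field_simp [h0 t ht]
      simp
    intro t ht
    refine (convex_Icc (0 : ℝ) 1).is_const_of_fderivWithin_eq_zero (𝕜 := ℝ)
      (f := fun t => exp (-J t) * c t) (fun t ht => (hder t ht).differentiableWithinAt) ?_ ht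
      (by simp)
    intro t ht
    have h := (hder t ht).hasFDerivWithinAt.fderivWithin (uniqueDiffOn_Icc (by norm_num) t ht)
    rw [h]; ext; simp
  have hJ0 : J 0 = 0 := by simp [J]
  have key := log_sub_const (A := Icc (0 : ℝ) 1) isPreconnected_Icc hl
    (g := fun t => l 0 + J t) (continuousOn_const.add fun t ht => (hJ t ht).continuousWithinAt)
    (by
      intro t ht
      have := hexp t ht
      rw [hJ0, neg_zero, exp_zero, one_mul, exp_neg, inv_mul_eq_iff_eq_mul₀ (exp_ne_zero _)] at this
      rw [exp_add, he t ht, he 0 (by simp), this]; ring) ht (show (0 : ℝ) ∈ Icc (0 : ℝ) 1 by simp)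
  simp only [hJ0] at key
  have : l t = l 0 + J t := by linear_combination key
  rw [this]; ring

namespace ClosedCurve

variable {n : ℕ} (C : ClosedCurve n)

/-- The increment over a period does not depend on its start, again by rigidity; over `[0, n]` it
splits into the increments along the arcs. -/
theorem log_period {z : ℂ} {l : ℝ → ℂ} (hl : Continuous l)
    (he : ∀ t, exp (l t) = C.path t - z) (a : ℝ) :
    l (a + n) - l a = 2 * Real.pi * I * C.windInt z := by
  have h1 : l (a + n) - l a = l (0 + n) - l 0 :=
    log_sub_const (A := (univ : Set ℝ)) isPreconnected_univ (f := fun a => l (a + n)) (g := l)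
      (by fun_prop) hl.continuousOn
      (fun x _ => by rw [he, he, C.path_periodic]) (mem_univ a) (mem_univ 0)
  have h2 : ∀ k : ℕ, ∫ t in (0 : ℝ)..1, C.d k t / (C.c k t - z) = l ((k + 1 : ℕ) : ℝ) - l k := by
    intro k
    have := log_arc (c := fun t => C.c k t - z) (d := C.d k) (l := fun t => l (k + t))
      (fun t ht => (C.hasDeriv k t ht).sub_const z) (C.cont_d k) (by fun_prop)
      (fun t ht => by rw [he, ← C.path_add k ht]; simp) (t := 1) (by simp)
    rw [← this]; simp
  have h3 : (2 * Real.pi * I : ℂ) ≠ 0 := by simp [Real.pi_ne_zero]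
  rw [h1, windInt, mul_inv_cancel_left₀ h3, Finset.sum_congr rfl fun k _ => h2 k,
    Finset.sum_range_sub (fun k : ℕ => l (k : ℝ))]
  simp

/-- The winding number of the curve around `z`. -/
noncomputable def wind (z : ℂ) : ℤ := round (C.windInt z).re

/-- The logarithm starts and ends a period over the same point, so its increment is a multiple of
`2πi`. Off the curve, the rounding in `wind` therefore loses nothing. -/
theorem windInt_eq {z : ℂ} (hz : z ∉ C.trace) : C.windInt z = C.wind z := by
  obtain ⟨l, hl, he⟩ := C.exists_log hz
  have h := C.log_period hl he 0
  have h1 : exp (l (0 + n)) = exp (l 0) := by rw [he, he, C.path_periodic]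
  obtain ⟨m, hm⟩ := exp_eq_exp_iff_exists_int.1 h1
  have h3 : (2 * Real.pi * I : ℂ) ≠ 0 := by simp [Real.pi_ne_zero]
  have h4 : C.windInt z = m := by
    apply mul_left_cancel₀ h3
    rw [← h, hm]; ring
  rw [wind, h4]; simp

theorem wind_eq_of_log {z : ℂ} (hz : z ∉ C.trace) {l : ℝ → ℂ} (hl : Continuous l)
    (he : ∀ t, exp (l t) = C.path t - z) (a : ℝ) :
    l (a + n) - l a = 2 * Real.pi * I * C.wind z := by
  rw [C.log_period hl he, C.windInt_eq hz]

/-- Seen from the curve, the quotient of the two differences stays in the unit disc around `1`. Its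
principal logarithm is a periodic correction from one logarithm to the other. -/
theorem wind_eq_of_dist_lt {z z' : ℂ} (h : ∀ t, ‖z' - z‖ < ‖C.path t - z‖) :
    C.wind z' = C.wind z := by
  have hz : z ∉ C.trace := by
    rintro ⟨t, rfl⟩
    have := h t
    simp at this
    linarith [norm_nonneg (z' - C.path t)]
  have hz' : z' ∉ C.trace := by
    rintro ⟨t, rfl⟩
    exact lt_irrefl _ (h t)
  obtain ⟨l, hl, he⟩ := C.exists_log hz
  have hq : ∀ t, (C.path t - z') / (C.path t - z) ∈ slitPlane := by
    intro t
    apply mem_slitPlane_of_norm_sub_one_lt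
    have h0 := C.path_sub_ne hz t
    rw [div_sub_one h0, norm_div, div_lt_one (norm_pos_iff.2 h0)]
    convert! h t using 1
    rw [← norm_neg]; congr 1; ring
  have hc := C.continuous_path
  have h1 := C.wind_eq_of_log hz' (l := fun t => l t + log ((C.path t - z') / (C.path t - z)))
    (hl.add (((hc.sub continuous_const).div (hc.sub continuous_const)
      (fun t => C.path_sub_ne hz t)).clog hq))
    (by
      intro t
      rw [exp_add, he, exp_log (slitPlane_ne_zero (hq t)), mul_div_cancel₀ _ (C.path_sub_ne hz t)]) 0
  have h2 := C.wind_eq_of_log hz hl he 0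
  rw [C.path_periodic, add_sub_add_right_eq_sub, h2] at h1
  have h3 : (2 * Real.pi * I : ℂ) ≠ 0 := by simp [Real.pi_ne_zero]
  exact_mod_cast (mul_left_cancel₀ h3 h1).symm

/-- From a point farther out than the curve, the directions to the curve stay in a half-plane, so
the principal logarithm is itself a periodic choice. -/
theorem wind_eq_zero_of_norm_lt {z : ℂ} (h : ∀ t, ‖C.path t‖ < ‖z‖) : C.wind z = 0 := by
  have hz : z ∉ C.trace := by rintro ⟨t, rfl⟩; exact lt_irrefl _ (h t)
  have hz0 : z ≠ 0 := by rintro rfl; have := h 0; simp at this; linarith [norm_nonneg (C.path 0)]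
  have hq : ∀ t, (C.path t - z) / (-z) ∈ slitPlane := by
    intro t
    apply mem_slitPlane_of_norm_sub_one_lt
    have : (C.path t - z) / (-z) - 1 = -(C.path t / z) := by field_simp; ring
    rw [this, norm_neg, norm_div, div_lt_one (norm_pos_iff.2 hz0)]
    exact h t
  have hc := C.continuous_path
  have h1 := C.wind_eq_of_log hz (l := fun t => log (-z) + log ((C.path t - z) / (-z)))
    (continuous_const.add (((hc.sub continuous_const).div_const _).clog hq))
    (by
      intro t
      rw [exp_add, exp_log (neg_ne_zero.2 hz0), exp_log (slitPlane_ne_zero (hq t)),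
        mul_div_cancel₀ _ (neg_ne_zero.2 hz0)]) 0
  rw [C.path_periodic, sub_self] at h1
  have h3 : (2 * Real.pi * I : ℂ) ≠ 0 := by simp [Real.pi_ne_zero]
  exact_mod_cast (mul_eq_zero.1 h1.symm).resolve_left h3

theorem exists_pos_dist {z : ℂ} (hz : z ∉ C.trace) : ∃ r > 0, ∀ t, r ≤ ‖C.path t - z‖ := by
  have ho : IsOpen C.traceᶜ := C.isCompact_trace.isClosed.isOpen_compl
  obtain ⟨r, hr, hb⟩ := Metric.isOpen_iff.1 ho z hz
  refine ⟨r, hr, fun t => ?_⟩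
  by_contra hc
  push Not at hc
  exact hb (by rwa [Metric.mem_ball, dist_eq_norm]) (C.mem_trace t)

theorem continuousOn_wind : ContinuousOn C.wind C.traceᶜ := by
  intro z hz
  obtain ⟨r, hr, h⟩ := C.exists_pos_dist hz
  apply ContinuousAt.continuousWithinAt
  have : C.wind =ᶠ[𝓝 z] fun _ => C.wind z := by
    filter_upwards [Metric.ball_mem_nhds z hr] with z' hz'
    rw [Metric.mem_ball, dist_eq_norm] at hz'
    exact C.wind_eq_of_dist_lt fun t => hz'.trans_le (h t)
  exact continuousAt_const.congr this.symm

theorem wind_eq_of_isPreconnected {A : Set ℂ} (hA : IsPreconnected A) (h : Disjoint A C.trace)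
    {x y : ℂ} (hx : x ∈ A) (hy : y ∈ A) : C.wind x = C.wind y :=
  hA.constant (C.continuousOn_wind.mono h.subset_compl_right) hx hy

theorem exists_norm_bound : ∃ R > 0, ∀ t, ‖C.path t‖ < R := by
  obtain ⟨R, hR⟩ := C.isCompact_trace.isBounded.exists_norm_le
  refine ⟨max R 0 + 1, by positivity, fun t => ?_⟩
  have := hR _ (C.mem_trace t)
  linarith [le_max_left R 0]

theorem isBounded_of_wind_ne_zero {z : ℂ} (hz : z ∉ C.trace) (h : C.wind z ≠ 0) :
    Bornology.IsBounded (connectedComponentIn C.traceᶜ z) := by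
  obtain ⟨R, -, hR⟩ := C.exists_norm_bound
  refine (Metric.isBounded_closedBall (x := (0 : ℂ)) (r := R)).subset fun w hw => ?_
  rw [mem_closedBall_zero_iff]
  by_contra hc
  push Not at hc
  apply h
  rw [← C.wind_eq_zero_of_norm_lt (z := w) fun t => (hR t).trans hc]
  exact C.wind_eq_of_isPreconnected isPreconnected_connectedComponentIn
    (disjoint_left.2 fun x hx => connectedComponentIn_subset _ _ hx)
    (mem_connectedComponentIn hz) hw

/-! ### Bounded components and winding numbers -/

theorem frontier_component_subset (z : ℂ) :
    closure (connectedComponentIn C.traceᶜ z) ⊆ connectedComponentIn C.traceᶜ z ∪ C.trace := by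
  have ho : IsOpen C.traceᶜ := C.isCompact_trace.isClosed.isOpen_compl
  intro x hx
  by_cases hxK : x ∈ C.trace
  · exact Or.inr hxK
  left
  obtain ⟨y, hy1, hy2⟩ := mem_closure_iff.1 hx _ (ho.connectedComponentIn (x := x))
    (mem_connectedComponentIn hxK)
  rw [connectedComponentIn_eq hy2, ← connectedComponentIn_eq hy1]
  exact mem_connectedComponentIn hxK

/-- The parametrization is a quotient map from a compact interval onto the curve and identifies only
parameters that differ by periods. A periodic function thus descends to the curve, and Tietze's
theorem extends it to the plane. -/
theorem exists_extension {m : ℝ → ℂ} (hm : Continuous m) (hp : ∀ t, m (t + n) = m t) :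
    ∃ F : ℂ → ℂ, Continuous F ∧ ∀ t, F (C.path t) = m t := by
  let π : Icc (0 : ℝ) n → C.trace := fun t => ⟨C.path t, C.mem_trace t⟩
  have hπc : Continuous π := (C.continuous_path.comp continuous_subtype_val).subtype_mk _
  have hπs : Function.Surjective π := by
    rintro ⟨x, hx⟩
    rw [C.trace_eq_image] at hx
    obtain ⟨t, ht, rfl⟩ := hx
    exact ⟨⟨t, ht⟩, rfl⟩
  have hq : IsQuotientMap π := hπc.isClosedMap.isQuotientMap hπc hπs
  have hmp : ∀ s t, C.path s = C.path t → m s = m t := by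
    intro s t h
    obtain ⟨j, rfl⟩ := C.path_inj h
    have : Function.Periodic m (n : ℝ) := hp
    exact (by simpa using (this.int_mul j s).symm)
  let f : C.trace → ℂ := fun x => m (Function.surjInv hπs x : Icc (0 : ℝ) n)
  have hf : Continuous f := by
    rw [hq.continuous_iff]
    have : f ∘ π = fun t : Icc (0 : ℝ) n => m t := by
      funext t
      refine hmp _ _ ?_
      exact congrArg Subtype.val (Function.surjInv_eq hπs (π t))
    rw [this]; exact hm.comp continuous_subtype_val
  obtain ⟨F, hF⟩ := ContinuousMap.exists_restrict_eq C.isCompact_trace.isClosed ⟨f, hf⟩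
  refine ⟨F, F.continuous, fun t => ?_⟩
  have h1 := congrArg (fun g : C(C.trace, ℂ) => g ⟨C.path t, C.mem_trace t⟩) hF
  simp only [ContinuousMap.restrict_apply, ContinuousMap.coe_mk] at h1
  rw [h1]
  exact hmp _ _ (congrArg Subtype.val (Function.surjInv_eq hπs ⟨C.path t, C.mem_trace t⟩))

/-- A function `(x - z)ᵖ` on a large circle around `z` does not extend to the plane without zeros
unless `p = 0`. -/
theorem _root_.PlaneCurve.eq_zero_of_extension {G : ℂ → ℂ} (hG : Continuous G)
    (h0 : ∀ x, G x ≠ 0) {z : ℂ} {p : ℤ} {R : ℝ} (hR : 0 < R)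
    (h : ∀ x, R ≤ ‖x - z‖ → G x = (x - z) ^ p) : p = 0 := by
  obtain ⟨g, hg, he⟩ := exists_log_of_convex (E := ℂ) convex_univ univ_nonempty isOpen_univ
    hG.continuousOn fun x _ => h0 x
  rw [continuousOn_univ] at hg
  have hR' : (R : ℂ) ≠ 0 := by exact_mod_cast hR.ne'
  -- On the circle of radius `R` a global logarithm of `G` returns to its value after one turn,
  -- whereas the evident logarithm of the `p`-th power gains `2πi p`.
  have key := log_sub_const (A := (univ : Set ℝ)) isPreconnected_univ
    (f := fun t : ℝ => g (z + R * exp (t * I))) (g := fun t : ℝ => p * (Real.log R + t * I))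
    (by fun_prop) (by fun_prop)
    (by
      intro t _
      have hn : ‖z + R * exp (t * I) - z‖ = R := by
        rw [add_sub_cancel_left, norm_mul, norm_exp_ofReal_mul_I, mul_one, norm_real,
          Real.norm_eq_abs, abs_of_pos hR]
      rw [he _ (mem_univ _), h _ hn.ge, add_sub_cancel_left, exp_int_mul, exp_add, ← ofReal_exp,
        Real.exp_log hR]) (mem_univ (2 * Real.pi)) (mem_univ 0)
  have h2 : exp (((2 * Real.pi : ℝ) : ℂ) * I) = 1 := by push_cast; exact exp_two_pi_mul_I
  have h3 : exp (((0 : ℝ) : ℂ) * I) = 1 := by simp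
  simp only [h2, h3] at key
  have h4 : (p : ℂ) * (2 * Real.pi * I) = 0 := by
    push_cast at key
    linear_combination -key
  have h5 : (2 * Real.pi * I : ℂ) ≠ 0 := by simp [Real.pi_ne_zero]
  exact_mod_cast (mul_eq_zero.1 h4).resolve_right h5

/-- The relation between the winding numbers says that `(x - z₁)ᵖ (x - z₂)^q` has a continuous
logarithm on the curve. Extended to the plane, it allows the zero or pole at `z₁` inside the bounded
component to be replaced by a nonvanishing function without changing anything near infinity. -/
theorem eq_zero_of_bounded_component {z₁ z₂ : ℂ} (h₁ : z₁ ∉ C.trace) (h₂ : z₂ ∉ C.trace)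
    (hb : Bornology.IsBounded (connectedComponentIn C.traceᶜ z₁))
    (h₁₂ : z₂ ∉ connectedComponentIn C.traceᶜ z₁) {p q : ℤ}
    (hpq : p * C.wind z₁ + q * C.wind z₂ = 0) : p = 0 := by
  classical
  set A := connectedComponentIn C.traceᶜ z₁ with hA
  have ho : IsOpen A := C.isCompact_trace.isClosed.isOpen_compl.connectedComponentIn
  have hAK : ∀ x ∈ A, x ∉ C.trace := fun x hx => connectedComponentIn_subset _ _ hx
  have hcl : closure A ⊆ A ∪ C.trace := C.frontier_component_subset z₁
  obtain ⟨l₁, hl₁, he₁⟩ := C.exists_log h₁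
  obtain ⟨l₂, hl₂, he₂⟩ := C.exists_log h₂
  obtain ⟨F, hF, hFm⟩ := C.exists_extension (m := fun t => p * l₁ t + q * l₂ t) (by fun_prop) (by
    intro t
    have e₁ := C.wind_eq_of_log h₁ hl₁ he₁ t
    have e₂ := C.wind_eq_of_log h₂ hl₂ he₂ t
    have : (p * C.wind z₁ + q * C.wind z₂ : ℂ) = 0 := by exact_mod_cast hpq
    linear_combination p * e₁ + q * e₂ + 2 * Real.pi * I * this)
  have hz₂ : ∀ x ∈ closure A, x - z₂ ≠ 0 := by
    intro x hx h
    rw [sub_eq_zero] at h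
    subst h
    rcases hcl hx with h | h
    exacts [h₁₂ h, h₂ h]
  have hz₁A : z₁ ∈ A := mem_connectedComponentIn h₁
  have hz₁ : ∀ x ∈ Aᶜ, x - z₁ ≠ 0 := by
    intro x hx h
    rw [sub_eq_zero] at h
    exact hx (h ▸ hz₁A)
  -- The two formulas agree on the frontier of `A`, where `exp F = (x - z₁)ᵖ (x - z₂)^q`. The pole
  -- at `z₂` is harmless because `z₂` is not in the closure of `A`.
  let G : ℂ → ℂ := A.piecewise (fun x => exp (F x) * (x - z₂) ^ (-q)) (fun x => (x - z₁) ^ p)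
  have hG : Continuous G := by
    refine continuous_piecewise ?_ ?_ ?_
    · intro x hx
      have hxK : x ∈ C.trace := by
        rcases hcl hx.1 with h | h
        · exact absurd (by rwa [ho.interior_eq]) hx.2
        · exact h
      obtain ⟨t, rfl⟩ := hxK
      have := hz₂ _ hx.1
      simp only [hFm]
      rw [exp_add, exp_int_mul, exp_int_mul, he₁, he₂, mul_assoc, ← zpow_add₀ this]
      simp
    · refine hF.continuousOn.cexp.mul (ContinuousOn.zpow₀ (by fun_prop) _ fun x hx => ?_)
      exact Or.inl (hz₂ x hx)
    · rw [ho.isClosed_compl.closure_eq]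
      exact ContinuousOn.zpow₀ (by fun_prop) _ fun x hx => Or.inl (hz₁ x hx)
  have hG0 : ∀ x, G x ≠ 0 := by
    intro x
    by_cases hx : x ∈ A
    · simp only [G, piecewise_eq_of_mem _ _ _ hx]
      exact mul_ne_zero (exp_ne_zero _) (zpow_ne_zero _ (hz₂ x (subset_closure hx)))
    · simp only [G, piecewise_eq_of_notMem _ _ _ hx]
      exact zpow_ne_zero _ (hz₁ x hx)
  obtain ⟨R, hR⟩ := hb.subset_ball z₁
  refine eq_zero_of_extension hG hG0 (z := z₁) (R := max R 1) (by positivity) fun x hx => ?_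
  refine piecewise_eq_of_notMem _ _ _ fun hxA => ?_
  have := hR hxA
  rw [Metric.mem_ball, dist_eq_norm] at this
  linarith [le_max_left R 1]

theorem isBounded_component_iff {z : ℂ} (hz : z ∉ C.trace) :
    Bornology.IsBounded (connectedComponentIn C.traceᶜ z) ↔ C.wind z ≠ 0 := by
  refine ⟨fun hb hw => ?_, C.isBounded_of_wind_ne_zero hz⟩
  obtain ⟨R, hR0, hR⟩ := C.exists_norm_bound
  obtain ⟨R', hR'⟩ := hb.exists_norm_le
  have hn : ‖((max R R' + 1 : ℝ) : ℂ)‖ = max R R' + 1 := by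
    rw [norm_real, Real.norm_eq_abs, abs_of_pos]
    linarith [le_max_left R R']
  have h2 : ((max R R' + 1 : ℝ) : ℂ) ∉ C.trace := by
    rintro ⟨t, ht⟩
    have := hR t
    rw [ht, hn] at this
    linarith [le_max_left R R']
  have h3 : ((max R R' + 1 : ℝ) : ℂ) ∉ connectedComponentIn C.traceᶜ z := by
    intro h
    have := hR' _ h
    rw [hn] at this
    linarith [le_max_right R R']
  -- If the winding number vanished, the exponent `p = 1` would be admissible, with a far away point
  -- as `z₂`.
  have := C.eq_zero_of_bounded_component hz h2 hb h3 (p := 1) (q := 0) (by rw [hw]; ring)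
  exact one_ne_zero this

/-- In different components, the exponents `p = wind z₂` and `q = -wind z₁` satisfy the relation
trivially and would have to vanish. -/
theorem wind_eq_wind {z₁ z₂ : ℂ} (h₁ : z₁ ∉ C.trace) (h₂ : z₂ ∉ C.trace) (hw₁ : C.wind z₁ ≠ 0)
    (hw₂ : C.wind z₂ ≠ 0) : C.wind z₁ = C.wind z₂ := by
  by_cases h : z₂ ∈ connectedComponentIn C.traceᶜ z₁
  · exact C.wind_eq_of_isPreconnected isPreconnected_connectedComponentIn
      (disjoint_left.2 fun x hx => connectedComponentIn_subset _ _ hx)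
      (mem_connectedComponentIn h₁) h
  · exact absurd (C.eq_zero_of_bounded_component h₁ h₂ ((C.isBounded_component_iff h₁).2 hw₁) h
      (p := C.wind z₂) (q := -C.wind z₁) (by ring)) hw₂

end ClosedCurve

end PlaneCurve


/-! ## The turning number -/

namespace PlaneCurve

open Complex Set Filter Topology

theorem exists_norm_log_lt {ρ : ℂ} (hρ : ρ ∈ slitPlane) {ε : ℝ} (hε : 0 < ε) :
    ∃ δ > 0, ∀ q : ℂ, ‖q - ρ‖ < δ → ‖log q - log ρ‖ < ε := by
  obtain ⟨δ, hδ, h⟩ := Metric.continuousAt_iff.1 (continuousAt_clog hρ) ε hε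
  exact ⟨δ, hδ, fun q hq => by simpa [dist_eq_norm] using h (by simpa [dist_eq_norm] using hq)⟩

theorem mul_mem_slitPlane {r : ℝ} (hr : 0 < r) {q : ℂ} (hq : q ∈ slitPlane) :
    (r : ℂ) * q ∈ slitPlane := by
  rw [mem_slitPlane_iff] at hq ⊢
  simp only [re_ofReal_mul, im_ofReal_mul]
  rcases hq with h | h
  · exact Or.inl (mul_pos hr h)
  · exact Or.inr (mul_ne_zero hr.ne' h)

/-- Nonzero nonnegative combinations of `1` and `ρ` stay uniformly away from the negative real
axis. -/
theorem exists_cone_mem_slitPlane {ρ : ℂ} (hρ : ρ ∈ slitPlane) :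
    ∃ ε > 0, ∀ (a b : ℝ) (e e' : ℂ), 0 ≤ a → 0 ≤ b → 0 < a + b → ‖e‖ < ε → ‖e'‖ < ε →
      a * (1 + e) + b * (ρ + e') ∈ slitPlane := by
  have hseg : segment ℝ (1 : ℂ) ρ ⊆ slitPlane :=
    starConvex_one_slitPlane.segment_subset hρ
  have hcomp : IsCompact (segment ℝ (1 : ℂ) ρ) := by
    rw [segment_eq_image]
    exact isCompact_Icc.image (by fun_prop)
  obtain ⟨ε, hε, hsub⟩ := hcomp.exists_thickening_subset_open isOpen_slitPlane hseg
  refine ⟨ε, hε, fun a b e e' ha hb hab he he' => ?_⟩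
  have h1 : (a / (a + b)) • (1 : ℂ) + (b / (a + b)) • ρ ∈ segment ℝ (1 : ℂ) ρ :=
    ⟨_, _, by positivity, by positivity, by field_simp, rfl⟩
  have h2 : (a / (a + b)) • (1 + e) + (b / (a + b)) • (ρ + e') ∈ slitPlane := by
    apply hsub
    rw [Metric.mem_thickening_iff]
    refine ⟨_, h1, ?_⟩
    have : (a / (a + b)) • (1 + e) + (b / (a + b)) • (ρ + e') -
        ((a / (a + b)) • (1 : ℂ) + (b / (a + b)) • ρ) = (a / (a + b)) • e + (b / (a + b)) • e' := by
      module
    rw [dist_eq_norm, this]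
    have hx : (0 : ℝ) ≤ a / (a + b) := by positivity
    have hy : (0 : ℝ) ≤ b / (a + b) := by positivity
    have hxy : a / (a + b) + b / (a + b) = 1 := by field_simp
    calc _ ≤ a / (a + b) * ‖e‖ + b / (a + b) * ‖e'‖ := by
          refine (norm_add_le _ _).trans_eq ?_
          rw [norm_smul, norm_smul, Real.norm_of_nonneg hx, Real.norm_of_nonneg hy]
      _ ≤ a / (a + b) * max ‖e‖ ‖e'‖ + b / (a + b) * max ‖e‖ ‖e'‖ := by
          gcongr
          exacts [le_max_left _ _, le_max_right _ _]
      _ = max ‖e‖ ‖e'‖ := by rw [← add_mul, hxy, one_mul]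
      _ < ε := max_lt he he'
  have h3 := mul_mem_slitPlane hab h2
  convert! h3 using 1
  have : (a + b : ℂ) ≠ 0 := by exact_mod_cast hab.ne'
  simp only [real_smul]
  push_cast
  field_simp

namespace ClosedCurve

variable {n : ℕ} (C : ClosedCurve n)

theorem one_le_n (C : ClosedCurve n) : (1 : ℝ) ≤ n := by exact_mod_cast C.n_pos

/-- Differentiability with an error uniform in the base point, from uniform continuity of the
derivative and the mean value inequality applied to `c(x) - x c'(s)`. -/
theorem exists_strict (k : ℤ) {ε : ℝ} (hε : 0 < ε) : ∃ δ > 0, ∀ s ∈ Icc (0 : ℝ) 1,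
    ∀ t ∈ Icc (0 : ℝ) 1, |t - s| < δ →
      ‖C.c k t - C.c k s - (t - s : ℝ) * C.d k s‖ ≤ ε * |t - s| := by
  have hu := isCompact_Icc.uniformContinuousOn_of_continuous (C.cont_d k)
  rw [Metric.uniformContinuousOn_iff_le] at hu
  obtain ⟨δ, hδ, h⟩ := hu ε hε
  refine ⟨δ, hδ, fun s hs t ht hst => ?_⟩
  have hsub : uIcc s t ⊆ Icc 0 1 := uIcc_subset_Icc hs ht
  have key := (convex_uIcc s t).norm_image_sub_le_of_norm_hasDerivWithin_le
    (f := fun x : ℝ => C.c k x - x * C.d k s) (f' := fun x => C.d k x - 1 * C.d k s) (C := ε)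
    (fun x hx => (((C.hasDeriv k x (hsub hx)).mono hsub).sub
      (((hasDerivAt_id (x : ℝ)).ofReal_comp.hasDerivWithinAt).mul_const _)))
    (fun x hx => by
      rw [one_mul, ← dist_eq_norm]
      refine h _ (hsub hx) _ hs ?_
      rw [Real.dist_eq]
      refine (abs_sub_left_of_mem_uIcc hx).trans hst.le) left_mem_uIcc right_mem_uIcc
  rw [Real.norm_eq_abs] at key
  convert! key using 2
  push_cast; ring

theorem exists_speed_bound (k : ℤ) : ∃ μ > 0, ∀ s ∈ Icc (0 : ℝ) 1, μ ≤ ‖C.d k s‖ := by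
  obtain ⟨x, hx, hmin⟩ := isCompact_Icc.exists_isMinOn (nonempty_Icc.2 zero_le_one)
    (C.cont_d k).norm
  exact ⟨_, norm_pos_iff.2 (C.d_ne k x hx), fun s hs => hmin hs⟩

theorem exists_ratio (k : ℤ) {ε : ℝ} (hε : 0 < ε) : ∃ δ > 0, ∀ s ∈ Icc (0 : ℝ) 1,
    ∀ t ∈ Icc (0 : ℝ) 1, s ≠ t → |t - s| < δ →
      ‖(C.c k t - C.c k s) / ((t - s : ℝ) * C.d k s) - 1‖ < ε := by
  obtain ⟨μ, hμ, hμd⟩ := C.exists_speed_bound k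
  obtain ⟨δ, hδ, h⟩ := C.exists_strict k (ε := ε * μ / 2) (by positivity)
  refine ⟨δ, hδ, fun s hs t ht hne hst => ?_⟩
  have h0 : ((t - s : ℝ) : ℂ) ≠ 0 := by exact_mod_cast sub_ne_zero.2 hne.symm
  have hp : 0 < |t - s| := abs_pos.2 (sub_ne_zero.2 hne.symm)
  have hd := C.d_ne k s hs
  rw [div_sub_one (mul_ne_zero h0 hd), norm_div, norm_mul, norm_real, Real.norm_eq_abs,
    div_lt_iff₀ (mul_pos hp (norm_pos_iff.2 hd))]
  calc _ ≤ ε * μ / 2 * |t - s| := h s hs t ht hst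
    _ < ε * μ * |t - s| := by nlinarith [mul_pos (mul_pos hε hμ) hp]
    _ ≤ ε * (|t - s| * ‖C.d k s‖) := by
      have := hμd s hs
      nlinarith [mul_le_mul_of_nonneg_left this (mul_pos hε hp).le]

/-- The pairs of parameters that bound a chord of the curve. -/
def chords (n : ℕ) : Set (ℝ × ℝ) := {p | p.1 < p.2 ∧ p.2 < p.1 + n}

theorem convex_chords : Convex ℝ (chords n) := by
  have : chords n = {p : ℝ × ℝ | (p.1 - p.2 : ℝ) < 0} ∩ {p : ℝ × ℝ | (p.2 - p.1 : ℝ) < n} := by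
    ext p
    simp only [chords, mem_inter_iff, mem_ofPred_eq]
    constructor <;> rintro ⟨h1, h2⟩ <;> constructor <;> linarith
  rw [this]
  exact (convex_halfSpace_lt (f := fun p : ℝ × ℝ => p.1 - p.2)
      (LinearMap.fst ℝ ℝ ℝ - LinearMap.snd ℝ ℝ ℝ).isLinear _).inter
    (convex_halfSpace_lt (f := fun p : ℝ × ℝ => p.2 - p.1)
      (LinearMap.snd ℝ ℝ ℝ - LinearMap.fst ℝ ℝ ℝ).isLinear _)

/-- A continuous logarithm of the chords of the curve. -/
structure IsChordLog (L : ℝ × ℝ → ℂ) : Prop where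
  cont : ContinuousOn L (chords n)
  exp_eq : ∀ s t : ℝ, s < t → t < s + n → exp (L (s, t)) = C.path t - C.path s

/-- Hopf's device: the parameter pairs form a convex strip, and simplicity of the curve says exactly
that no chord in it vanishes. -/
theorem exists_isChordLog : ∃ L, C.IsChordLog L := by
  obtain ⟨f, hf, he⟩ := exists_log_of_convex (convex_chords (n := n))
    ⟨(0, 1 / 2), by simp only [chords, mem_ofPred_eq]; constructor <;> linarith [C.one_le_n]⟩
    ((isOpen_lt continuous_fst continuous_snd).inter
      (isOpen_lt continuous_snd (continuous_fst.add continuous_const)))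
    (g := fun p => C.path p.2 - C.path p.1)
    (((C.continuous_path.comp continuous_snd).sub
      (C.continuous_path.comp continuous_fst)).continuousOn)
    (fun p hp => C.path_ne hp.1 hp.2)
  exact ⟨f, hf, fun s t h1 h2 => he (s, t) ⟨h1, h2⟩⟩

variable {C}

namespace IsChordLog

variable {L : ℝ × ℝ → ℂ}

/-- Replacing `(s, t)` by `(t, s + n)` reverses the chord, so the logarithm changes by a constant
odd multiple of `πi`. Applying this twice turns the tangent through a whole period, so `m` is the
turning number. -/
theorem exists_odd (hL : C.IsChordLog L) : ∃ m : ℤ, Odd m ∧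
    ∀ s t : ℝ, s < t → t < s + n → L (t, s + n) = L (s, t) + Real.pi * I * m := by
  have hn := C.one_le_n
  have hmaps : MapsTo (fun p : ℝ × ℝ => (p.2, p.1 + (n : ℝ))) (chords n) (chords n) := by
    rintro ⟨s, t⟩ ⟨h1, h2⟩
    exact ⟨h2, by simpa using h1⟩
  have he : ∀ s t : ℝ, s < t → t < s + n → exp (L (t, s + n)) = exp (L (s, t) + Real.pi * I) := by
    intro s t h1 h2
    rw [hL.exp_eq _ _ h2 (by linarith), exp_add, exp_pi_mul_I, hL.exp_eq _ _ h1 h2,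
      C.path_periodic]
    ring
  have key := fun p hp q hq => log_sub_const (A := chords n) convex_chords.isPreconnected
    (f := fun p => L (p.2, p.1 + n)) (g := fun p => L p + Real.pi * I)
    (hL.cont.comp (by fun_prop) hmaps) (hL.cont.add continuousOn_const)
    (fun p hp => he p.1 p.2 hp.1 hp.2) (x := p) (y := q) hp hq
  have h0 : ((0 : ℝ), (1 / 2 : ℝ)) ∈ chords n := ⟨by norm_num, by simp only []; linarith⟩
  obtain ⟨j, hj⟩ := exp_eq_exp_iff_exists_int.1 (he 0 (1 / 2) h0.1 h0.2)
  refine ⟨2 * j + 1, ⟨j, rfl⟩, fun s t h1 h2 => ?_⟩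
  have := key (s, t) ⟨h1, h2⟩ _ h0
  simp only at this
  push_cast
  linear_combination this + hj

theorem _root_.PlaneCurve.ClosedCurve.chordLog_shift {m : ℤ}
    (hm : ∀ s t : ℝ, s < t → t < s + n → L (t, s + n) = L (s, t) + Real.pi * I * m) {s t : ℝ}
    (h1 : s < t) (h2 : t < s + n) : L (s + n, t + n) = L (s, t) + 2 * Real.pi * I * m := by
  rw [hm t (s + n) h2 (by linarith), hm s t h1 h2]; ring

/-- Along one arc the logarithm of short chords follows the logarithm of the velocity. -/
theorem exists_arc (hL : C.IsChordLog L) (k : ℤ) {l : ℝ → ℂ} (hl : ContinuousOn l (Icc 0 1))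
    (he : ∀ t ∈ Icc (0 : ℝ) 1, exp (l t) = C.d k t) : ∃ p : ℂ,
      (∀ s ∈ Ico (0 : ℝ) 1, Tendsto (fun h : ℝ => L (k + s, k + s + h) - Real.log h)
        (𝓝[>] 0) (𝓝 (l s + p))) ∧
      (∀ s ∈ Ioc (0 : ℝ) 1, Tendsto (fun h : ℝ => L (k + s - h, k + s) - Real.log h)
        (𝓝[>] 0) (𝓝 (l s + p))) := by
  have hn := C.one_le_n
  let q : ℝ × ℝ → ℂ := fun x => (C.c k x.2 - C.c k x.1) / ((x.2 - x.1 : ℝ) * C.d k x.1)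
  obtain ⟨δ₀, hδ₀, h₀⟩ := C.exists_ratio k (ε := 1) one_pos
  -- A convex strip along the diagonal on which the difference quotient, divided by the velocity,
  -- stays near `1`. There the chord logarithm is `log (t - s) + l s + log q` up to the constant
  -- `p`, and `log q` tends to `0` at the diagonal.
  let T : Set (ℝ × ℝ) := {x | 0 ≤ x.1 ∧ x.1 < x.2 ∧ x.2 ≤ 1 ∧ x.2 - x.1 < min δ₀ 1}
  have hT1 : ∀ x ∈ T, x.1 ∈ Icc (0 : ℝ) 1 := fun x hx => ⟨hx.1, by linarith [hx.2.1, hx.2.2.1]⟩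
  have hT2 : ∀ x ∈ T, x.2 ∈ Icc (0 : ℝ) 1 := fun x hx => ⟨by linarith [hx.1, hx.2.1], hx.2.2.1⟩
  have hTc : Convex ℝ T := by
    rintro ⟨a, b⟩ ⟨h1, h2, h3, h4⟩ ⟨a', b'⟩ ⟨h1', h2', h3', h4'⟩ u v hu hv huv
    simp only at h1 h2 h3 h4 h1' h2' h3' h4'
    refine ⟨?_, ?_, ?_, ?_⟩ <;> simp only [Prod.smul_mk, Prod.mk_add_mk, smul_eq_mul]
    · positivity
    · rcases eq_or_lt_of_le hu with rfl | hu'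
      · have : v = 1 := by linarith
        subst this; linarith
      · nlinarith
    · nlinarith
    · rcases eq_or_lt_of_le hu with rfl | hu'
      · have : v = 1 := by linarith
        subst this; linarith
      · have : min δ₀ 1 = u * min δ₀ 1 + v * min δ₀ 1 := by rw [← add_mul, huv, one_mul]
        rw [this]; nlinarith
  have hq1 : ∀ x ∈ T, q x ∈ slitPlane := by
    intro x hx
    apply mem_slitPlane_of_norm_sub_one_lt
    refine h₀ _ (hT1 x hx) _ (hT2 x hx) hx.2.1.ne ?_
    rw [abs_of_pos (sub_pos.2 hx.2.1)]
    exact hx.2.2.2.trans_le (min_le_left _ _)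
  have hden : ∀ x ∈ T, ((x.2 - x.1 : ℝ) : ℂ) * C.d k x.1 ≠ 0 := fun x hx =>
    mul_ne_zero (by exact_mod_cast (sub_pos.2 hx.2.1).ne') (C.d_ne k _ (hT1 x hx))
  have hqc : ContinuousOn q T := by
    refine ContinuousOn.div ?_ ?_ hden
    · exact ((C.cont_c k).comp continuousOn_snd hT2).sub ((C.cont_c k).comp continuousOn_fst hT1)
    · exact (by fun_prop : ContinuousOn (fun x : ℝ × ℝ => ((x.2 - x.1 : ℝ) : ℂ)) T).mul
        ((C.cont_d k).comp continuousOn_fst hT1)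
  have hch : MapsTo (fun x : ℝ × ℝ => ((k : ℝ) + x.1, (k : ℝ) + x.2)) T (chords n) := by
    rintro x ⟨h1, h2, h3, h4⟩
    refine ⟨by simpa using h2, ?_⟩
    simp only
    linarith [min_le_right δ₀ 1]
  have key := fun x hx y hy => log_sub_const (A := T) hTc.isPreconnected
    (f := fun x : ℝ × ℝ => L (k + x.1, k + x.2))
    (g := fun x => Real.log (x.2 - x.1) + l x.1 + log (q x))
    (hL.cont.comp (by fun_prop) hch)
    (((continuous_ofReal.comp_continuousOn (ContinuousOn.log (by fun_prop)
      (fun x hx => (sub_pos.2 hx.2.1).ne'))).add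
        (hl.comp continuousOn_fst hT1)).add (hqc.clog hq1))
    (by
      intro x hx
      have hx' := hch hx
      have hpos := sub_pos.2 hx.2.1
      rw [hL.exp_eq _ _ hx'.1 hx'.2, C.path_add k (hT1 x hx), C.path_add k (hT2 x hx), exp_add,
        exp_add, ← ofReal_exp, Real.exp_log hpos, he _ (hT1 x hx),
        exp_log (slitPlane_ne_zero (hq1 x hx)), mul_div_cancel₀ _ (hden x hx)]) (x := x) (y := y)
          hx hy
  have hδ₁ : 0 < min δ₀ 1 := by positivity
  set x₀ : ℝ × ℝ := (0, min δ₀ 1 / 2) with hx₀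
  have hx₀T : x₀ ∈ T :=
    ⟨le_rfl, by simp only [hx₀]; positivity, by simp only [hx₀]; linarith [min_le_right δ₀ 1], by
      simp only [hx₀]; linarith⟩
  set p := L (k + x₀.1, k + x₀.2) - (Real.log (x₀.2 - x₀.1) + l x₀.1 + log (q x₀)) with hp
  have hval : ∀ x ∈ T, L (k + x.1, k + x.2) - Real.log (x.2 - x.1) = l x.1 + p + log (q x) := by
    intro x hx
    have := key x hx x₀ hx₀T
    rw [← hp] at this
    linear_combination this
  have hlim : ∀ (f : ℝ → ℝ × ℝ), (∀ᶠ h in 𝓝[>] (0 : ℝ), f h ∈ T ∧ (f h).2 - (f h).1 = h) →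
      Tendsto (fun h => log (q (f h))) (𝓝[>] 0) (𝓝 0) := by
    intro f hf
    rw [← log_one]
    refine (continuousAt_clog one_mem_slitPlane).tendsto.comp ?_
    rw [Metric.tendsto_nhds]
    intro ε hε
    obtain ⟨δ, hδ, hr⟩ := C.exists_ratio k hε
    filter_upwards [hf, Ioo_mem_nhdsGT hδ] with h h1 h2
    rw [dist_eq_norm]
    refine hr _ (hT1 _ h1.1) _ (hT2 _ h1.1) h1.1.2.1.ne ?_
    rw [h1.2, abs_of_pos h2.1]
    exact h2.2
  refine ⟨p, fun s hs => ?_, fun s hs => ?_⟩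
  · have hev : ∀ᶠ h in 𝓝[>] (0 : ℝ), (s, s + h) ∈ T ∧ (s, s + h).2 - (s, s + h).1 = h := by
      filter_upwards [Ioo_mem_nhdsGT (show 0 < min (min δ₀ 1) (1 - s) from
        lt_min hδ₁ (by linarith [hs.2]))] with h hh
      have h1 := hh.2.trans_le (min_le_left _ _)
      have h2 := hh.2.trans_le (min_le_right _ _)
      exact ⟨⟨hs.1, by simpa using hh.1, by simp only; linarith, by simpa using h1⟩, by simp⟩
    have h1 := (tendsto_const_nhds (x := l s + p)).add (hlim _ hev)
    rw [add_zero] at h1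
    refine h1.congr' ?_
    filter_upwards [hev] with h hh
    have := hval _ hh.1
    rw [hh.2] at this
    rw [← this, add_assoc]
  · have hev : ∀ᶠ h in 𝓝[>] (0 : ℝ), (s - h, s) ∈ T ∧ (s - h, s).2 - (s - h, s).1 = h := by
      filter_upwards [Ioo_mem_nhdsGT (show 0 < min (min δ₀ 1) s from lt_min hδ₁ hs.1)] with h hh
      have h1 := hh.2.trans_le (min_le_left _ _)
      have h2 := hh.2.trans_le (min_le_right _ _)
      exact ⟨⟨by simp only; linarith, by simpa using hh.1, hs.2, by simpa using h1⟩, by simp⟩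
    have hls : Tendsto (fun h => l (s - h)) (𝓝[>] 0) (𝓝 (l s)) := by
      refine (hl s ⟨hs.1.le, hs.2⟩).tendsto.comp (tendsto_nhdsWithin_iff.2 ⟨?_, ?_⟩)
      · have : Tendsto (fun h : ℝ => s - h) (𝓝 0) (𝓝 (s - 0)) := by
          exact (continuous_const.sub continuous_id).tendsto 0
        rw [sub_zero] at this
        exact this.mono_left nhdsWithin_le_nhds
      · filter_upwards [hev] with h hh
        exact hT1 _ hh.1
    have h1 := (hls.add_const p).add (hlim _ hev)
    rw [add_zero] at h1
    refine h1.congr' ?_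
    filter_upwards [hev] with h hh
    have := hval _ hh.1
    rw [hh.2] at this
    rw [← this, add_sub_assoc]

end IsChordLog

end ClosedCurve

end PlaneCurve


/-! ### Chords at a corner, and the total turning -/

namespace PlaneCurve

open Complex Set Filter Topology

theorem exists_log_Icc {g : ℝ → ℂ} (hg : ContinuousOn g (Icc 0 1))
    (h0 : ∀ t ∈ Icc (0 : ℝ) 1, g t ≠ 0) : ∃ l : ℝ → ℂ, ContinuousOn l (Icc 0 1) ∧
    ∀ t ∈ Icc (0 : ℝ) 1, exp (l t) = g t := by
  have h01 : (0 : ℝ) ≤ 1 := zero_le_one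
  have hc : Continuous fun t => g (projIcc 0 1 h01 t) :=
    (continuousOn_iff_continuous_domRestrict.1 hg).comp (continuous_projIcc (h := h01))
  obtain ⟨f, hf, hfe⟩ := exists_log_of_convex (E := ℝ) convex_univ univ_nonempty isOpen_univ
    hc.continuousOn (fun t _ => h0 _ (projIcc 0 1 h01 t).2)
  refine ⟨f, hf.mono (subset_univ _), fun t ht => ?_⟩
  rw [hfe t (mem_univ t), projIcc_of_mem _ ht]

namespace ClosedCurve

variable {n : ℕ} {C : ClosedCurve n}

/-- A short chord across the corner is nearly a nonnegative combination of the two one-sided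
velocities. Without a cusp, that cone, divided by the incoming velocity, avoids the negative axis,
so the principal logarithm follows the chord from one side of the corner to the other. -/
theorem IsChordLog.corner {L : ℝ × ℝ → ℂ} (hL : C.IsChordLog L) (k : ℤ) {a b : ℂ}
    (ha : Tendsto (fun h : ℝ => L (k + 1 - h, k + 1) - Real.log h) (𝓝[>] 0) (𝓝 a))
    (hb : Tendsto (fun h : ℝ => L (k + 1, k + 1 + h) - Real.log h) (𝓝[>] 0) (𝓝 b)) :
    b = a + log (C.d (k + 1) 0 / C.d k 1) := by
  have hn := C.one_le_n
  have h01 : (0 : ℝ) ∈ Icc (0 : ℝ) 1 := by simp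
  have h11 : (1 : ℝ) ∈ Icc (0 : ℝ) 1 := by simp
  set v := C.d k 1 with hv
  set ρ := C.d (k + 1) 0 / v with hρ
  have hv0 : v ≠ 0 := C.d_ne k 1 h11
  have hvp : 0 < ‖v‖ := norm_pos_iff.2 hv0
  have hρs : ρ ∈ slitPlane := C.noCusp k
  obtain ⟨ε, hε, hcone⟩ := exists_cone_mem_slitPlane hρs
  -- the quotients of chords at the corner
  have hr : ∀ η > 0, ∃ δ > 0, δ < 1 / 2 ∧ ∀ h, 0 < h → h < δ →
      ‖(C.path (k + 1 + h) - C.path (k + 1)) / (h * v) - ρ‖ < η ∧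
      ‖(C.path (k + 1) - C.path (k + 1 - h)) / (h * v) - 1‖ < η := by
    intro η hη
    obtain ⟨δ₁, hδ₁, h1⟩ := C.exists_strict k (ε := η * ‖v‖ / 2) (by positivity)
    obtain ⟨δ₂, hδ₂, h2⟩ := C.exists_strict (k + 1) (ε := η * ‖v‖ / 2) (by positivity)
    refine ⟨min (min δ₁ δ₂) (1 / 4), by positivity, (min_le_right _ _).trans_lt (by norm_num),
      fun h hh hlt => ?_⟩
    have hlt1 : h < δ₁ := hlt.trans_le ((min_le_left _ _).trans (min_le_left _ _))
    have hlt2 : h < δ₂ := hlt.trans_le ((min_le_left _ _).trans (min_le_right _ _))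
    have hlt3 : h < 1 / 4 := hlt.trans_le (min_le_right _ _)
    have hh0 : (h : ℂ) ≠ 0 := by exact_mod_cast hh.ne'
    have e0 : C.path (k + 1) = C.c (k + 1) 0 := by
      have := C.path_add (k + 1) h01; push_cast at this; rwa [add_zero] at this
    have e1 : C.path (k + 1 + h) = C.c (k + 1) h := by
      have := C.path_add (k + 1) (s := h) ⟨hh.le, by linarith⟩; push_cast at this; exact this
    have e2 : C.path (k + 1 - h) = C.c k (1 - h) := by
      rw [← C.path_add k (s := 1 - h) ⟨by linarith, by linarith⟩]; congr 1; ring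
    have hkey : η * ‖v‖ / 2 * h < η * (h * ‖v‖) := by
      nlinarith [mul_pos (mul_pos hη hvp) hh]
    constructor
    · have := h2 0 h01 h ⟨hh.le, by linarith⟩ (by rwa [sub_zero, abs_of_pos hh])
      rw [sub_zero, abs_of_pos hh] at this
      rw [e0, e1, hρ, div_sub_div _ _ (mul_ne_zero hh0 hv0) hv0,
        show (C.c (k + 1) h - C.c (k + 1) 0) * v - h * v * C.d (k + 1) 0 =
          (C.c (k + 1) h - C.c (k + 1) 0 - h * C.d (k + 1) 0) * v by ring, mul_div_mul_right _ _ hv0,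
        norm_div, norm_mul, norm_real, Real.norm_eq_abs, abs_of_pos hh, div_lt_iff₀ (by positivity)]
      exact this.trans_lt hkey
    · have := h1 1 h11 (1 - h) ⟨by linarith, by linarith⟩ (by
        rw [sub_sub_cancel_left, abs_neg, abs_of_pos hh]; exact hlt1)
      rw [sub_sub_cancel_left, abs_neg, abs_of_pos hh] at this
      rw [e0, e2, ← C.join, div_sub_one (mul_ne_zero hh0 hv0),
        norm_div, norm_mul, norm_real, Real.norm_eq_abs, abs_of_pos hh, div_lt_iff₀ (by positivity)]
      refine lt_of_eq_of_lt ?_ (this.trans_lt hkey)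
      rw [← norm_neg]; congr 1; push_cast; ring
  obtain ⟨δ, hδ, hδ2, hδr⟩ := hr ε hε
  -- Pairs with `s` before and `t` after the corner, not both at it. This set is convex and contains
  -- the one-sided chords of both arcs.
  let Q : Set (ℝ × ℝ) := {x | (k + 1 - δ < x.1 ∧ x.1 ≤ k + 1) ∧ (k + 1 ≤ x.2 ∧ x.2 < k + 1 + δ) ∧
    x.1 - x.2 < 0}
  have hQc : Convex ℝ Q := by
    have : Q = (Ioc (k + 1 - δ : ℝ) (k + 1) ×ˢ Ico (k + 1 : ℝ) (k + 1 + δ)) ∩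
        {x : ℝ × ℝ | (x.1 - x.2 : ℝ) < 0} := by
      ext x; simp only [Q, mem_inter_iff, mem_ofPred_eq, mem_prod, mem_Ioc, mem_Ico, and_assoc]
    rw [this]
    exact ((convex_Ioc _ _).prod (convex_Ico _ _)).inter
      (convex_halfSpace_lt (f := fun p : ℝ × ℝ => p.1 - p.2)
        (LinearMap.fst ℝ ℝ ℝ - LinearMap.snd ℝ ℝ ℝ).isLinear _)
  have hQch : ∀ x ∈ Q, x ∈ chords n := by
    rintro x ⟨⟨h1, h2⟩, ⟨h3, h4⟩, h5⟩
    exact ⟨by linarith, by linarith⟩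
  have hQs : ∀ x ∈ Q, (C.path x.2 - C.path x.1) / v ∈ slitPlane := by
    rintro ⟨s, t⟩ ⟨⟨h1, h2⟩, ⟨h3, h4⟩, h5⟩
    simp only at h1 h2 h3 h4 h5 ⊢
    have hs : ∃ e : ℂ, ‖e‖ < ε ∧ (C.path (k + 1) - C.path s) / v = (k + 1 - s : ℝ) * (1 + e) := by
      rcases eq_or_lt_of_le h2 with rfl | h2
      · exact ⟨0, by simpa using hε, by simp⟩
      · have hp : (0 : ℝ) < k + 1 - s := by linarith
        have := (hδr (k + 1 - s) hp (by linarith)).2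
        rw [sub_sub_cancel] at this
        refine ⟨_, this, ?_⟩
        have : ((k + 1 - s : ℝ) : ℂ) ≠ 0 := by exact_mod_cast hp.ne'
        field_simp
        ring
    have ht : ∃ e : ℂ, ‖e‖ < ε ∧ (C.path t - C.path (k + 1)) / v = (t - (k + 1) : ℝ) * (ρ + e) := by
      rcases eq_or_lt_of_le h3 with h3 | h3
      · exact ⟨0, by simpa using hε, by simp [← h3]⟩
      · have hp : (0 : ℝ) < t - (k + 1) := by linarith
        have := (hδr (t - (k + 1)) hp (by linarith)).1
        rw [add_sub_cancel] at this
        refine ⟨_, this, ?_⟩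
        have : ((t - (k + 1) : ℝ) : ℂ) ≠ 0 := by exact_mod_cast hp.ne'
        rw [add_sub_cancel, ← div_div, mul_div_assoc', mul_div_cancel₀ _ this]
    obtain ⟨e, he, hse⟩ := hs
    obtain ⟨e', he', hte⟩ := ht
    have : (C.path t - C.path s) / v =
        (k + 1 - s : ℝ) * (1 + e) + (t - (k + 1) : ℝ) * (ρ + e') := by
      rw [← hse, ← hte]; ring
    rw [this]
    exact hcone _ _ _ _ (by linarith) (by linarith) (by linarith) he he'
  have hc := C.continuous_path
  have key := fun x hx y hy => log_sub_const (A := Q) hQc.isPreconnected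
    (f := L) (g := fun x => log v + log ((C.path x.2 - C.path x.1) / v))
    (hL.cont.mono hQch)
    (continuousOn_const.add (ContinuousOn.clog
      ((((hc.comp continuous_snd).sub (hc.comp continuous_fst)).div_const v).continuousOn) hQs))
    (fun x hx => by
      rw [hL.exp_eq _ _ (hQch x hx).1 (hQch x hx).2, exp_add, exp_log hv0,
        exp_log (slitPlane_ne_zero (hQs x hx)), mul_div_cancel₀ _ hv0]) (x := x) (y := y) hx hy
  have hmem1 : ∀ h, 0 < h → h < δ → ((k + 1 - h : ℝ), (k + 1 : ℝ)) ∈ Q := fun h h1 h2 =>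
    ⟨⟨by simp only; linarith, by simp only; linarith⟩,
      ⟨by simp only; linarith, by simp only; linarith⟩, by simp only; linarith⟩
  have hmem2 : ∀ h, 0 < h → h < δ → ((k + 1 : ℝ), (k + 1 + h : ℝ)) ∈ Q := fun h h1 h2 =>
    ⟨⟨by simp only; linarith, by simp only; linarith⟩,
      ⟨by simp only; linarith, by simp only; linarith⟩, by simp only; linarith⟩
  have hlog : ∀ {w : ℂ} {h : ℝ}, 0 < h → w ≠ 0 → log (w / v) - Real.log h = log (w / (h * v)) := by
    intro w h hh hw
    have : w / v = (h : ℝ) * (w / (h * v)) := by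
      have : (h : ℂ) ≠ 0 := by exact_mod_cast hh.ne'
      field_simp
    have h' : w / (h * v) ≠ 0 :=
      div_ne_zero hw (mul_ne_zero (by exact_mod_cast hh.ne') hv0)
    rw [this, log_ofReal_mul hh h', add_sub_cancel_left]
  have hl1 : Tendsto (fun h : ℝ => log ((C.path (k + 1) - C.path (k + 1 - h)) / (h * v)))
      (𝓝[>] 0) (𝓝 (log 1)) := by
    refine (continuousAt_clog one_mem_slitPlane).tendsto.comp ?_
    rw [Metric.tendsto_nhds]
    intro η hη
    obtain ⟨δ', hδ', -, hr'⟩ := hr η hη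
    filter_upwards [Ioo_mem_nhdsGT hδ'] with h hh
    rw [dist_eq_norm]; exact (hr' h hh.1 hh.2).2
  have hl2 : Tendsto (fun h : ℝ => log ((C.path (k + 1 + h) - C.path (k + 1)) / (h * v)))
      (𝓝[>] 0) (𝓝 (log ρ)) := by
    refine (continuousAt_clog hρs).tendsto.comp ?_
    rw [Metric.tendsto_nhds]
    intro η hη
    obtain ⟨δ', hδ', -, hr'⟩ := hr η hη
    filter_upwards [Ioo_mem_nhdsGT hδ'] with h hh
    rw [dist_eq_norm]; exact (hr' h hh.1 hh.2).1
  rw [log_one] at hl1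
  have hfin := (hb.sub hl2).sub (ha.sub hl1)
  have hzero : Tendsto (fun h : ℝ => L (k + 1, k + 1 + h) - Real.log h -
      log ((C.path (k + 1 + h) - C.path (k + 1)) / (h * v)) -
      (L (k + 1 - h, k + 1) - Real.log h -
        log ((C.path (k + 1) - C.path (k + 1 - h)) / (h * v)))) (𝓝[>] 0) (𝓝 0) := by
    refine tendsto_const_nhds.congr' ?_
    filter_upwards [Ioo_mem_nhdsGT hδ] with h hh
    have h1 := hmem1 h hh.1 hh.2
    have h2 := hmem2 h hh.1 hh.2
    have := key _ h1 _ h2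
    simp only at this
    rw [← hlog hh.1 (C.path_ne (hQch _ h1).1 (hQch _ h1).2),
      ← hlog hh.1 (C.path_ne (hQch _ h2).1 (hQch _ h2).2)]
    linear_combination this
  have := tendsto_nhds_unique hfin hzero
  linear_combination this

/-- The total turning of the tangent is the sum of the changes of direction along the arcs and at
the corners. -/
theorem turning_sum {L : ℝ × ℝ → ℂ} (hL : C.IsChordLog L) {m : ℤ}
    (hm : ∀ s t : ℝ, s < t → t < s + n → L (t, s + n) = L (s, t) + Real.pi * I * m)
    {l : ℤ → ℝ → ℂ} (hl : ∀ k, ContinuousOn (l k) (Icc 0 1))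
    (he : ∀ k, ∀ t ∈ Icc (0 : ℝ) 1, exp (l k t) = C.d k t) :
    2 * Real.pi * I * m =
      ∑ k ∈ Finset.range n, (l k 1 - l k 0 + log (C.d (k + 1) 0 / C.d k 1)) := by
  choose p hp1 hp2 using fun k => hL.exists_arc k (hl k) (he k)
  have hR : ∀ k : ℤ, Tendsto (fun h : ℝ => L (k, k + h) - Real.log h) (𝓝[>] 0)
      (𝓝 (l k 0 + p k)) := by
    intro k
    have := hp1 k 0 (by simp)
    simpa only [add_zero] using this
  -- The limit of the chord logarithm at the start of an arc advances by the turning along the arc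
  -- and at its final corner, so the sum telescopes.
  have hstep : ∀ k : ℤ, l (k + 1) 0 + p (k + 1) =
      l k 0 + p k + (l k 1 - l k 0 + log (C.d (k + 1) 0 / C.d k 1)) := by
    intro k
    have h1 := hR (k + 1)
    push_cast at h1
    rw [hL.corner k (hp2 k 1 (by simp)) h1]
    ring
  have hsum : ∀ N : ℕ, ∑ k ∈ Finset.range N, (l k 1 - l k 0 + log (C.d (k + 1) 0 / C.d k 1)) =
      (l N 0 + p N) - (l 0 0 + p 0) := by
    intro N
    induction N with
    | zero => simp
    | succ N ih =>
      rw [Finset.sum_range_succ, ih]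
      have := hstep N
      push_cast
      linear_combination -this
  rw [hsum]
  have h0 := hR 0
  have hN := hR n
  have hsh : Tendsto (fun h : ℝ => L ((n : ℤ), (n : ℤ) + h) - Real.log h) (𝓝[>] 0)
      (𝓝 (l 0 0 + p 0 + 2 * Real.pi * I * m)) := by
    refine (h0.add_const (2 * Real.pi * I * m)).congr' ?_
    filter_upwards [Ioo_mem_nhdsGT one_pos] with h hh
    have := chordLog_shift hm (s := 0) (t := h) hh.1 (by linarith [hh.2, C.one_le_n])
    simp only [Int.cast_natCast, Int.cast_zero, zero_add] at this ⊢
    rw [add_comm (n : ℝ) h, this]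
    ring
  rw [tendsto_nhds_unique hN hsh]
  ring

set_option maxHeartbeats 1600000 in
/-- The winding number on either side of a regular point of the curve. -/
theorem wind_near {L : ℝ × ℝ → ℂ} (hL : C.IsChordLog L) {m : ℤ}
    (hm : ∀ s t : ℝ, s < t → t < s + n → L (t, s + n) = L (s, t) + Real.pi * I * m)
    (k : ℤ) {s : ℝ} (hs : s ∈ Ioo (0 : ℝ) 1) {ω : ℂ} {σ : ℤ} (hσ : σ = 1 ∨ σ = -1)
    (hω : 0 < σ * ω.im) {z : ℝ → ℂ}
    (hz : Tendsto (fun h : ℝ => (z h - C.c k s) / (h * C.d k s)) (𝓝[>] 0) (𝓝 ω)) :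
    ∀ᶠ h in 𝓝[>] (0 : ℝ), z h ∉ C.trace ∧ 2 * C.wind (z h) = m + σ := by
  have hn := C.one_le_n
  have hsI : s ∈ Icc (0 : ℝ) 1 := Ioo_subset_Icc_self hs
  set v := C.d k s with hv
  have hv0 : v ≠ 0 := C.d_ne k s hsI
  have hvp : 0 < ‖v‖ := norm_pos_iff.2 hv0
  have hσ2 : (σ : ℝ) ^ 2 = 1 := by rcases hσ with rfl | rfl <;> norm_num
  have hσa : |(σ : ℝ)| = 1 := by rcases hσ with rfl | rfl <;> norm_num
  have hω' : 0 < |ω.im| := abs_pos.2 (by rintro h; simp [h] at hω)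
  have hωσ : (σ : ℝ) * ω.im = |ω.im| := by
    rw [← abs_of_pos hω, abs_mul, hσa, one_mul]
  set s₀ : ℝ := k + s with hs₀
  have hp0 : C.path s₀ = C.c k s := C.path_add k hsI
  -- logarithms near `± σ i`
  have hiσ : ∀ τ : ℝ, τ = 1 ∨ τ = -1 → (I * σ * τ : ℂ) ∈ slitPlane := by
    intro τ hτ
    rw [mem_slitPlane_iff]; right
    rcases hσ with rfl | rfl <;> rcases hτ with rfl | rfl <;> simp
  -- Seen from a point on the side `σ`, a straight line sweeps out the angle `σ π`. The factor `iσ`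
  -- places this sweep around the positive real axis.
  have hlogi : log (I * σ * (1 : ℝ)) - log (I * σ * (-1 : ℝ)) = Real.pi * I * σ := by
    rcases hσ with rfl | rfl <;> simp [log_I, log_neg_I] <;> ring
  obtain ⟨r₁, hr₁, hlog₁⟩ := exists_norm_log_lt (hiσ 1 (Or.inl rfl)) (ε := 1 / 10) (by norm_num)
  obtain ⟨r₂, hr₂, hlog₂⟩ := exists_norm_log_lt (hiσ (-1) (Or.inr rfl)) (ε := 1 / 10) (by norm_num)
  obtain ⟨r₃, hr₃, hlog₃⟩ := exists_norm_log_lt one_mem_slitPlane (ε := 1 / 10) (by norm_num)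
  rw [log_one] at hlog₃
  -- The last condition places the approach direction `ω` well outside the double cone of slope
  -- about `ε` that contains the curve near `s₀`.
  obtain ⟨ε, hε, hε1, hεr₁, hεr₂, hεr₃, hεω⟩ : ∃ ε > 0, ε < 1 / 2 ∧ 2 * ε < r₁ ∧ 2 * ε < r₂ ∧
      ε < r₃ ∧ 4 * ε * (|ω.re| + 1) < |ω.im| := by
    refine ⟨min (min (1 / 4) (min (r₁ / 4) (r₂ / 4))) (min (r₃ / 2) (|ω.im| / (8 * (|ω.re| + 1)))),
      by positivity, ?_, ?_, ?_, ?_, ?_⟩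
    · exact ((min_le_left _ _).trans (min_le_left _ _)).trans_lt (by norm_num)
    · have := (min_le_left (min (1 / 4) (min (r₁ / 4) (r₂ / 4)))
        (min (r₃ / 2) (|ω.im| / (8 * (|ω.re| + 1))))).trans
          ((min_le_right _ _).trans (min_le_left _ _))
      linarith
    · have := (min_le_left (min (1 / 4) (min (r₁ / 4) (r₂ / 4)))
        (min (r₃ / 2) (|ω.im| / (8 * (|ω.re| + 1))))).trans
          ((min_le_right _ _).trans (min_le_right _ _))
      linarith
    · exact ((min_le_right _ _).trans (min_le_left _ _)).trans_lt (by linarith)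
    · have := (min_le_right (min (1 / 4) (min (r₁ / 4) (r₂ / 4)))
        (min (r₃ / 2) (|ω.im| / (8 * (|ω.re| + 1))))).trans (min_le_right _ _)
      rw [le_div_iff₀ (by positivity)] at this
      linarith
  -- the arc near `s₀`
  obtain ⟨δ, hδ, hstr⟩ := C.exists_strict k (ε := ε * ‖v‖) (by positivity)
  obtain ⟨l, hl, hle⟩ := exists_log_Icc (C.cont_d k) (C.d_ne k)
  obtain ⟨p, hp1, hp2⟩ := hL.exists_arc k hl hle
  have hR := Metric.tendsto_nhds.1 (hp1 s ⟨hs.1.le, hs.2⟩) (1 / 10) (by norm_num)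
  have hLf := Metric.tendsto_nhds.1 (hp2 s ⟨hs.1, hs.2.le⟩) (1 / 10) (by norm_num)
  -- Forward and backward chords of length about `η` have the same limiting logarithm `l s + p`; the
  -- two errors are made smaller than `1 / 10` at once.
  obtain ⟨η, ⟨hη, hηlt⟩, hRη, hLη⟩ : ∃ η : ℝ, (0 < η ∧ η < min (min δ (1 / 2)) (min s (1 - s))) ∧
      ‖L (s₀, s₀ + η) - Real.log η - (l s + p)‖ < 1 / 10 ∧
      ‖L (s₀ - η, s₀) - Real.log η - (l s + p)‖ < 1 / 10 := by
    have hpos : (0 : ℝ) < min (min δ (1 / 2)) (min s (1 - s)) := by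
      have := hs.1; have : 0 < 1 - s := by linarith [hs.2]
      positivity
    obtain ⟨η, h1, h2, h3⟩ := (Filter.Eventually.and (Ioo_mem_nhdsGT hpos) (hR.and hLf)).exists
    refine ⟨η, h1, ?_, ?_⟩
    · rwa [dist_eq_norm] at h2
    · rwa [dist_eq_norm] at h3
  have hηδ : η < δ := hηlt.trans_le ((min_le_left _ _).trans (min_le_left _ _))
  have hη2 : η < 1 / 2 := hηlt.trans_le ((min_le_left _ _).trans (min_le_right _ _))
  have hηs : η < s := hηlt.trans_le ((min_le_right _ _).trans (min_le_left _ _))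
  have hηs' : η < 1 - s := hηlt.trans_le ((min_le_right _ _).trans (min_le_right _ _))
  -- on `[-η, η]` the curve is close to its tangent
  have hloc : ∀ τ ∈ Icc (-η) η, ∃ e : ℂ, ‖e‖ ≤ ε ∧ (C.path (s₀ + τ) - C.path s₀) / v = τ * (1 + e) := by
    intro τ hτ
    rcases eq_or_ne τ 0 with rfl | hτ0
    · exact ⟨0, by simpa using hε.le, by simp⟩
    have hmem : s + τ ∈ Icc (0 : ℝ) 1 := ⟨by linarith [hτ.1], by linarith [hτ.2]⟩
    have h1 := hstr s hsI (s + τ) hmem (by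
      rw [add_sub_cancel_left]; exact (abs_le.2 hτ).trans_lt hηδ)
    rw [add_sub_cancel_left, ← C.path_add k hmem, ← hp0, ← add_assoc, ← hs₀, ← hv] at h1
    have hτ' : (τ : ℂ) ≠ 0 := by exact_mod_cast hτ0
    refine ⟨(C.path (s₀ + τ) - C.path s₀) / (τ * v) - 1, ?_, by field_simp; ring⟩
    rw [div_sub_one (mul_ne_zero hτ' hv0), norm_div, norm_mul, norm_real, Real.norm_eq_abs,
      div_le_iff₀ (mul_pos (abs_pos.2 hτ0) hvp)]
    linarith
  -- off `[-η, η]` the curve stays away from the point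
  obtain ⟨c, hc0, hcd⟩ : ∃ c > 0, ∀ t ∈ Icc (s₀ + η) (s₀ + n - η), c ≤ ‖C.path t - C.path s₀‖ := by
    obtain ⟨x, hx, hmin⟩ := isCompact_Icc.exists_isMinOn
      (nonempty_Icc.2 (by linarith : s₀ + η ≤ s₀ + n - η))
      ((C.continuous_path.sub continuous_const).norm.continuousOn (s := Icc (s₀ + η) (s₀ + n - η)))
    exact ⟨_, norm_pos_iff.2 (C.path_ne (by linarith [hx.1]) (by linarith [hx.2])),
      fun t ht => hmin ht⟩
  -- the point `z h`
  have hz0 : Tendsto (fun h : ℝ => z h - C.c k s) (𝓝[>] 0) (𝓝 0) := by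
    have h1 : Tendsto (fun h : ℝ => (h : ℂ) * v) (𝓝[>] 0) (𝓝 (((0 : ℝ) : ℂ) * v)) :=
      ((continuous_ofReal.mul continuous_const).tendsto 0).mono_left nhdsWithin_le_nhds
    have h2 := h1.mul hz
    rw [ofReal_zero, zero_mul, zero_mul] at h2
    refine h2.congr' ?_
    filter_upwards [self_mem_nhdsWithin] with h hh
    have : (h : ℂ) ≠ 0 := by exact_mod_cast (mem_Ioi.1 hh).ne'
    field_simp
  have hz1 : ∀ᶠ h in 𝓝[>] (0 : ℝ), ‖z h - C.c k s‖ < min (ε * c) (ε * η * ‖v‖) := by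
    have := Metric.tendsto_nhds.1 hz0 (min (ε * c) (ε * η * ‖v‖)) (by positivity)
    simpa [dist_eq_norm] using this
  have hz2 := Metric.tendsto_nhds.1 hz (min 1 (|ω.im| / 2)) (by positivity)
  filter_upwards [hz1, hz2, self_mem_nhdsWithin] with h h1 h2 hh
  rw [mem_Ioi] at hh
  rw [dist_eq_norm] at h2
  rw [← hp0] at h1 h2
  have hhc : (h : ℂ) ≠ 0 := by exact_mod_cast hh.ne'
  set ζ := (z h - C.path s₀) / v with hζ
  have hzζ : (z h - C.path s₀) / (h * v) = ζ / h := by rw [hζ, div_div, mul_comm]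
  rw [hzζ] at h2
  have hzc : ‖z h - C.path s₀‖ < ε * c := h1.trans_le (min_le_left _ _)
  have hζη : ‖ζ‖ < ε * η := by
    rw [hζ, norm_div, div_lt_iff₀ hvp]; exact h1.trans_le (min_le_right _ _)
  have hslope : 2 * ε * |ζ.re| < σ * ζ.im := by
    have hre : |ζ.re / h - ω.re| < 1 := by
      have := (abs_re_le_norm (ζ / h - ω)).trans_lt (h2.trans_le (min_le_left _ _))
      simpa [div_ofReal_re] using this
    have him : |ζ.im / h - ω.im| < |ω.im| / 2 := by
      have := (abs_im_le_norm (ζ / h - ω)).trans_lt (h2.trans_le (min_le_right _ _))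
      simpa [div_ofReal_im] using this
    have e1 : |ζ.re / h| < |ω.re| + 1 := by
      have := abs_sub_abs_le_abs_sub (ζ.re / h) ω.re; linarith
    have e2 : |ω.im| / 2 < σ * (ζ.im / h) := by
      have : |σ * (ζ.im / h) - σ * ω.im| < |ω.im| / 2 := by
        rw [← mul_sub, abs_mul, hσa, one_mul]; exact him
      rw [hωσ] at this
      linarith [(abs_lt.1 this).1]
    rw [abs_div, abs_of_pos hh, div_lt_iff₀ hh] at e1
    rw [mul_div_assoc', lt_div_iff₀ hh] at e2
    nlinarith
  -- If the imaginary part vanishes, the point of the curve lies over `ζ` in the tangent direction;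
  -- it is then within the cone, hence strictly on the far side of the line from `ζ`.
  have hslit : ∀ τ ∈ Icc (-η) η, I * σ * ((C.path (s₀ + τ) - z h) / v) ∈ slitPlane := by
    intro τ hτ
    obtain ⟨e, he, heq⟩ := hloc τ hτ
    have hw : (C.path (s₀ + τ) - z h) / v = τ * (1 + e) - ζ := by
      rw [← heq, hζ]; ring
    rw [hw, mem_slitPlane_iff]
    have hre : (I * σ * ((τ : ℂ) * (1 + e) - ζ)).re = σ * ζ.im - σ * (τ * e.im) := by
      simp; ring
    have him : (I * σ * ((τ : ℂ) * (1 + e) - ζ)).im = σ * (τ * (1 + e.re) - ζ.re) := by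
      simp
    rw [hre, him]
    by_cases h0 : (σ : ℝ) * (τ * (1 + e.re) - ζ.re) = 0
    · left
      have hσ0 : (σ : ℝ) ≠ 0 := by rcases hσ with rfl | rfl <;> norm_num
      have h0' : τ * (1 + e.re) = ζ.re := by
        linarith [(mul_eq_zero.1 h0).resolve_left hσ0]
      have her : |e.re| ≤ ε := (abs_re_le_norm e).trans he
      have hei : |e.im| ≤ ε := (abs_im_le_norm e).trans he
      have h3 : |τ| ≤ 2 * |ζ.re| := by
        rw [← h0', abs_mul]
        have : 1 / 2 ≤ |1 + e.re| := by
          rw [abs_of_nonneg] <;> linarith [(abs_le.1 her).1]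
        nlinarith [abs_nonneg τ]
      have h4 : σ * (τ * e.im) ≤ |τ| * ε := by
        refine (le_abs_self _).trans ?_
        rw [abs_mul, hσa, one_mul, abs_mul]
        gcongr
      nlinarith
    · exact Or.inr h0
  -- Away from `s₀`, moving the observer from the curve to `z h` changes directions by a factor
  -- close to `1`.
  have hfar : ∀ t ∈ Icc (s₀ + η) (s₀ + n - η),
      ‖(C.path t - z h) / (C.path t - C.path s₀) - 1‖ < ε := by
    intro t ht
    have h0 : C.path t - C.path s₀ ≠ 0 := C.path_ne (by linarith [ht.1]) (by linarith [ht.2])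
    rw [div_sub_one h0, norm_div, div_lt_iff₀ (norm_pos_iff.2 h0), sub_sub_sub_cancel_left,
      norm_sub_rev]
    exact hzc.trans_le (by gcongr; exact hcd t ht)
  have hfars : ∀ t ∈ Icc (s₀ + η) (s₀ + n - η),
      (C.path t - z h) / (C.path t - C.path s₀) ∈ slitPlane := fun t ht =>
    mem_slitPlane_of_norm_sub_one_lt ((hfar t ht).trans (by linarith))
  have htr : z h ∉ C.trace := by
    rintro ⟨t, ht⟩
    -- move `t` to the period that starts at `s₀ - η`
    have hn0 : (0 : ℝ) < n := by linarith
    obtain ⟨j, hj⟩ : ∃ j : ℤ, t + j * n ∈ Ico (s₀ - η) (s₀ - η + n) := by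
      obtain ⟨j, hj, -⟩ := existsUnique_add_zsmul_mem_Ico hn0 t (s₀ - η)
      exact ⟨j, by simpa using hj⟩
    rw [← C.path_add_mul t j] at ht
    by_cases hcase : t + j * n ≤ s₀ + η
    · have := hslit (t + j * n - s₀) ⟨by linarith [hj.1], by linarith⟩
      rw [add_sub_cancel, ht] at this
      simp at this
    · have := hfars (t + j * n) ⟨by linarith, by linarith [hj.2]⟩
      rw [ht] at this
      simp at this
  refine ⟨htr, ?_⟩
  obtain ⟨q, hq, hqe⟩ := C.exists_log htr
  have hwind := C.wind_eq_of_log htr hq hqe (s₀ - η)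
  have hcp := C.continuous_path
  -- the change of the logarithm near `s₀`
  have hA := log_sub_const (A := Icc (-η) η) isPreconnected_Icc (f := fun τ => q (s₀ + τ))
    (g := fun τ => log (v / (I * σ)) + log (I * σ * ((C.path (s₀ + τ) - z h) / v)))
    (by fun_prop) (continuousOn_const.add (ContinuousOn.clog (by fun_prop) hslit))
    (by
      intro τ hτ
      have hσc : (σ : ℂ) ≠ 0 := by rcases hσ with rfl | rfl <;> simp
      have h0 : (I * σ : ℂ) ≠ 0 := mul_ne_zero I_ne_zero hσc
      rw [hqe, exp_add, exp_log (div_ne_zero hv0 h0), exp_log (slitPlane_ne_zero (hslit τ hτ))]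
      field_simp) (x := η) (y := -η) ⟨by linarith, le_rfl⟩ ⟨le_rfl, by linarith⟩
  -- the change of the logarithm away from `s₀`
  have hB := log_sub_const (A := Icc (s₀ + η) (s₀ + n - η)) isPreconnected_Icc (f := q)
    (g := fun t => L (s₀, t) + log ((C.path t - z h) / (C.path t - C.path s₀)))
    (by fun_prop) (ContinuousOn.add
      (hL.cont.comp (by fun_prop) fun t ht => ⟨by simp only; linarith [ht.1],
        by simp only; linarith [ht.2]⟩)
      (ContinuousOn.clog (ContinuousOn.div (by fun_prop) (by fun_prop) fun t ht =>
        C.path_ne (by linarith [ht.1]) (by linarith [ht.2])) hfars))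
    (by
      intro t ht
      rw [hqe, exp_add, hL.exp_eq _ _ (by linarith [ht.1]) (by linarith [ht.2]),
        exp_log (slitPlane_ne_zero (hfars t ht)), mul_div_cancel₀ _
          (C.path_ne (by linarith [ht.1]) (by linarith [ht.2]))])
    (x := s₀ + n - η) (y := s₀ + η) ⟨by linarith, le_rfl⟩ ⟨le_rfl, by linarith⟩
  have hend : ∀ τ : ℝ, (τ = 1 ∨ τ = -1) → ∃ e : ℂ, ‖e‖ < 2 * ε ∧
      log (I * σ * ((C.path (s₀ + τ * η) - z h) / v)) - Real.log η = log (I * σ * τ + e) := by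
    intro τ hτ
    have hτ2 : |τ| = 1 := by rcases hτ with rfl | rfl <;> simp
    have hτη : τ * η ∈ Icc (-η) η := by
      rw [mem_Icc, ← abs_le, abs_mul, hτ2, one_mul, abs_of_pos hη]
    obtain ⟨e, he, heq⟩ := hloc _ hτη
    have hηc : (η : ℂ) ≠ 0 := by exact_mod_cast hη.ne'
    have hw : I * σ * ((C.path (s₀ + τ * η) - z h) / v) =
        (η : ℝ) * (I * σ * τ + I * σ * (τ * e - ζ / η)) := by
      have : (C.path (s₀ + τ * η) - z h) / v = (τ * η : ℝ) * (1 + e) - ζ := by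
        rw [← heq, hζ]; ring
      rw [this]
      push_cast
      field_simp
      ring
    refine ⟨I * σ * (τ * e - ζ / η), ?_, ?_⟩
    · have hσn : ‖(σ : ℂ)‖ = 1 := by rcases hσ with rfl | rfl <;> simp
      rw [norm_mul, norm_mul, norm_I, hσn, one_mul, one_mul]
      have h5 : ‖ζ / η‖ < ε := by
        rw [norm_div, norm_real, Real.norm_eq_abs, abs_of_pos hη, div_lt_iff₀ hη]; exact hζη
      have h6 : ‖(τ : ℂ) * e‖ ≤ ε := by
        rw [norm_mul, norm_real, Real.norm_eq_abs, hτ2, one_mul]; exact he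
      linarith [norm_sub_le ((τ : ℂ) * e) (ζ / η)]
    · have hne := slitPlane_ne_zero (hslit _ hτη)
      rw [hw] at hne ⊢
      rw [log_ofReal_mul hη (right_ne_zero_of_mul hne), add_sub_cancel_left]
  obtain ⟨e₁, he₁, hE₁⟩ := hend 1 (Or.inl rfl)
  obtain ⟨e₂, he₂, hE₂⟩ := hend (-1) (Or.inr rfl)
  have hF₁ := hlog₁ (I * σ * (1 : ℝ) + e₁) (by rw [add_sub_cancel_left]; linarith)
  have hF₂ := hlog₂ (I * σ * (-1 : ℝ) + e₂) (by rw [add_sub_cancel_left]; linarith)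
  rw [← hE₁, one_mul] at hF₁
  rw [← hE₂, neg_one_mul] at hF₂
  have hG₁ := hlog₃ _ ((hfar (s₀ + n - η) ⟨by linarith, le_rfl⟩).trans hεr₃)
  have hG₂ := hlog₃ _ ((hfar (s₀ + η) ⟨le_rfl, by linarith⟩).trans hεr₃)
  rw [sub_zero] at hG₁ hG₂
  have hshift := hm (s₀ - η) s₀ (by linarith) (by linarith)
  rw [show s₀ - η + (n : ℝ) = s₀ + n - η by ring] at hshift hwind
  rw [hshift] at hB
  rw [← sub_eq_add_neg] at hA hF₂
  generalize log (I * σ * ((C.path (s₀ + η) - z h) / v)) = a₁ at *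
  generalize log (I * σ * ((C.path (s₀ - η) - z h) / v)) = a₂ at *
  generalize log (I * σ * (1 : ℝ)) = b₁ at *
  generalize log (I * σ * (-1 : ℝ)) = b₂ at *
  generalize log ((C.path (s₀ + n - η) - z h) / (C.path (s₀ + n - η) - C.path s₀)) = g₁ at *
  generalize log ((C.path (s₀ + η) - z h) / (C.path (s₀ + η) - C.path s₀)) = g₂ at *
  have hid : Real.pi * I * (2 * C.wind (z h) - m - σ : ℤ) =
      (a₁ - Real.log η - b₁) - (a₂ - Real.log η - b₂) + (g₁ - g₂) +
      ((L (s₀ - η, s₀) - Real.log η - (l s + p)) - (L (s₀, s₀ + η) - Real.log η - (l s + p))) := by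
    push_cast
    linear_combination -hwind + hA + hB + hlogi
  have hnorm : Real.pi * |((2 * C.wind (z h) - m - σ : ℤ) : ℝ)| < 6 / 10 := by
    have h7 : ‖Real.pi * I * ((2 * C.wind (z h) - m - σ : ℤ) : ℂ)‖ =
        Real.pi * |((2 * C.wind (z h) - m - σ : ℤ) : ℝ)| := by
      rw [norm_mul, norm_mul, norm_I, norm_real, Real.norm_of_nonneg Real.pi_pos.le, mul_one,
        norm_intCast]
    rw [← h7, hid]
    refine (norm_add_le _ _).trans_lt ?_
    have t1 := norm_add_le ((a₁ - Real.log η - b₁) - (a₂ - Real.log η - b₂)) (g₁ - g₂)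
    have t2 := norm_sub_le (a₁ - Real.log η - b₁) (a₂ - Real.log η - b₂)
    have t3 := norm_sub_le g₁ g₂
    have t4 := norm_sub_le (L (s₀ - η, s₀) - Real.log η - (l s + p))
      (L (s₀, s₀ + η) - Real.log η - (l s + p))
    linarith
  have hlt : |((2 * C.wind (z h) - m - σ : ℤ) : ℝ)| < 1 := by
    nlinarith [Real.pi_gt_three, abs_nonneg ((2 * C.wind (z h) - m - σ : ℤ) : ℝ)]
  have : |2 * C.wind (z h) - m - σ| < 1 := by exact_mod_cast hlt
  have := Int.abs_lt_one_iff.1 this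
  linarith

end ClosedCurve

end PlaneCurve


/-! ### A simple closed curve turns exactly once -/

namespace PlaneCurve

open Complex Set Filter Topology

namespace ClosedCurve

variable {n : ℕ} (C : ClosedCurve n)

/-- The turning number of a simple closed curve is `m = ±1`, the winding numbers are `0` and `m`,
and the side on the left has winding number `(m + 1) / 2`. -/
theorem exists_turning : ∃ m : ℤ, (m = 1 ∨ m = -1) ∧
    (∀ z, z ∉ C.trace → C.wind z = 0 ∨ C.wind z = m) ∧ (∃ z, z ∉ C.trace ∧ C.wind z = m) ∧
    (∀ l : ℤ → ℝ → ℂ, (∀ k, ContinuousOn (l k) (Icc 0 1)) →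
      (∀ k, ∀ t ∈ Icc (0 : ℝ) 1, exp (l k t) = C.d k t) →
      2 * Real.pi * I * m =
        ∑ k ∈ Finset.range n, (l k 1 - l k 0 + log (C.d (k + 1) 0 / C.d k 1))) ∧
    ∀ (k : ℤ) (s : ℝ), s ∈ Ioo (0 : ℝ) 1 → ∀ (ω : ℂ) (z : ℝ → ℂ), 0 < ω.im →
      Tendsto (fun h : ℝ => (z h - C.c k s) / (h * C.d k s)) (𝓝[>] 0) (𝓝 ω) →
      ∀ᶠ h in 𝓝[>] (0 : ℝ), z h ∉ C.trace ∧ 2 * C.wind (z h) = m + 1 := by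
  obtain ⟨L, hL⟩ := C.exists_isChordLog
  obtain ⟨m, -, hm⟩ := hL.exists_odd
  have hhalf : (1 / 2 : ℝ) ∈ Ioo (0 : ℝ) 1 := by norm_num
  have hd0 : C.d 0 (1 / 2) ≠ 0 := C.d_ne 0 _ (Ioo_subset_Icc_self hhalf)
  have hside : ∀ ω : ℂ, Tendsto (fun h : ℝ =>
      (C.c 0 (1 / 2) + h * (C.d 0 (1 / 2) * ω) - C.c 0 (1 / 2)) / (h * C.d 0 (1 / 2)))
      (𝓝[>] 0) (𝓝 ω) := by
    intro ω
    refine tendsto_const_nhds.congr' ?_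
    filter_upwards [self_mem_nhdsWithin] with h hh
    have : (h : ℂ) ≠ 0 := by exact_mod_cast (mem_Ioi.1 hh).ne'
    field_simp
    ring
  obtain ⟨h₁, hl₁, hl₂⟩ := (wind_near hL hm 0 hhalf (σ := 1) (Or.inl rfl) (ω := I) (by simp)
    (hside I)).exists
  obtain ⟨h₂, hr₁, hr₂⟩ := (wind_near hL hm 0 hhalf (σ := -1) (Or.inr rfl) (ω := -I) (by simp)
    (hside (-I))).exists
  generalize C.c 0 (1 / 2) + h₁ * (C.d 0 (1 / 2) * I) = zl at *
  generalize C.c 0 (1 / 2) + h₂ * (C.d 0 (1 / 2) * -I) = zr at *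
  -- The winding numbers on the two sides are `(m + 1) / 2` and `(m - 1) / 2`. They differ, so they
  -- cannot both be nonzero, and `m = ±1`.
  have hlr : C.wind zl = 0 ∨ C.wind zr = 0 := by
    by_contra! hc
    have := C.wind_eq_wind hl₁ hr₁ hc.1 hc.2
    omega
  have hm1 : m = 1 ∨ m = -1 := by omega
  have hex : ∃ z, z ∉ C.trace ∧ C.wind z = m := by
    rcases hm1 with rfl | rfl
    · exact ⟨zl, hl₁, by omega⟩
    · exact ⟨zr, hr₁, by omega⟩
  refine ⟨m, hm1, ?_, hex, fun l hl he => turning_sum hL hm hl he, ?_⟩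
  · intro z hz
    by_contra! hc
    obtain ⟨z', hz', hw⟩ := hex
    exact hc.2 ((C.wind_eq_wind hz hz' hc.1 (by omega)).trans hw)
  · intro k s hs ω z hω hz
    simpa using wind_near hL hm k hs (σ := 1) (Or.inl rfl) (by simpa using hω) hz

end ClosedCurve

end PlaneCurve


/-! ## The optical metric in polar coordinates -/

namespace Surface

theorem pd_zero_eq {F : Coord → ℝ} {h : ℝ → ℝ} {a : ℝ} (hF : ∀ y, a < y 0 → F y = h (y 0))
    {x : Coord} (hx : a < x 0) : pd 0 F x = deriv h (x 0) := by
  refine Filter.EventuallyEq.deriv_eq ?_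
  filter_upwards [lt_mem_nhds hx] with s hs
  have : Function.update x 0 s 0 = s := Function.update_self ..
  rw [hF _ (by rwa [this]), this]

theorem pd_one_eq {F : Coord → ℝ} {h : ℝ → ℝ} {a : ℝ} (hF : ∀ y, a < y 0 → F y = h (y 0))
    {x : Coord} (hx : a < x 0) : pd 1 F x = 0 := by
  have : (fun s : ℝ => F (Function.update x 1 s)) = fun _ => h (x 0) := by
    funext s
    have : Function.update x 1 s 0 = x 0 := Function.update_of_ne (by decide) ..
    rw [hF _ (by rwa [this]), this]
  rw [pd, this, deriv_const]

end Surface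

namespace Schwarzschild

open Surface

variable {M : ℝ}

/-- The lapse factor `1 - 2M/r`. -/
noncomputable def lapse (M r : ℝ) : ℝ := 1 - 2 * M / r

theorem lapse_pos {r : ℝ} (hM : 0 < M) (hr : 2 * M < r) : 0 < lapse M r := by
  have : 0 < r := by linarith
  rw [lapse, sub_pos, div_lt_one this]; exact hr

theorem lapse_eq {r : ℝ} (hM : 0 < M) (hr : 2 * M < r) : lapse M r = (r - 2 * M) / r := by
  have : r ≠ 0 := by linarith
  rw [lapse]; field_simp

theorem hasDerivAt_lapse {r : ℝ} (hM : 0 < M) (hr : 2 * M < r) :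
    HasDerivAt (lapse M) (2 * M / r ^ 2) r := by
  have h0 : r ≠ 0 := by linarith
  have := ((hasDerivAt_inv h0).const_mul (2 * M)).const_sub 1
  refine (this.congr_deriv ?_)
  field_simp

theorem pd_metric (hM : 0 < M) {x : Coord} (hx : 2 * M < x 0) :
    pd 0 (fun y => opticalMetric M y 0 0) x = -(4 * M / (x 0 ^ 2 * lapse M (x 0) ^ 3)) ∧
    pd 0 (fun y => opticalMetric M y 1 1) x = 2 * (x 0 - 3 * M) / lapse M (x 0) ^ 2 ∧
    pd 1 (fun y => opticalMetric M y 0 0) x = 0 ∧ pd 1 (fun y => opticalMetric M y 1 1) x = 0 ∧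
    (∀ k, pd k (fun y => opticalMetric M y 0 1) x = 0) ∧
    ∀ k, pd k (fun y => opticalMetric M y 1 0) x = 0 := by
  have h0 : x 0 ≠ 0 := by linarith
  have hf := (lapse_pos hM hx).ne'
  have e0 : ∀ y : Coord, 2 * M < y 0 → opticalMetric M y 0 0 = (fun r => 1 / lapse M r ^ 2) (y 0) :=
    fun y _ => by simp [opticalMetric, lapse]
  have e1 : ∀ y : Coord, 2 * M < y 0 → opticalMetric M y 1 1 = (fun r => r ^ 2 / lapse M r) (y 0) :=
    fun y _ => by simp [opticalMetric, lapse]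
  have e2 : (fun y : Coord => opticalMetric M y 0 1) = fun _ => 0 := by
    funext y; simp [opticalMetric]
  have e3 : (fun y : Coord => opticalMetric M y 1 0) = fun _ => 0 := by
    funext y; simp [opticalMetric]
  have hd := hasDerivAt_lapse hM hx
  refine ⟨?_, ?_, pd_one_eq (h := fun r => 1 / lapse M r ^ 2) e0 hx,
    pd_one_eq (h := fun r => r ^ 2 / lapse M r) e1 hx, fun k => by rw [e2, pd, deriv_const],
    fun k => by rw [e3, pd, deriv_const]⟩
  · rw [pd_zero_eq (h := fun r => 1 / lapse M r ^ 2) e0 hx]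
    have := ((hasDerivAt_const (x 0) (1 : ℝ)).div (hd.pow 2) (pow_ne_zero 2 hf)).deriv
    refine Eq.trans this ?_
    simp only [Pi.pow_apply]
    field_simp
    ring
  · rw [pd_zero_eq (h := fun r => r ^ 2 / lapse M r) e1 hx]
    have := (((hasDerivAt_id (x 0)).pow 2).div hd hf).deriv
    refine Eq.trans this ?_
    simp only [id, Pi.pow_apply]
    rw [lapse_eq hM hx]
    have : x 0 - 2 * M ≠ 0 := by linarith
    field_simp
    ring

theorem det_metric (x : Coord) : (opticalMetric M x).det = x 0 ^ 2 / lapse M (x 0) ^ 3 := by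
  rw [Matrix.det_fin_two]; simp [opticalMetric, ← lapse.eq_1]; ring

theorem inv_metric (hM : 0 < M) {x : Coord} (hx : 2 * M < x 0) :
    (opticalMetric M x)⁻¹ = !![lapse M (x 0) ^ 2, 0; 0, lapse M (x 0) / x 0 ^ 2] := by
  have h0 : x 0 ≠ 0 := by linarith
  have hf := (lapse_pos hM hx).ne'
  apply Matrix.inv_eq_right_inv
  ext i j
  fin_cases i <;> fin_cases j <;> simp [opticalMetric, Matrix.mul_apply, ← lapse.eq_1] <;> field_simp

theorem christoffel_metric (hM : 0 < M) {x : Coord} (hx : 2 * M < x 0) :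
    christoffel (opticalMetric M) 0 0 0 x = -(2 * M / (x 0 * (x 0 - 2 * M))) ∧
    christoffel (opticalMetric M) 0 0 1 x = 0 ∧ christoffel (opticalMetric M) 0 1 0 x = 0 ∧
    christoffel (opticalMetric M) 0 1 1 x = -(x 0 - 3 * M) ∧
    christoffel (opticalMetric M) 1 0 0 x = 0 ∧
    christoffel (opticalMetric M) 1 0 1 x = (x 0 - 3 * M) / (x 0 * (x 0 - 2 * M)) ∧
    christoffel (opticalMetric M) 1 1 0 x = (x 0 - 3 * M) / (x 0 * (x 0 - 2 * M)) ∧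
    christoffel (opticalMetric M) 1 1 1 x = 0 := by
  obtain ⟨h1, h2, h3, h4, h5, h6⟩ := pd_metric hM hx
  have h0 : x 0 ≠ 0 := by linarith
  have h0' : x 0 - 2 * M ≠ 0 := by linarith
  refine ⟨?_, ?_, ?_, ?_, ?_, ?_, ?_, ?_⟩ <;>
    simp [christoffel, inv_metric hM hx, Fin.sum_univ_two, h1, h2, h3, h4, h5, h6] <;>
    rw [lapse_eq hM hx] <;> field_simp <;> ring

theorem gaussCurvature_opticalMetric (hM : 0 < M) {x : Coord} (hx : 2 * M < x 0) :
    gaussCurvature (opticalMetric M) x = -(2 * M / x 0 ^ 3) * (1 - 3 * M / (2 * x 0)) := by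
  obtain ⟨c1, c2, c3, c4, c5, c6, c7, c8⟩ := christoffel_metric hM hx
  have h0 : x 0 ≠ 0 := by linarith
  have h0' : x 0 - 2 * M ≠ 0 := by linarith
  have d1 : pd 0 (christoffel (opticalMetric M) 0 1 1) x = -1 := by
    rw [pd_zero_eq (h := fun r => -(r - 3 * M))
      (fun y hy => (christoffel_metric hM hy).2.2.2.1) hx]
    have := (((hasDerivAt_id (x 0)).sub_const (3 * M)).neg).deriv
    exact this.trans (by simp)
  have d2 : pd 1 (christoffel (opticalMetric M) 0 0 1) x = 0 :=
    pd_one_eq (h := fun _ => 0) (fun y hy => (christoffel_metric hM hy).2.1) hx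
  have hm : opticalMetric M x 0 1 = 0 := by simp [opticalMetric]
  have hm0 : opticalMetric M x 0 0 = 1 / lapse M (x 0) ^ 2 := by simp [opticalMetric, lapse]
  rw [gaussCurvature, det_metric, Fin.sum_univ_two, hm, hm0, riemann, Fin.sum_univ_two, d1, d2,
    c1, c2, c3, c4, c6, c8, lapse_eq hM hx]
  field_simp
  ring

theorem geodesicAccel_opticalMetric (hM : 0 < M) {x : Coord} (hx : 2 * M < x 0) (v : Coord) :
    geodesicAccel (opticalMetric M) x v =
      ![2 * M / (x 0 * (x 0 - 2 * M)) * v 0 ^ 2 + (x 0 - 3 * M) * v 1 ^ 2,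
        -(2 * (x 0 - 3 * M) / (x 0 * (x 0 - 2 * M))) * v 0 * v 1] := by
  obtain ⟨c1, c2, c3, c4, c5, c6, c7, c8⟩ := christoffel_metric hM hx
  ext i
  fin_cases i
  · simp [geodesicAccel, Fin.sum_univ_two, c1, c2, c3, c4]; ring
  · simp [geodesicAccel, Fin.sum_univ_two, c5, c6, c7, c8]; ring

/-- The density of the connection form `κ dφ`, whose differential is `-K dA`. -/
noncomputable def connection (M r : ℝ) : ℝ := (1 - 3 * M / r) / √(lapse M r)

/-- The derivative of `connection`. -/
noncomputable def connectionDeriv (M r : ℝ) : ℝ :=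
  M / r ^ 2 * (2 - 3 * M / r) / (lapse M r * √(lapse M r))

theorem hasDerivAt_connection (hM : 0 < M) {r : ℝ} (hr : 2 * M < r) :
    HasDerivAt (connection M) (connectionDeriv M r) r := by
  have h0 : r ≠ 0 := by linarith
  have hf := lapse_pos hM hr
  have hs : √(lapse M r) ≠ 0 := (Real.sqrt_pos.2 hf).ne'
  have hd := (hasDerivAt_lapse hM hr).sqrt hf.ne'
  have := (((hasDerivAt_inv h0).const_mul (3 * M)).const_sub 1).div hd hs
  refine (this.congr_deriv ?_)
  have hsq : √(lapse M r) ^ 2 = lapse M r := Real.sq_sqrt hf.le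
  rw [connectionDeriv]
  rw [← div_eq_mul_inv, div_eq_div_iff (by positivity) (by positivity), hsq]
  have hl : lapse M r = √(lapse M r) ^ 2 := hsq.symm
  field_simp
  rw [hsq, lapse]
  field_simp
  ring

theorem connectionDeriv_pos (hM : 0 < M) {r : ℝ} (hr : 2 * M < r) : 0 < connectionDeriv M r := by
  have h0 : 0 < r := by linarith
  have hf := lapse_pos hM hr
  have : 3 * M / r < 2 := by rw [div_lt_iff₀ h0]; linarith
  have : 0 < 2 - 3 * M / r := by linarith
  unfold connectionDeriv
  positivity

theorem areaDensity_opticalMetric (hM : 0 < M) {x : Coord} (hx : 2 * M < x 0) :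
    areaDensity (opticalMetric M) x = x 0 / (lapse M (x 0) * √(lapse M (x 0))) := by
  have h0 : 0 < x 0 := by linarith
  have hf := lapse_pos hM hx
  rw [areaDensity, det_metric, Real.sqrt_eq_iff_mul_self_eq (by positivity) (by positivity)]
  have hsq : √(lapse M (x 0)) ^ 2 = lapse M (x 0) := Real.sq_sqrt hf.le
  have : lapse M (x 0) ^ 3 = (lapse M (x 0) * √(lapse M (x 0))) ^ 2 := by rw [mul_pow, hsq]; ring
  rw [this]
  field_simp

/-- This is `K dA = -d(κ dφ)` in coordinates, the identity that turns curvature integrals into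
boundary integrals. -/
theorem curvatureDensity_eq (hM : 0 < M) {x : Coord} (hx : 2 * M < x 0) :
    curvatureDensity M x = -connectionDeriv M (x 0) := by
  have h0 : 0 < x 0 := by linarith
  have hf := lapse_pos hM hx
  rw [curvatureDensity, gaussCurvature_opticalMetric hM hx, areaDensity_opticalMetric hM hx,
    connectionDeriv]
  field_simp

/-- The circle `r = 3M` is a geodesic, so its boundary term in Stokes' formula vanishes. -/
theorem connection_three (hM : 0 < M) : connection M (3 * M) = 0 := by
  rw [connection, div_self (by positivity)]; simp

/-- After squaring, the claim is `(r - 3M)² < r (r - 2M)`, that is, `9M < 4r`. The value `1` is the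
limit at infinity, so the curvature outside `r = 3M` totals more than `-2π`. -/
theorem connection_lt_one (hM : 0 < M) {r : ℝ} (hr : 3 * M ≤ r) : connection M r < 1 := by
  have h0 : 0 < r := by linarith
  have hf := lapse_pos hM (show 2 * M < r by linarith)
  rw [connection, div_lt_one (Real.sqrt_pos.2 hf)]
  apply Real.lt_sqrt_of_sq_lt
  have h1 : (1 - 3 * M / r) ^ 2 = (r - 3 * M) ^ 2 / r ^ 2 := by field_simp
  have h2 : lapse M r = (r - 2 * M) * r / r ^ 2 := by
    rw [lapse_eq hM (by linarith)]; field_simp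
  rw [h1, h2]
  gcongr ?_ / _
  nlinarith

/-- The components of a tangent vector in the orthonormal polar frame, as a complex number. -/
noncomputable def frame (M : ℝ) (x v : Coord) : ℂ :=
  ⟨v 0 / lapse M (x 0), x 0 * v 1 / √(lapse M (x 0))⟩

theorem frame_ne_zero (hM : 0 < M) {x v : Coord} (hx : 2 * M < x 0) (hv : v ≠ 0) :
    frame M x v ≠ 0 := by
  have h0 : 0 < x 0 := by linarith
  have hf := lapse_pos hM hx
  have hs := Real.sqrt_pos.2 hf
  intro h
  apply hv
  have h1 := congrArg Complex.re h
  have h2 := congrArg Complex.im h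
  simp only [frame, Complex.zero_re, Complex.zero_im, div_eq_zero_iff, mul_eq_zero] at h1 h2
  ext i
  fin_cases i
  · simpa [hf.ne'] using h1
  · simpa [hs.ne', h0.ne'] using h2

theorem signedAngle_eq (hM : 0 < M) {x : Coord} (hx : 2 * M < x 0) (u v : Coord) :
    signedAngle (opticalMetric M) x u v =
      Complex.arg (starRingEnd ℂ (frame M x u) * frame M x v) := by
  have h0 : 0 < x 0 := by linarith
  have hf := lapse_pos hM hx
  have hs := Real.sqrt_pos.2 hf
  have hsq : √(lapse M (x 0)) ^ 2 = lapse M (x 0) := Real.sq_sqrt hf.le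
  rw [signedAngle, areaDensity_opticalMetric hM hx]
  congr 1
  apply Complex.ext
  · simp only [frame, Complex.mul_re, Complex.conj_re, Complex.conj_im]
    simp [Fin.sum_univ_two, opticalMetric, ← lapse.eq_1]
    rw [show x 0 * u 1 / √(lapse M (x 0)) * (x 0 * v 1 / √(lapse M (x 0))) =
      x 0 ^ 2 * u 1 * v 1 / √(lapse M (x 0)) ^ 2 by field_simp, hsq]
    field_simp
  · simp only [frame, Complex.mul_im, Complex.conj_re, Complex.conj_im]
    field_simp
    ring

end Schwarzschild


/-! ## Geodesic arcs in the plane -/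

namespace Schwarzschild

open Surface Set Filter Topology

variable {M : ℝ}

theorem norm_toPlane {x : Coord} (hx : 0 ≤ x 0) : ‖toPlane x‖ = x 0 := by
  rw [toPlane, norm_mul, Complex.norm_exp_ofReal_mul_I, mul_one, Complex.norm_real,
    Real.norm_of_nonneg hx]

theorem toPlane_eq_iff {x y : Coord} (hx : 0 < x 0) (hy : 0 < y 0) :
    toPlane x = toPlane y ↔ x 0 = y 0 ∧ ∃ j : ℤ, x 1 = y 1 + j * (2 * Real.pi) := by
  constructor
  · intro h
    have h0 : x 0 = y 0 := by rw [← norm_toPlane hx.le, ← norm_toPlane hy.le, h]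
    refine ⟨h0, ?_⟩
    have hx' : (x 0 : ℂ) ≠ 0 := by exact_mod_cast hx.ne'
    rw [toPlane, toPlane, ← h0] at h
    obtain ⟨j, hj⟩ := Complex.exp_eq_exp_iff_exists_int.1 (mul_left_cancel₀ hx' h)
    refine ⟨j, ?_⟩
    have := congrArg Complex.im hj
    simpa using this
  · rintro ⟨h0, j, hj⟩
    rw [toPlane, toPlane, h0]
    congr 1
    rw [Complex.exp_eq_exp_iff_exists_int]
    exact ⟨j, by rw [hj]; push_cast; ring⟩

theorem exp_eq_of_toPlane_eq {x y : Coord} (hx : 0 < x 0) (hy : 0 < y 0)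
    (h : toPlane x = toPlane y) :
    Complex.exp (x 1 * Complex.I) = Complex.exp (y 1 * Complex.I) := by
  obtain ⟨h0, -⟩ := (toPlane_eq_iff hx hy).1 h
  have hx' : (x 0 : ℂ) ≠ 0 := by exact_mod_cast hx.ne'
  rw [toPlane, toPlane, ← h0] at h
  exact mul_left_cancel₀ hx' h

/-- The components of a tangent vector in the Euclidean orthonormal polar frame. -/
noncomputable def flatFrame (x v : Coord) : ℂ := ⟨v 0, x 0 * v 1⟩

/-- The image of a tangent vector under the differential of `toPlane`. -/
noncomputable def planeVector (x v : Coord) : ℂ :=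
  flatFrame x v * Complex.exp (x 1 * Complex.I)

theorem flatFrame_ne_zero {x v : Coord} (hx : 0 < x 0) (hv : v ≠ 0) : flatFrame x v ≠ 0 := by
  intro h
  apply hv
  have h1 := congrArg Complex.re h
  have h2 := congrArg Complex.im h
  simp only [flatFrame, Complex.zero_re, Complex.zero_im, mul_eq_zero, hx.ne', false_or] at h1 h2
  ext i
  fin_cases i
  · exact h1
  · exact h2

theorem planeVector_ne_zero {x v : Coord} (hx : 0 < x 0) (hv : v ≠ 0) : planeVector x v ≠ 0 :=
  mul_ne_zero (flatFrame_ne_zero hx hv) (Complex.exp_ne_zero _)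

theorem hasDerivWithinAt_toPlane {p : ℝ → Coord} {v : Coord} {s : Set ℝ} {t : ℝ}
    (h : HasDerivWithinAt p v s t) :
    HasDerivWithinAt (fun t => toPlane (p t)) (planeVector (p t) v) s t := by
  have h0 := ((hasDerivWithinAt_pi.1 h) 0).ofReal_comp
  have h1 := ((hasDerivWithinAt_pi.1 h) 1).ofReal_comp
  have := h0.mul ((h1.mul_const Complex.I).cexp)
  refine this.congr_deriv ?_
  have hW : flatFrame (p t) v = v 0 + p t 0 * v 1 * Complex.I := by
    apply Complex.ext <;> simp [flatFrame]
  rw [planeVector, hW]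
  ring

/-- The rotation angle between the orthonormal frames of the optical and of the flat metric. -/
theorem arg_flatFrame (hM : 0 < M) {x u v : Coord} (hx : 2 * M < x 0) (hu : u ≠ 0) (hv : v ≠ 0) :
    Complex.arg (flatFrame x v / flatFrame x u) =
      signedAngle (opticalMetric M) x u v - Complex.arg (frame M x v / flatFrame x v) +
        Complex.arg (frame M x u / flatFrame x u) := by
  have h0 : 0 < x 0 := by linarith
  have hf := lapse_pos hM hx
  have hs := Real.sqrt_pos.2 hf
  have hWu := flatFrame_ne_zero h0 hu
  have hWv := flatFrame_ne_zero h0 hv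
  have hVu := frame_ne_zero hM hx hu
  have hVv := frame_ne_zero hM hx hv
  rw [signedAngle_eq hM hx]
  -- Both frames rescale the radial and the angular component by positive factors, so the two images
  -- of a vector have positive inner product.
  have hδ : ∀ w : Coord, w ≠ 0 → |Complex.arg (frame M x w / flatFrame x w)| < Real.pi / 2 := by
    intro w hw
    rw [Complex.abs_arg_lt_pi_div_two_iff]
    left
    have hW := flatFrame_ne_zero h0 hw
    rw [Complex.div_re]
    have hn := Complex.normSq_pos.2 hW
    rw [← add_div]
    refine div_pos ?_ hn
    have hw' : w 0 ≠ 0 ∨ w 1 ≠ 0 := by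
      by_contra! hc
      exact hw (by ext i; fin_cases i; exacts [hc.1, hc.2])
    simp only [frame, flatFrame]
    have e : w 0 / lapse M (x 0) * w 0 + x 0 * w 1 / √(lapse M (x 0)) * (x 0 * w 1) =
      w 0 ^ 2 / lapse M (x 0) + (x 0 * w 1) ^ 2 / √(lapse M (x 0)) := by ring
    rw [e]
    rcases hw' with h | h <;> positivity
  -- The two angles have the same sign, that of `u₀ v₁ - u₁ v₀`. With the two corrections below `π /
  -- 2`, the sides of the formula differ by less than `2π`, while they agree modulo `2π`.
  have hAB : |Complex.arg (flatFrame x v / flatFrame x u) -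
      Complex.arg (starRingEnd ℂ (frame M x u) * frame M x v)| ≤ Real.pi := by
    have e1 : (flatFrame x v / flatFrame x u).im =
        x 0 * (u 0 * v 1 - u 1 * v 0) / Complex.normSq (flatFrame x u) := by
      rw [Complex.div_im]; simp only [flatFrame]; ring
    have e2 : (starRingEnd ℂ (frame M x u) * frame M x v).im =
        x 0 * (u 0 * v 1 - u 1 * v 0) / (lapse M (x 0) * √(lapse M (x 0))) := by
      simp only [frame, Complex.mul_im, Complex.conj_re, Complex.conj_im]
      field_simp
      ring
    have hn := Complex.normSq_pos.2 hWu
    rcases le_or_gt 0 (x 0 * (u 0 * v 1 - u 1 * v 0)) with h | h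
    · have a1 : 0 ≤ Complex.arg (flatFrame x v / flatFrame x u) := by
        rw [Complex.arg_nonneg_iff, e1]; positivity
      have a2 : 0 ≤ Complex.arg (starRingEnd ℂ (frame M x u) * frame M x v) := by
        rw [Complex.arg_nonneg_iff, e2]; positivity
      rw [abs_le]
      constructor <;> linarith [Complex.arg_le_pi (flatFrame x v / flatFrame x u),
        Complex.arg_le_pi (starRingEnd ℂ (frame M x u) * frame M x v)]
    · have a1 : Complex.arg (flatFrame x v / flatFrame x u) < 0 := by
        rw [Complex.arg_neg_iff, e1]; exact div_neg_of_neg_of_pos h hn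
      have a2 : Complex.arg (starRingEnd ℂ (frame M x u) * frame M x v) < 0 := by
        rw [Complex.arg_neg_iff, e2]; exact div_neg_of_neg_of_pos h (by positivity)
      rw [abs_le]
      constructor <;> linarith [Complex.neg_pi_lt_arg (flatFrame x v / flatFrame x u),
        Complex.neg_pi_lt_arg (starRingEnd ℂ (frame M x u) * frame M x v)]
  have hang : (Complex.arg (flatFrame x v / flatFrame x u) : Real.Angle) =
      ((Complex.arg (starRingEnd ℂ (frame M x u) * frame M x v) -
        Complex.arg (frame M x v / flatFrame x v) +
        Complex.arg (frame M x u / flatFrame x u) : ℝ) : Real.Angle) := by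
    rw [Real.Angle.coe_add, Real.Angle.coe_sub, Complex.arg_div_coe_angle hWv hWu,
      Complex.arg_div_coe_angle hVv hWv, Complex.arg_div_coe_angle hVu hWu,
      Complex.arg_mul_coe_angle ((map_ne_zero _).2 hVu) hVv, Complex.arg_conj_coe_angle]
    abel
  obtain ⟨j, hj⟩ := Real.Angle.angle_eq_iff_two_pi_dvd_sub.1 hang
  have hu' := abs_lt.1 (hδ u hu)
  have hv' := abs_lt.1 (hδ v hv)
  have hAB' := abs_le.1 hAB
  have hj0 : j = 0 := by
    have h1 : |(j : ℝ)| < 1 := by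
      rw [abs_lt]
      constructor <;> nlinarith [Real.pi_pos]
    have : |j| < 1 := by exact_mod_cast h1
    exact Int.abs_lt_one_iff.1 this
  rw [hj0] at hj
  simp only [Int.cast_zero, mul_zero] at hj
  linarith

theorem GeodesicArc.pos_pos (hM : 0 < M) (A : GeodesicArc M) {t : ℝ} (ht : t ∈ Icc (0 : ℝ) 1) :
    0 < A.pos t 0 := by
  have := A.outside t ht; linarith

namespace GeodesicArc

variable (A : GeodesicArc M)

theorem continuousOn_pos : ContinuousOn A.pos (Icc 0 1) := fun t ht =>
  (A.hasDeriv_pos t ht).continuousWithinAt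

theorem continuousOn_vel : ContinuousOn A.vel (Icc 0 1) := fun t ht =>
  (A.hasDeriv_vel t ht).continuousWithinAt

theorem continuousOn_coord (i : Fin 2) : ContinuousOn (fun t => A.pos t i) (Icc 0 1) :=
  continuousOn_pi.1 A.continuousOn_pos i

theorem continuousOn_velCoord (i : Fin 2) : ContinuousOn (fun t => A.vel t i) (Icc 0 1) :=
  continuousOn_pi.1 A.continuousOn_vel i

theorem hasDeriv_coord (i : Fin 2) {t : ℝ} (ht : t ∈ Icc (0 : ℝ) 1) :
    HasDerivWithinAt (fun t => A.pos t i) (A.vel t i) (Icc 0 1) t :=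
  hasDerivWithinAt_pi.1 (A.hasDeriv_pos t ht) i

theorem hasDeriv_toPlane {t : ℝ} (ht : t ∈ Icc (0 : ℝ) 1) :
    HasDerivWithinAt (fun t => toPlane (A.pos t)) (planeVector (A.pos t) (A.vel t)) (Icc 0 1) t :=
  hasDerivWithinAt_toPlane (A.hasDeriv_pos t ht)

theorem continuousOn_flatFrame :
    ContinuousOn (fun t => flatFrame (A.pos t) (A.vel t)) (Icc 0 1) := by
  have h := A.continuousOn_coord 0
  have h0 := A.continuousOn_velCoord 0
  have h1 := A.continuousOn_velCoord 1
  have : (fun t => flatFrame (A.pos t) (A.vel t)) =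
      fun t => ((A.vel t 0 : ℝ) : ℂ) + ((A.pos t 0 * A.vel t 1 : ℝ) : ℂ) * Complex.I := by
    funext t; apply Complex.ext <;> simp [flatFrame]
  rw [this]
  exact (Complex.continuous_ofReal.comp_continuousOn h0).add
    ((Complex.continuous_ofReal.comp_continuousOn (h.mul h1)).mul continuousOn_const)

theorem continuousOn_planeVector :
    ContinuousOn (fun t => planeVector (A.pos t) (A.vel t)) (Icc 0 1) :=
  A.continuousOn_flatFrame.mul
    (((Complex.continuous_ofReal.comp_continuousOn (A.continuousOn_coord 1)).mul
      continuousOn_const).cexp)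

/-- With `σ = √(1 - 2m/r)` as a variable and `m` eliminated, the parallel transport equation becomes
a rational identity. -/
theorem frame_deriv_re {m r a b σ l : ℝ} (h0 : r ≠ 0) (hs : σ ≠ 0) (hl : l = σ ^ 2)
    (hm : m = r * (1 - σ ^ 2) / 2) (hr : r - 2 * m = σ ^ 2 * r) :
    ((2 * m / (r * (r - 2 * m)) * a ^ 2 + (r - 3 * m) * b ^ 2) * l - a * (2 * m / r ^ 2 * a)) /
      l ^ 2 = (1 - 3 * m / r) / σ * b * (r * b / σ) := by
  rw [hr, hl]
  field_simp
  rw [hm]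
  ring

theorem frame_deriv_im {m r a b σ l : ℝ} (h0 : r ≠ 0) (hs : σ ≠ 0) (hl : l = σ ^ 2)
    (hm : m = r * (1 - σ ^ 2) / 2) (hr : r - 2 * m = σ ^ 2 * r) :
    ((a * b + r * (-(2 * (r - 3 * m) / (r * (r - 2 * m))) * a * b)) * σ -
      r * b * (2 * m / r ^ 2 * a / (2 * σ))) / σ ^ 2 =
      -((1 - 3 * m / r) / σ * b) * (a / l) := by
  rw [hr, hl]
  field_simp
  rw [hm]
  ring

/-- The velocity of a geodesic is parallel: in the orthonormal polar frame it rotates with the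
angular velocity `-κ φ'`. -/
theorem hasDeriv_frame (hM : 0 < M) {t : ℝ} (ht : t ∈ Icc (0 : ℝ) 1) :
    HasDerivWithinAt (fun t => frame M (A.pos t) (A.vel t))
      (-(connection M (A.pos t 0) * A.vel t 1 : ℝ) * Complex.I * frame M (A.pos t) (A.vel t))
      (Icc 0 1) t := by
  have hx := A.outside t ht
  have h0 : A.pos t 0 ≠ 0 := (A.pos_pos hM ht).ne'
  have hf := lapse_pos hM hx
  have hs : √(lapse M (A.pos t 0)) ≠ 0 := (Real.sqrt_pos.2 hf).ne'
  have hr := A.hasDeriv_coord 0 ht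
  have hvel := A.hasDeriv_vel t ht
  rw [geodesicAccel_opticalMetric hM hx] at hvel
  have hv0 := hasDerivWithinAt_pi.1 hvel 0
  have hv1 := hasDerivWithinAt_pi.1 hvel 1
  simp only [Matrix.cons_val_zero, Matrix.cons_val_one] at hv0 hv1
  have hlap : HasDerivWithinAt (fun t => lapse M (A.pos t 0))
      (2 * M / A.pos t 0 ^ 2 * A.vel t 0) (Icc 0 1) t :=
    HasDerivAt.comp_hasDerivWithinAt (h₂ := lapse M) (h := fun t => A.pos t 0) t
      (hasDerivAt_lapse hM hx) hr
  have hre := (hv0.div hlap hf.ne').ofReal_comp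
  have him := ((hr.mul hv1).div (hlap.sqrt hf.ne') hs).ofReal_comp
  have hfr : (fun t => frame M (A.pos t) (A.vel t)) = fun t =>
      ((A.vel t 0 / lapse M (A.pos t 0) : ℝ) : ℂ) +
        ((A.pos t 0 * A.vel t 1 / √(lapse M (A.pos t 0)) : ℝ) : ℂ) * Complex.I := by
    funext t; apply Complex.ext <;> simp [frame]
  rw [hfr]
  refine (hre.add (him.mul_const Complex.I)).congr_deriv ?_
  have hsq : √(lapse M (A.pos t 0)) ^ 2 = lapse M (A.pos t 0) := Real.sq_sqrt hf.le
  have hσr : A.pos t 0 - 2 * M = √(lapse M (A.pos t 0)) ^ 2 * A.pos t 0 := by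
    rw [hsq, lapse_eq hM hx, div_mul_cancel₀ _ h0]
  have hσM : M = A.pos t 0 * (1 - √(lapse M (A.pos t 0)) ^ 2) / 2 := by linarith
  apply Complex.ext
  · simp only [Complex.add_re, Complex.mul_re, Complex.neg_re, Complex.neg_im, Complex.ofReal_re,
      Complex.ofReal_im, Complex.I_re, Complex.I_im, Complex.mul_im, frame, connection, Pi.mul_apply]
    linear_combination frame_deriv_re (a := A.vel t 0) (b := A.vel t 1) h0 hs hsq.symm hσM hσr
  · simp only [Complex.add_im, Complex.mul_re, Complex.neg_re, Complex.neg_im, Complex.ofReal_re,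
      Complex.ofReal_im, Complex.I_re, Complex.I_im, Complex.mul_im, frame, connection, Pi.mul_apply]
    linear_combination frame_deriv_im (a := A.vel t 0) (b := A.vel t 1) h0 hs hsq.symm hσM hσr

/-- The integral of the connection form along an arc. -/
noncomputable def rotation : ℝ := ∫ t in (0 : ℝ)..1, connection M (A.pos t 0) * A.vel t 1

/-- The logarithm is built from three rotations: the velocity turns by `-∫ κ dφ` in the optical
frame, passing to the flat frame costs an angle that depends only on the endpoints, and the flat
frame itself turns with `φ`. The endpoint angles will cancel around a polygon. -/
theorem exists_log_planeVector (hM : 0 < M) : ∃ l : ℝ → ℂ, ContinuousOn l (Icc 0 1) ∧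
    (∀ t ∈ Icc (0 : ℝ) 1, Complex.exp (l t) = planeVector (A.pos t) (A.vel t)) ∧
    (l 1).im - (l 0).im = -A.rotation + (A.pos 1 1 - A.pos 0 1) -
      (Complex.arg (frame M (A.pos 1) (A.vel 1) / flatFrame (A.pos 1) (A.vel 1)) -
        Complex.arg (frame M (A.pos 0) (A.vel 0) / flatFrame (A.pos 0) (A.vel 0))) := by
  have hV0 : ∀ t ∈ Icc (0 : ℝ) 1, frame M (A.pos t) (A.vel t) ≠ 0 := fun t ht =>
    frame_ne_zero hM (A.outside t ht) (A.vel_ne_zero t ht)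
  have hW0 : ∀ t ∈ Icc (0 : ℝ) 1, flatFrame (A.pos t) (A.vel t) ≠ 0 := fun t ht =>
    flatFrame_ne_zero (A.pos_pos hM ht) (A.vel_ne_zero t ht)
  have hVc : ContinuousOn (fun t => frame M (A.pos t) (A.vel t)) (Icc 0 1) := fun t ht =>
    (A.hasDeriv_frame hM ht).continuousWithinAt
  obtain ⟨q, hq, hqe⟩ := PlaneCurve.exists_log_Icc hVc hV0
  have hslit : ∀ t ∈ Icc (0 : ℝ) 1,
      frame M (A.pos t) (A.vel t) / flatFrame (A.pos t) (A.vel t) ∈ Complex.slitPlane := by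
    intro t ht
    have hx := A.outside t ht
    have hf := lapse_pos hM hx
    have hs := Real.sqrt_pos.2 hf
    rw [Complex.mem_slitPlane_iff]
    left
    rw [Complex.div_re, ← add_div]
    refine div_pos ?_ (Complex.normSq_pos.2 (hW0 t ht))
    have hw' : A.vel t 0 ≠ 0 ∨ A.vel t 1 ≠ 0 := by
      by_contra! hc
      exact A.vel_ne_zero t ht (by ext i; fin_cases i; exacts [hc.1, hc.2])
    have h0 := A.pos_pos hM ht
    simp only [frame, flatFrame]
    have e : A.vel t 0 / lapse M (A.pos t 0) * A.vel t 0 +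
        A.pos t 0 * A.vel t 1 / √(lapse M (A.pos t 0)) * (A.pos t 0 * A.vel t 1) =
      A.vel t 0 ^ 2 / lapse M (A.pos t 0) +
        (A.pos t 0 * A.vel t 1) ^ 2 / √(lapse M (A.pos t 0)) := by ring
    rw [e]
    rcases hw' with h | h <;> positivity
  have hW := A.continuousOn_flatFrame
  refine ⟨fun t => q t - Complex.log (frame M (A.pos t) (A.vel t) / flatFrame (A.pos t) (A.vel t)) +
    A.pos t 1 * Complex.I, ?_, ?_, ?_⟩
  · exact (hq.sub ((hVc.div hW hW0).clog hslit)).add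
      ((Complex.continuous_ofReal.comp_continuousOn (A.continuousOn_coord 1)).mul continuousOn_const)
  · intro t ht
    rw [Complex.exp_add, Complex.exp_sub, hqe t ht,
      Complex.exp_log (Complex.slitPlane_ne_zero (hslit t ht)), planeVector, div_div_cancel₀ (hV0 t ht)]
  · have hint := PlaneCurve.log_arc (fun t ht => A.hasDeriv_frame hM ht) ?_ hq hqe
      (t := 1) (by simp)
    · have hcongr : ∫ s in (0 : ℝ)..1, -(connection M (A.pos s 0) * A.vel s 1 : ℝ) * Complex.I *
          frame M (A.pos s) (A.vel s) / frame M (A.pos s) (A.vel s) =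
          ∫ s in (0 : ℝ)..1, ((connection M (A.pos s 0) * A.vel s 1 : ℝ) : ℂ) * (-Complex.I) := by
        refine intervalIntegral.integral_congr fun s hs => ?_
        rw [uIcc_of_le zero_le_one] at hs
        have := hV0 s hs
        field_simp
      rw [hcongr, intervalIntegral.integral_mul_const, intervalIntegral.integral_ofReal] at hint
      have him := congrArg Complex.im hint
      simp only [Complex.sub_im, Complex.mul_im, Complex.ofReal_re, Complex.ofReal_im,
        Complex.neg_im, Complex.I_im, Complex.neg_re, Complex.I_re] at him
      simp only [Complex.add_im, Complex.sub_im, Complex.log_im, Complex.mul_im, Complex.ofReal_re,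
        Complex.ofReal_im, Complex.I_im, Complex.I_re, rotation]
      linarith
    · refine ContinuousOn.mul (ContinuousOn.mul (Complex.continuous_ofReal.comp_continuousOn
        (ContinuousOn.mul ?_ (A.continuousOn_velCoord 1))).neg continuousOn_const) hVc
      intro t ht
      exact ContinuousAt.comp_continuousWithinAt (g := connection M) (f := fun t => A.pos t 0)
        (hasDerivAt_connection hM (A.outside t ht)).continuousAt (A.continuousOn_coord 0 t ht)

end GeodesicArc

end Schwarzschild


/-! ## Geodesic polygons as closed curves -/

namespace Schwarzschild

open Surface Set Filter Topology

variable {M : ℝ}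

/-- The right-hand side of the geodesic equation as a first-order system. -/
noncomputable def geodesicField (M : ℝ) (y : Coord × Coord) : Coord × Coord :=
  (y.2, ![2 * M / (y.1 0 * (y.1 0 - 2 * M)) * y.2 0 ^ 2 + (y.1 0 - 3 * M) * y.2 1 ^ 2,
    -(2 * (y.1 0 - 3 * M) / (y.1 0 * (y.1 0 - 2 * M))) * y.2 0 * y.2 1])

theorem contDiffAt_geodesicField (hM : 0 < M) {y : Coord × Coord} (hy : 2 * M < y.1 0) :
    ContDiffAt ℝ 1 (geodesicField M) y := by
  have h0 : y.1 0 * (y.1 0 - 2 * M) ≠ 0 := by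
    apply mul_ne_zero <;> linarith
  have c0 : ContDiffAt ℝ 1 (fun y : Coord × Coord => y.1 0) y := by fun_prop
  have d0 : ContDiffAt ℝ 1 (fun y : Coord × Coord => y.2 0) y := by fun_prop
  have d1 : ContDiffAt ℝ 1 (fun y : Coord × Coord => y.2 1) y := by fun_prop
  refine contDiffAt_snd.prodMk (contDiffAt_pi.2 fun i => ?_)
  fin_cases i
  · exact ((contDiffAt_const.div (c0.mul (c0.sub contDiffAt_const)) h0).mul (d0.pow 2)).add
      ((c0.sub contDiffAt_const).mul (d1.pow 2))
  · exact (((contDiffAt_const.mul (c0.sub contDiffAt_const)).div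
      (c0.mul (c0.sub contDiffAt_const)) h0).neg.mul d0).mul d1

/-- A geodesic that starts in the direction opposite to the one in which another geodesic has
arrived runs back along it. -/
theorem exists_backtrack (hM : 0 < M) (A B : GeodesicArc M)
    (hj : toPlane (A.pos 1) = toPlane (B.pos 0)) {c : ℝ} (hc : 0 < c)
    (hv : B.vel 0 = -c • A.vel 1) :
    ∃ s, 0 < s ∧ s < 1 ∧ 0 < 1 - c * s ∧ 1 - c * s < 1 ∧ s ≠ 1 - c * s ∧
      toPlane (B.pos s) = toPlane (A.pos (1 - c * s)) := by
  have h0 : (0 : ℝ) ∈ Icc (0 : ℝ) 1 := by simp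
  have h1 : (1 : ℝ) ∈ Icc (0 : ℝ) 1 := by simp
  obtain ⟨hr, j, hφ⟩ := (toPlane_eq_iff (B.pos_pos hM h0) (A.pos_pos hM h1)).1 hj.symm
  -- The arcs meet in the plane, but their angle coordinates may differ by a multiple of `2π`.
  let w : Coord := ![0, j * (2 * Real.pi)]
  let F : ℝ → Coord × Coord := fun s => (B.pos s, B.vel s)
  -- The first arc run backwards at `c` times its speed. It solves the same system because the
  -- acceleration is quadratic in the velocity and independent of the angle.
  let G : ℝ → Coord × Coord := fun s => (A.pos (1 - c * s) + w, -c • A.vel (1 - c * s))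
  have hFG : F 0 = G 0 := by
    simp only [F, G, mul_zero, sub_zero, hv, Prod.mk.injEq, and_true]
    ext i; fin_cases i
    · simpa [w] using hr
    · simpa [w] using hφ
  set η : ℝ := min 1 c⁻¹ with hη
  have hη0 : 0 < η := by positivity
  have hη1 : η ≤ 1 := min_le_left _ _
  have hηc : ∀ s, s ≤ η → c * s ≤ 1 := fun s hs => by
    have : s ≤ c⁻¹ := hs.trans (min_le_right _ _)
    calc c * s ≤ c * c⁻¹ := by gcongr
      _ = 1 := mul_inv_cancel₀ hc.ne'
  have hF : ∀ s ∈ Ico 0 η, HasDerivWithinAt F (geodesicField M (F s)) (Ici s) s := by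
    intro s hs
    have hs' : s ∈ Icc (0 : ℝ) 1 := ⟨hs.1, hs.2.le.trans hη1⟩
    have hmem : Icc (0 : ℝ) 1 ∈ 𝓝[Ici s] s :=
      mem_of_superset (Icc_mem_nhdsGE (hs.2.trans_le hη1)) (Icc_subset_Icc_left hs.1)
    have e2 := B.hasDeriv_vel s hs'
    rw [geodesicAccel_opticalMetric hM (B.outside s hs')] at e2
    exact ((B.hasDeriv_pos s hs').prodMk e2).mono_of_mem_nhdsWithin hmem
  have hG : ∀ s ∈ Ico 0 η, HasDerivWithinAt G (geodesicField M (G s)) (Ici s) s := by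
    intro s hs
    have hcs := hηc s hs.2.le
    have hs' : 1 - c * s ∈ Icc (0 : ℝ) 1 := ⟨by linarith, by nlinarith [hs.1]⟩
    have hmaps : MapsTo (fun s => 1 - c * s) (Icc s η) (Icc 0 1) := fun x hx =>
      ⟨by linarith [hηc x hx.2], by nlinarith [hs.1, hx.1]⟩
    have hinner : HasDerivWithinAt (fun s : ℝ => 1 - c * s) (-c) (Icc s η) s := by
      simpa using (((hasDerivWithinAt_id s (Icc s η)).const_mul c).const_sub 1)
    have e1 := ((A.hasDeriv_pos _ hs').scomp s hinner hmaps).add_const w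
    have e2 := ((A.hasDeriv_vel _ hs').scomp s hinner hmaps).const_smul (-c)
    rw [geodesicAccel_opticalMetric hM (A.outside _ hs')] at e2
    have h3 := (e1.prodMk e2).mono_of_mem_nhdsWithin (Icc_mem_nhdsGE hs.2)
    refine h3.congr_deriv ?_
    simp only [geodesicField, G, Prod.mk.injEq, true_and]
    ext i
    fin_cases i <;> simp [w] <;> ring
  have hy : 2 * M < (F 0).1 0 := B.outside 0 h0
  obtain ⟨K, U, hU, hLip⟩ := (contDiffAt_geodesicField hM hy).exists_lipschitzOnWith
  have hFc : ContinuousOn F (Icc 0 η) := fun s hs =>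
    ((B.continuousOn_pos s ⟨hs.1, hs.2.trans hη1⟩).prodMk
      (B.continuousOn_vel s ⟨hs.1, hs.2.trans hη1⟩)).mono (Icc_subset_Icc_right hη1)
  have hmapsG : MapsTo (fun s => 1 - c * s) (Icc 0 η) (Icc 0 1) := fun x hx =>
    ⟨by linarith [hηc x hx.2], by nlinarith [hx.1]⟩
  have hGc : ContinuousOn G (Icc 0 η) := by
    refine ContinuousOn.prodMk ?_ ?_
    · exact (A.continuousOn_pos.comp (by fun_prop) hmapsG).add continuousOn_const
    · exact (A.continuousOn_vel.comp (by fun_prop) hmapsG).const_smul (-c)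
  have h0η : (0 : ℝ) ∈ Icc 0 η := ⟨le_rfl, hη0.le⟩
  have evF : ∀ᶠ s in 𝓝[≥] (0 : ℝ), F s ∈ U := by
    have := (hFc 0 h0η).mono_of_mem_nhdsWithin (Icc_mem_nhdsGE hη0)
    exact this hU
  have evG : ∀ᶠ s in 𝓝[≥] (0 : ℝ), G s ∈ U := by
    have := (hGc 0 h0η).mono_of_mem_nhdsWithin (Icc_mem_nhdsGE hη0)
    exact this (hFG ▸ hU)
  obtain ⟨δ, hδ, hδU⟩ := mem_nhdsGE_iff_exists_Ico_subset.1 (evF.and evG)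
  rw [mem_Ioi] at hδ
  set b := min (δ / 2) (η / 2) with hb
  have hb0 : 0 < b := by positivity
  have hbδ : b < δ := (min_le_left _ _).trans_lt (by linarith)
  have hbη : b ≤ η / 2 := min_le_right _ _
  have huniq := ODE_solution_unique_of_mem_Icc_right (v := fun _ => geodesicField M)
    (s := fun _ => U) (K := K) (f := F) (g := G) (a := 0) (b := b) (fun _ _ => hLip)
    (hFc.mono (Icc_subset_Icc_right (by linarith)))
    (fun s hs => hF s ⟨hs.1, by linarith [hs.2]⟩)
    (fun s hs => (hδU ⟨hs.1, hs.2.trans hbδ⟩).1)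
    (hGc.mono (Icc_subset_Icc_right (by linarith)))
    (fun s hs => hG s ⟨hs.1, by linarith [hs.2]⟩)
    (fun s hs => (hδU ⟨hs.1, hs.2.trans hbδ⟩).2) hFG
  have hfin : ∀ s, 0 < s → s ≤ b → toPlane (B.pos s) = toPlane (A.pos (1 - c * s)) := by
    intro s hs0 hsb
    have hcs := hηc s (by linarith)
    have hpos := congrArg Prod.fst (huniq ⟨hs0.le, hsb⟩)
    simp only [F, G] at hpos
    refine (toPlane_eq_iff (B.pos_pos hM ⟨hs0.le, by linarith⟩)
      (A.pos_pos hM ⟨by linarith, by nlinarith⟩)).2 ⟨?_, j, ?_⟩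
    · rw [hpos]; simp [w]
    · rw [hpos]; simp [w]
  have hfacts : ∀ s, 0 < s → s ≤ b → s < 1 ∧ 0 < 1 - c * s ∧ 1 - c * s < 1 := by
    intro s hs0 hsb
    refine ⟨by linarith, ?_, by nlinarith⟩
    have := hηc (2 * s) (by linarith)
    nlinarith
  -- If the two parameters happened to be equal, the coincidence would not contradict simplicity of
  -- a loop, where both arcs are the same edge. Halving `b` separates them.
  by_cases hbc : b = 1 - c * b
  · have hb2 : b / 2 ≠ 1 - c * (b / 2) := by intro h; linarith
    obtain ⟨f1, f2, f3⟩ := hfacts (b / 2) (by linarith) (by linarith)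
    exact ⟨b / 2, by linarith, f1, f2, f3, hb2, hfin _ (by linarith) (by linarith)⟩
  · obtain ⟨f1, f2, f3⟩ := hfacts b hb0 le_rfl
    exact ⟨b, hb0, f1, f2, f3, hbc, hfin _ hb0 le_rfl⟩

namespace GeodesicPolygon

variable {n : ℕ} [NeZero n]

/-- The reduction of an integer modulo `n`. -/
def index (n : ℕ) [NeZero n] (k : ℤ) : Fin n := (ZMod.finEquiv n).symm (k : ZMod n)

theorem index_succ (k : ℤ) : index n (k + 1) = index n k + 1 := by
  simp [index]

theorem index_add (k : ℤ) : index n (k + n) = index n k := by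
  simp [index]

theorem index_eq {k l : ℤ} (h : index n k = index n l) : ∃ j : ℤ, l = k + j * n := by
  have h1 : (k : ZMod n) = l := (ZMod.finEquiv n).symm.injective h
  obtain ⟨j, hj⟩ := (ZMod.intCast_eq_intCast_iff_dvd_sub k l n).1 h1
  exact ⟨j, by linarith⟩

theorem sum_index {α : Type*} [AddCommMonoid α] (F : Fin n → α) :
    ∑ k ∈ Finset.range n, F (index n k) = ∑ i, F i := by
  have hinj : Set.InjOn (fun k : ℕ => index n k) (Finset.range n : Set ℕ) := by
    intro a ha b hb h
    obtain ⟨j, hj⟩ := index_eq h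
    simp only [Finset.coe_range, mem_Iio] at ha hb
    have hj0 : j = 0 := by
      have : (b : ℤ) < n := by exact_mod_cast hb
      have : (a : ℤ) < n := by exact_mod_cast ha
      by_contra hc
      rcases lt_or_gt_of_ne hc with h | h <;> nlinarith
    subst hj0
    have : (b : ℤ) = a := by simpa using hj
    exact_mod_cast this.symm
  have himg : (Finset.range n).image (fun k : ℕ => index n k) = Finset.univ := by
    apply Finset.eq_univ_of_card
    rw [Finset.card_image_of_injOn hinj]
    simp
  rw [← himg, Finset.sum_image hinj]

theorem exp_coord_eq (hM : 0 < M) (P : GeodesicPolygon M n) (i : Fin n) :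
    (P.edge i).pos 1 0 = (P.edge (i + 1)).pos 0 0 ∧
    Complex.exp ((P.edge i).pos 1 1 * Complex.I) =
      Complex.exp ((P.edge (i + 1)).pos 0 1 * Complex.I) := by
  have h0 := (P.edge (i + 1)).pos_pos hM (t := 0) (by simp)
  have h1 := (P.edge i).pos_pos hM (t := 1) (by simp)
  exact ⟨((toPlane_eq_iff h1 h0).1 (P.closed i)).1, exp_eq_of_toPlane_eq h1 h0 (P.closed i)⟩

/-- The factor `exp (iφ)` is common to both edges although their angle coordinates may disagree, so
directions at a corner compare in one frame. -/
theorem planeVector_div (hM : 0 < M) (P : GeodesicPolygon M n) (i : Fin n) :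
    planeVector ((P.edge (i + 1)).pos 0) ((P.edge (i + 1)).vel 0) /
      planeVector ((P.edge i).pos 1) ((P.edge i).vel 1) =
    flatFrame ((P.edge (i + 1)).pos 0) ((P.edge (i + 1)).vel 0) /
      flatFrame ((P.edge (i + 1)).pos 0) ((P.edge i).vel 1) := by
  obtain ⟨h1, h2⟩ := P.exp_coord_eq hM i
  have h3 : flatFrame ((P.edge i).pos 1) ((P.edge i).vel 1) =
      flatFrame ((P.edge (i + 1)).pos 0) ((P.edge i).vel 1) := by rw [flatFrame, flatFrame, h1]
  rw [planeVector, planeVector, h2, h3, mul_div_mul_right _ _ (Complex.exp_ne_zero _)]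

/-- Otherwise the outgoing velocity is a negative multiple of the incoming one. By uniqueness of
geodesics the new edge retraces the old one, against simplicity. -/
theorem noCusp (hM : 0 < M) (P : GeodesicPolygon M n) (i : Fin n) :
    planeVector ((P.edge (i + 1)).pos 0) ((P.edge (i + 1)).vel 0) /
      planeVector ((P.edge i).pos 1) ((P.edge i).vel 1) ∈ Complex.slitPlane := by
  have h0I : (0 : ℝ) ∈ Icc (0 : ℝ) 1 := by simp
  have h1I : (1 : ℝ) ∈ Icc (0 : ℝ) 1 := by simp
  have hr := (P.edge (i + 1)).pos_pos hM h0I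
  have hW1 := flatFrame_ne_zero hr ((P.edge i).vel_ne_zero 1 h1I)
  have hW2 := flatFrame_ne_zero hr ((P.edge (i + 1)).vel_ne_zero 0 h0I)
  rw [P.planeVector_div hM i]
  by_contra hc
  rw [Complex.mem_slitPlane_iff] at hc
  push Not at hc
  set q := flatFrame ((P.edge (i + 1)).pos 0) ((P.edge (i + 1)).vel 0) /
      flatFrame ((P.edge (i + 1)).pos 0) ((P.edge i).vel 1) with hq
  have hq0 : q ≠ 0 := div_ne_zero hW2 hW1
  have hqr : q = (q.re : ℂ) := Complex.ext rfl (by simp [hc.2])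
  have hneg : q.re < 0 := lt_of_le_of_ne hc.1 fun h => hq0 (by rw [hqr, h]; simp)
  have hmul : flatFrame ((P.edge (i + 1)).pos 0) ((P.edge (i + 1)).vel 0) =
      (q.re : ℂ) * flatFrame ((P.edge (i + 1)).pos 0) ((P.edge i).vel 1) := by
    rw [← hqr, hq, div_mul_cancel₀ _ hW1]
  have hvel : (P.edge (i + 1)).vel 0 = -(-q.re) • (P.edge i).vel 1 := by
    have h1 := congrArg Complex.re hmul
    have h2 := congrArg Complex.im hmul
    simp only [Complex.re_ofReal_mul, Complex.im_ofReal_mul, flatFrame] at h1 h2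
    rw [neg_neg]
    ext k
    fin_cases k
    · simpa using h1
    · have : (P.edge (i + 1)).pos 0 0 * (P.edge (i + 1)).vel 0 1 =
          (P.edge (i + 1)).pos 0 0 * (q.re * (P.edge i).vel 1 1) := by linarith
      simpa using mul_left_cancel₀ hr.ne' this
  obtain ⟨s, hs0, hs1, ht0, ht1, hne, heq⟩ := exists_backtrack hM (P.edge i) (P.edge (i + 1))
    (P.closed i) (c := -q.re) (by linarith) hvel
  exact hne (P.simple _ _ s ⟨hs0.le, hs1⟩ _ ⟨ht0.le, ht1⟩ heq).2

/-- The boundary of a polygon as a closed curve in the plane. -/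
noncomputable def toClosedCurve (hM : 0 < M) (P : GeodesicPolygon M n) :
    PlaneCurve.ClosedCurve n where
  n_pos := Nat.pos_of_ne_zero (NeZero.ne n)
  c k t := toPlane ((P.edge (index n k)).pos t)
  d k t := planeVector ((P.edge (index n k)).pos t) ((P.edge (index n k)).vel t)
  hasDeriv k _ ht := (P.edge (index n k)).hasDeriv_toPlane ht
  cont_d k := (P.edge (index n k)).continuousOn_planeVector
  d_ne k t ht := planeVector_ne_zero ((P.edge (index n k)).pos_pos hM ht)
    ((P.edge (index n k)).vel_ne_zero t ht)
  join k := by rw [index_succ]; exact P.closed _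
  per_c k := by rw [index_add]
  per_d k := by rw [index_add]
  inj k l s hs t ht h := by
    obtain ⟨h1, h2⟩ := P.simple _ _ s hs t ht h
    obtain ⟨j, hj⟩ := index_eq h1
    exact ⟨j, hj, h2⟩
  noCusp k := by rw [index_succ]; exact P.noCusp hM _

theorem trace_toClosedCurve (hM : 0 < M) (P : GeodesicPolygon M n) :
    (P.toClosedCurve hM).trace = P.boundary := by
  apply Subset.antisymm
  · rintro _ ⟨t, rfl⟩
    exact mem_iUnion.2 ⟨index n ⌊t⌋, Int.fract t, ⟨Int.fract_nonneg t, (Int.fract_lt_one t).le⟩, rfl⟩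
  · intro z hz
    obtain ⟨i, t, ht, rfl⟩ := mem_iUnion.1 hz
    have hk : ∃ k : ℤ, index n k = i := by
      refine ⟨((ZMod.finEquiv n i).val : ℤ), ?_⟩
      simp [index]
    obtain ⟨k, rfl⟩ := hk
    exact (P.toClosedCurve hM).c_mem_trace k ht

/-- An angle `π` in the optical metric makes the outgoing velocity a negative multiple of the
incoming one, hence also a cusp in the flat frame. The strict bound is what excludes digons and
loops without the hole. -/
theorem abs_exteriorAngle_lt (hM : 0 < M) (P : GeodesicPolygon M n) (i : Fin n) :
    |P.exteriorAngle i| < Real.pi := by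
  have h0I : (0 : ℝ) ∈ Icc (0 : ℝ) 1 := by simp
  have h1I : (1 : ℝ) ∈ Icc (0 : ℝ) 1 := by simp
  have hx := (P.edge (i + 1)).outside 0 h0I
  have hr := (P.edge (i + 1)).pos_pos hM h0I
  have hu := (P.edge i).vel_ne_zero 1 h1I
  have hc := P.noCusp hM i
  rw [P.planeVector_div hM] at hc
  have hW1 := flatFrame_ne_zero hr hu
  rw [exteriorAngle, signedAngle_eq hM hx, abs_lt]
  refine ⟨Complex.neg_pi_lt_arg _, lt_of_le_of_ne (Complex.arg_le_pi _) fun h => ?_⟩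
  rw [Complex.arg_eq_pi_iff] at h
  have hf := lapse_pos hM hx
  have hs := Real.sqrt_pos.2 hf
  generalize (P.edge (i + 1)).pos 0 = x at *
  generalize (P.edge (i + 1)).vel 0 = v at *
  generalize (P.edge i).vel 1 = u at *
  have e2 : x 0 * (u 0 * v 1 - u 1 * v 0) / (lapse M (x 0) * √(lapse M (x 0))) = 0 := by
    rw [← h.2]
    simp only [frame, Complex.mul_im, Complex.conj_re, Complex.conj_im]
    field_simp
    ring
  have e3 : u 0 * v 1 - u 1 * v 0 = 0 := by
    rcases div_eq_zero_iff.1 e2 with h | h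
    · exact (mul_eq_zero.1 h).resolve_left hr.ne'
    · exact absurd h (by positivity)
  have e1 : (u 0 * v 0) / lapse M (x 0) ^ 2 + x 0 ^ 2 * (u 1 * v 1) / √(lapse M (x 0)) ^ 2 < 0 := by
    refine lt_of_eq_of_lt ?_ h.1
    simp only [frame, Complex.mul_re, Complex.conj_re, Complex.conj_im]
    field_simp
    ring
  have hn := Complex.normSq_pos.2 hW1
  rw [Complex.mem_slitPlane_iff] at hc
  have him : (flatFrame x v / flatFrame x u).im = 0 := by
    rw [Complex.div_im]; simp only [flatFrame]
    rw [div_sub_div_same, div_eq_zero_iff]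
    left
    linear_combination x 0 * e3
  rcases hc with hc | hc
  · rw [Complex.div_re, ← add_div] at hc
    have hc' := (div_pos_iff_of_pos_right hn).1 hc
    simp only [flatFrame] at hc'
    -- `v` is a multiple of `u`
    have hcase : u 0 ≠ 0 ∨ u 1 ≠ 0 := by
      by_contra! hcc
      exact hu (by ext i; fin_cases i; exacts [hcc.1, hcc.2])
    rcases hcase with h0 | h0
    · have hv1 : v 1 = v 0 / u 0 * u 1 := by field_simp; linarith
      have k1 : v 0 / u 0 * (u 0 ^ 2 / lapse M (x 0) ^ 2 +
          (x 0 * u 1) ^ 2 / √(lapse M (x 0)) ^ 2) < 0 := by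
        refine lt_of_eq_of_lt ?_ e1
        rw [hv1]; field_simp
      have k2 : 0 < v 0 / u 0 * (u 0 ^ 2 + (x 0 * u 1) ^ 2) := by
        refine lt_of_lt_of_eq hc' ?_
        rw [hv1]; field_simp
      have k3 : 0 < v 0 / u 0 := pos_of_mul_pos_left k2 (by positivity)
      have : 0 ≤ v 0 / u 0 * (u 0 ^ 2 / lapse M (x 0) ^ 2 +
          (x 0 * u 1) ^ 2 / √(lapse M (x 0)) ^ 2) := by positivity
      linarith
    · have hv1 : v 0 = v 1 / u 1 * u 0 := by field_simp; linarith
      have k1 : v 1 / u 1 * (u 0 ^ 2 / lapse M (x 0) ^ 2 +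
          (x 0 * u 1) ^ 2 / √(lapse M (x 0)) ^ 2) < 0 := by
        refine lt_of_eq_of_lt ?_ e1
        rw [hv1]; field_simp
      have k2 : 0 < v 1 / u 1 * (u 0 ^ 2 + (x 0 * u 1) ^ 2) := by
        refine lt_of_lt_of_eq hc' ?_
        rw [hv1]; field_simp
      have k3 : 0 < v 1 / u 1 := pos_of_mul_pos_left k2 (by positivity)
      have : 0 ≤ v 1 / u 1 * (u 0 ^ 2 / lapse M (x 0) ^ 2 +
          (x 0 * u 1) ^ 2 / √(lapse M (x 0)) ^ 2) := by positivity
      linarith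
  · exact hc him

/-- Along an edge, `log r + iφ` is a logarithm of the curve, so `φ` measures the winding around the
centre. -/
theorem sum_increment (hM : 0 < M) (P : GeodesicPolygon M n)
    (h0 : (0 : ℂ) ∉ (P.toClosedCurve hM).trace) :
    ∑ i, ((P.edge i).pos 1 1 - (P.edge i).pos 0 1) =
      2 * Real.pi * (P.toClosedCurve hM).wind 0 := by
  have hI : ∀ i, (∫ t in (0 : ℝ)..1, planeVector ((P.edge i).pos t) ((P.edge i).vel t) /
      (toPlane ((P.edge i).pos t) - 0)).im = (P.edge i).pos 1 1 - (P.edge i).pos 0 1 := by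
    intro i
    have := PlaneCurve.log_arc (c := fun t => toPlane ((P.edge i).pos t) - 0)
      (l := fun t => ((Real.log ((P.edge i).pos t 0) : ℝ) : ℂ) + (P.edge i).pos t 1 * Complex.I)
      (fun t ht => ((P.edge i).hasDeriv_toPlane ht).sub_const 0)
      (P.edge i).continuousOn_planeVector
      ((Complex.continuous_ofReal.comp_continuousOn
        (((P.edge i).continuousOn_coord 0).log fun t ht => ((P.edge i).pos_pos hM ht).ne')).add
        ((Complex.continuous_ofReal.comp_continuousOn ((P.edge i).continuousOn_coord 1)).mul
          continuousOn_const))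
      (fun t ht => by
        rw [Complex.exp_add, ← Complex.ofReal_exp, Real.exp_log ((P.edge i).pos_pos hM ht), sub_zero,
          toPlane]) (t := 1) (by simp)
    rw [← this]
    simp
  have hw := (P.toClosedCurve hM).windInt_eq h0
  rw [PlaneCurve.ClosedCurve.windInt, inv_mul_eq_iff_eq_mul₀ (by simp [Real.pi_ne_zero])] at hw
  have him := congrArg Complex.im hw
  rw [Complex.im_sum, ← sum_index] at *
  refine Eq.trans (Finset.sum_congr rfl fun k _ => (hI (index n k)).symm) (him.trans ?_)
  simp

/-- The Gauss–Bonnet formula before the curvature integral is introduced. -/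
theorem sum_exteriorAngle (hM : 0 < M) (P : GeodesicPolygon M n) {m : ℤ}
    (hm : ∀ l : ℤ → ℝ → ℂ, (∀ k, ContinuousOn (l k) (Icc 0 1)) →
      (∀ k, ∀ t ∈ Icc (0 : ℝ) 1, Complex.exp (l k t) = (P.toClosedCurve hM).d k t) →
      2 * Real.pi * Complex.I * m = ∑ k ∈ Finset.range n, (l k 1 - l k 0 +
        Complex.log ((P.toClosedCurve hM).d (k + 1) 0 / (P.toClosedCurve hM).d k 1)))
    (h0 : (0 : ℂ) ∉ (P.toClosedCurve hM).trace) :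
    ∑ i, P.exteriorAngle i =
      2 * Real.pi * (m - (P.toClosedCurve hM).wind 0) + ∑ i, (P.edge i).rotation := by
  choose l hl he hli using fun i => (P.edge i).exists_log_planeVector hM
  have key := congrArg Complex.im (hm (fun k => l (index n k)) (fun k => hl _) (fun k => he _))
  rw [Complex.im_sum] at key
  set δ : Fin n → ℝ := fun i => Complex.arg (frame M ((P.edge i).pos 0) ((P.edge i).vel 0) /
    flatFrame ((P.edge i).pos 0) ((P.edge i).vel 0)) with hδ
  have hterm : ∀ k : ℤ, (l (index n k) 1 - l (index n k) 0 + Complex.log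
      ((P.toClosedCurve hM).d (k + 1) 0 / (P.toClosedCurve hM).d k 1)).im =
      P.exteriorAngle (index n k) - (P.edge (index n k)).rotation +
        ((P.edge (index n k)).pos 1 1 - (P.edge (index n k)).pos 0 1) -
        (δ (index n k + 1) - δ (index n k)) := by
    intro k
    have hd : (P.toClosedCurve hM).d (k + 1) 0 / (P.toClosedCurve hM).d k 1 =
        planeVector ((P.edge (index n k + 1)).pos 0) ((P.edge (index n k + 1)).vel 0) /
        planeVector ((P.edge (index n k)).pos 1) ((P.edge (index n k)).vel 1) := by
      simp only [toClosedCurve, index_succ]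
    set i := index n k
    have hx := (P.edge (i + 1)).outside 0 (by simp)
    have hr := (P.exp_coord_eq hM i).1
    rw [Complex.add_im, Complex.sub_im, hli i, hd, P.planeVector_div hM i, Complex.log_im,
      arg_flatFrame hM hx ((P.edge i).vel_ne_zero 1 (by simp))
        ((P.edge (i + 1)).vel_ne_zero 0 (by simp)), exteriorAngle]
    have e1 : frame M ((P.edge i).pos 1) ((P.edge i).vel 1) =
        frame M ((P.edge (i + 1)).pos 0) ((P.edge i).vel 1) := by rw [frame, frame, hr]
    have e2 : flatFrame ((P.edge i).pos 1) ((P.edge i).vel 1) =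
        flatFrame ((P.edge (i + 1)).pos 0) ((P.edge i).vel 1) := by rw [flatFrame, flatFrame, hr]
    rw [e1, e2]
    simp only [hδ]
    ring
  rw [Finset.sum_congr rfl fun (k : ℕ) _ => hterm k,
    sum_index (fun i => P.exteriorAngle i - (P.edge i).rotation +
      ((P.edge i).pos 1 1 - (P.edge i).pos 0 1) - (δ (i + 1) - δ i))] at key
  -- The angles between the optical and the flat frame at the corners cancel cyclically.
  have hshift : ∑ i, δ (i + 1) = ∑ i, δ i := Equiv.sum_comp (Equiv.addRight (1 : Fin n)) δ
  have hδ0 : ∑ i, (δ (i + 1) - δ i) = 0 := by rw [Finset.sum_sub_distrib, hshift, sub_self]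
  have hinc := P.sum_increment hM h0
  rw [Finset.sum_sub_distrib, Finset.sum_add_distrib, Finset.sum_sub_distrib, hδ0, hinc] at key
  simp only [Complex.mul_im, Complex.mul_re, Complex.re_ofNat, Complex.im_ofNat, Complex.ofReal_re,
    Complex.ofReal_im, Complex.I_re, Complex.I_im, Complex.intCast_re, Complex.intCast_im] at key
  linarith

end GeodesicPolygon

end Schwarzschild


/-! ## Green's formula for the winding number -/

namespace PlaneCurve

open Complex Set Filter Topology MeasureTheory
open scoped ENNReal

theorem integral_inv_sub_circle_periodic (c : ℂ) (ρ : ℝ) :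
    ∫ φ in (-Real.pi)..Real.pi, (c - ρ * exp (φ * I))⁻¹ =
      ∫ φ in (0 : ℝ)..2 * Real.pi, (c - ρ * exp (φ * I))⁻¹ := by
  have hp : Function.Periodic (fun φ : ℝ => (c - ρ * exp (φ * I))⁻¹) (2 * Real.pi) := by
    intro φ
    have : ((φ + 2 * Real.pi : ℝ) : ℂ) * I = φ * I + 2 * Real.pi * I := by push_cast; ring
    simp only [this, exp_periodic (φ * I)]
  have := hp.intervalIntegral_add_eq (-Real.pi) 0
  rw [zero_add, show -Real.pi + 2 * Real.pi = Real.pi by ring] at this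
  exact this

/-- On the circle `dz = iz dφ`, so the extra factor `1/z` produces the angular integral. Cauchy's
formula then evaluates it when `c` is outside the circle, and two cancelling residues when `c` is
inside. -/
theorem circleIntegral_inv_mul_inv (c : ℂ) {ρ : ℝ} (hρ : 0 < ρ) :
    (∮ z in C(0, ρ), z⁻¹ * (c - z)⁻¹) =
      I * ∫ φ in (-Real.pi)..Real.pi, (c - ρ * exp (φ * I))⁻¹ := by
  rw [integral_inv_sub_circle_periodic, circleIntegral, ← intervalIntegral.integral_const_mul]
  refine intervalIntegral.integral_congr fun φ _ => ?_
  have hρ' : (ρ : ℂ) ≠ 0 := by exact_mod_cast hρ.ne'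
  have := exp_ne_zero (φ * I)
  simp only [deriv_circleMap, circleMap, zero_add, smul_eq_mul]
  field_simp

theorem integral_inv_sub_circle_of_lt {c : ℂ} {ρ : ℝ} (hρ : 0 < ρ) (h : ρ < ‖c‖) :
    ∫ φ in (-Real.pi)..Real.pi, (c - ρ * exp (φ * I))⁻¹ = 2 * Real.pi * c⁻¹ := by
  have hne : ∀ z ∈ Metric.closedBall (0 : ℂ) ρ, c - z ≠ 0 := by
    intro z hz h0
    rw [mem_closedBall_zero_iff] at hz
    rw [sub_eq_zero.1 h0] at h
    linarith
  have h1 := circleIntegral_sub_inv_smul_of_differentiable_on_off_countable (R := ρ) (c := 0)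
    (w := 0) (f := fun z => (c - z)⁻¹) (s := ∅) countable_empty (by simpa)
    (ContinuousOn.inv₀ (by fun_prop) hne)
    (fun z hz => DifferentiableAt.inv (by fun_prop) (hne z (Metric.ball_subset_closedBall hz.1)))
  simp only [sub_zero, smul_eq_mul] at h1
  rw [circleIntegral_inv_mul_inv c hρ] at h1
  refine mul_left_cancel₀ I_ne_zero (h1.trans ?_)
  ring

theorem integral_inv_sub_circle_of_gt {c : ℂ} {ρ : ℝ} (hc : c ≠ 0) (h : ‖c‖ < ρ) :
    ∫ φ in (-Real.pi)..Real.pi, (c - ρ * exp (φ * I))⁻¹ = 0 := by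
  have hρ : 0 < ρ := (norm_nonneg c).trans_lt h
  have h1 := circleIntegral_inv_mul_inv c hρ
  have h2 : (∮ z in C(0, ρ), z⁻¹ * (c - z)⁻¹) =
      ∮ z in C(0, ρ), (c⁻¹ • ((z - 0)⁻¹ - (z - c)⁻¹)) := by
    refine circleIntegral.integral_congr hρ.le fun z hz => ?_
    have hz' : ‖z‖ = ρ := by simpa using hz
    have hz0 : z ≠ 0 := by rintro rfl; simp at hz'; linarith
    have hzc : c - z ≠ 0 := by intro h0; rw [sub_eq_zero.1 h0] at h; linarith
    have hzc' : z - c ≠ 0 := by intro h0; exact hzc (by linear_combination -h0)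
    simp only [sub_zero, smul_eq_mul]
    field_simp
    ring
  have hmem : c ∈ Metric.ball (0 : ℂ) ρ := by simpa
  rw [h2, circleIntegral.integral_smul, circleIntegral.integral_sub,
    circleIntegral.integral_sub_inv_of_mem_ball hmem,
    circleIntegral.integral_sub_inv_of_mem_ball (Metric.mem_ball_self hρ), sub_self,
    smul_zero] at h1
  · exact (mul_eq_zero.1 h1.symm).resolve_left I_ne_zero
  · refine ContinuousOn.circleIntegrable hρ.le (ContinuousOn.inv₀ (by fun_prop) fun z hz h0 => ?_)
    have hz' : ‖z‖ = ρ := by simpa using hz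
    rw [sub_zero] at h0
    rw [h0, norm_zero] at hz'; linarith
  · refine ContinuousOn.circleIntegrable hρ.le (ContinuousOn.inv₀ (by fun_prop) fun z hz h0 => ?_)
    have hz' : ‖z‖ = ρ := by simpa using hz
    rw [sub_eq_zero.1 h0] at hz'; linarith

/-- The polar area factor `r` cancels the singularity `1/r`. -/
theorem lintegral_inv_closedBall (S : ℝ) :
    ∫⁻ z in Metric.closedBall (0 : ℂ) S, ‖z⁻¹‖ₑ ≤
      ENNReal.ofReal S * ENNReal.ofReal (Real.pi - -Real.pi) := by
  rw [← lintegral_indicator Metric.isClosed_closedBall.measurableSet,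
    ← Complex.lintegral_comp_polarCoord_symm]
  have hvol : volume (Ioc (0 : ℝ) S ×ˢ Ioo (-Real.pi) Real.pi) =
      ENNReal.ofReal S * ENNReal.ofReal (Real.pi - -Real.pi) := by
    rw [Measure.volume_eq_prod, Measure.prod_prod, Real.volume_Ioc, Real.volume_Ioo, sub_zero]
  rw [← hvol, ← lintegral_indicator_one (measurableSet_Ioc.prod measurableSet_Ioo),
    ← lintegral_indicator polarCoord.open_target.measurableSet]
  refine lintegral_mono fun p => ?_
  by_cases hp : p ∈ polarCoord.target
  · rw [indicator_of_mem hp]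
    have hp' : 0 < p.1 ∧ p.2 ∈ Ioo (-Real.pi) Real.pi := hp
    have hn : ‖Complex.polarCoord.symm p‖ = p.1 := by
      rw [Complex.norm_polarCoord_symm, abs_of_pos hp'.1]
    by_cases hs : Complex.polarCoord.symm p ∈ Metric.closedBall (0 : ℂ) S
    · have hm : p ∈ Ioc (0 : ℝ) S ×ˢ Ioo (-Real.pi) Real.pi := by
        rw [mem_closedBall_zero_iff, hn] at hs
        exact ⟨⟨hp'.1, hs⟩, hp'.2⟩
      rw [indicator_of_mem hs, indicator_of_mem hm, ← ofReal_norm, norm_inv, hn, smul_eq_mul,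
        ← ENNReal.ofReal_mul hp'.1.le, mul_inv_cancel₀ hp'.1.ne']
      simp
    · rw [indicator_of_notMem hs]; simp
  · rw [indicator_of_notMem hp]; simp

/-- The Cauchy kernel is integrable in polar coordinates, uniformly in the position of the pole. -/
theorem lintegral_inv_polar {r₀ R : ℝ} (hr : 0 < r₀) {c : ℂ} (hc : ‖c‖ ≤ R) :
    ∫⁻ p in Icc r₀ R ×ˢ Ioo (-Real.pi) Real.pi, ‖(c - p.1 * exp (p.2 * I))⁻¹‖ₑ ≤
      ENNReal.ofReal r₀⁻¹ * (ENNReal.ofReal (2 * R) * ENNReal.ofReal (Real.pi - -Real.pi)) := by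
  refine le_trans ?_ (mul_le_mul_right (lintegral_inv_closedBall (2 * R)) _)
  -- Moving the pole to the origin carries the disc of radius `R` into the disc of radius `2R`.
  have hshift : ∫⁻ z in Metric.closedBall (0 : ℂ) R, ‖(c - z)⁻¹‖ₑ ≤
      ∫⁻ z in Metric.closedBall (0 : ℂ) (2 * R), ‖z⁻¹‖ₑ := by
    rw [← lintegral_indicator Metric.isClosed_closedBall.measurableSet,
      ← lintegral_indicator Metric.isClosed_closedBall.measurableSet,
      ← lintegral_sub_left_eq_self _ c]
    refine lintegral_mono fun z => ?_
    by_cases hz : c - z ∈ Metric.closedBall (0 : ℂ) R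
    · have hz' : z ∈ Metric.closedBall (0 : ℂ) (2 * R) := by
        rw [mem_closedBall_zero_iff] at hz ⊢
        have := norm_sub_le c (c - z)
        rw [sub_sub_cancel] at this
        linarith
      rw [indicator_of_mem hz, indicator_of_mem hz', sub_sub_cancel]
    · rw [indicator_of_notMem hz]; simp
  refine le_trans ?_ (mul_le_mul_right hshift _)
  rw [← lintegral_indicator Metric.isClosed_closedBall.measurableSet,
    ← Complex.lintegral_comp_polarCoord_symm, ← lintegral_const_mul' _ _ ENNReal.ofReal_ne_top,
    ← lintegral_indicator (measurableSet_Icc.prod measurableSet_Ioo),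
    ← lintegral_indicator polarCoord.open_target.measurableSet]
  refine lintegral_mono fun p => ?_
  by_cases hp : p ∈ Icc r₀ R ×ˢ Ioo (-Real.pi) Real.pi
  · have hp1 : 0 < p.1 := hr.trans_le hp.1.1
    have ht : p ∈ polarCoord.target := ⟨hp1, hp.2⟩
    have hn : ‖Complex.polarCoord.symm p‖ = p.1 := by
      rw [Complex.norm_polarCoord_symm, abs_of_pos hp1]
    have hb : Complex.polarCoord.symm p ∈ Metric.closedBall (0 : ℂ) R := by
      rw [mem_closedBall_zero_iff, hn]; exact hp.1.2
    rw [indicator_of_mem hp, indicator_of_mem ht, indicator_of_mem hb,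
      Complex.polarCoord_symm_apply, smul_eq_mul, ← mul_assoc,
      ← ENNReal.ofReal_mul (inv_nonneg.2 hr.le), exp_mul_I, ← ofReal_cos, ← ofReal_sin]
    refine le_mul_of_one_le_left zero_le ?_
    rw [← ENNReal.ofReal_one]
    refine ENNReal.ofReal_le_ofReal ?_
    rw [inv_mul_eq_div, one_le_div hr]
    exact hp.1.1
  · rw [indicator_of_notMem hp]; simp

end PlaneCurve


/-! ### Fubini for the Cauchy kernel along an arc -/

namespace PlaneCurve

open Complex Set Filter Topology MeasureTheory
open scoped ENNReal

/-- Lebesgue measure on a rectangle of polar coordinates. -/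
noncomputable def polarMeasure (r₀ R : ℝ) : Measure (ℝ × ℝ) :=
  (volume.restrict (Icc r₀ R)).prod (volume.restrict (Ioo (-Real.pi) Real.pi))

theorem polarMeasure_eq (r₀ R : ℝ) :
    polarMeasure r₀ R = volume.restrict (Icc r₀ R ×ˢ Ioo (-Real.pi) Real.pi) := by
  rw [polarMeasure, Measure.prod_restrict, Measure.volume_eq_prod]

instance (r₀ R : ℝ) : IsFiniteMeasure (polarMeasure r₀ R) := by
  unfold polarMeasure; infer_instance

theorem ae_fst_mem (r₀ R : ℝ) : ∀ᵐ p ∂polarMeasure r₀ R, p.1 ∈ Icc r₀ R := by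
  rw [polarMeasure_eq]
  filter_upwards [ae_restrict_mem (measurableSet_Icc.prod measurableSet_Ioo)] with p hp
  exact hp.1

section Arc

variable {c d : ℝ → ℂ} {g : ℝ → ℝ} {r₀ R : ℝ}

theorem aestronglyMeasurable_kernel (hc : ContinuousOn c (Icc 0 1)) (hd : ContinuousOn d (Icc 0 1))
    (hg : ContinuousOn g (Icc r₀ R)) :
    AEStronglyMeasurable (fun q : (ℝ × ℝ) × ℝ =>
      (c q.2 - q.1.1 * exp (q.1.2 * I))⁻¹ * (d q.2 * g q.1.1))
      ((polarMeasure r₀ R).prod (volume.restrict (Ioc (0 : ℝ) 1))) := by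
  have hcm : AEMeasurable c (volume.restrict (Ioc (0 : ℝ) 1)) :=
    ((hc.aestronglyMeasurable measurableSet_Icc).mono_measure
      (Measure.restrict_mono Ioc_subset_Icc_self le_rfl)).aemeasurable
  have hdm : AEMeasurable d (volume.restrict (Ioc (0 : ℝ) 1)) :=
    ((hd.aestronglyMeasurable measurableSet_Icc).mono_measure
      (Measure.restrict_mono Ioc_subset_Icc_self le_rfl)).aemeasurable
  have hgm : AEMeasurable g (volume.restrict (Icc r₀ R)) :=
    (hg.aestronglyMeasurable measurableSet_Icc).aemeasurable
  have hgm' : AEMeasurable (fun p : ℝ × ℝ => (g p.1 : ℂ)) (polarMeasure r₀ R) := by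
    have : AEMeasurable (fun p : ℝ × ℝ => g p.1) (polarMeasure r₀ R) := by
      unfold polarMeasure; exact hgm.comp_fst
    exact measurable_ofReal.comp_aemeasurable this
  have h1 : AEMeasurable (fun q : (ℝ × ℝ) × ℝ => (q.1.1 : ℂ) * exp (q.1.2 * I))
      ((polarMeasure r₀ R).prod (volume.restrict (Ioc (0 : ℝ) 1))) := by
    refine Continuous.aemeasurable ?_
    fun_prop
  exact (((hcm.comp_snd).sub h1).inv.mul (hdm.comp_snd.mul hgm'.comp_fst)).aestronglyMeasurable

/-- By Tonelli it suffices to bound the integral over the plane for each point of the arc, and that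
bound is uniform. -/
theorem integrable_kernel (hc : ContinuousOn c (Icc 0 1)) (hd : ContinuousOn d (Icc 0 1))
    (hg : ContinuousOn g (Icc r₀ R)) (hr : 0 < r₀) (hcR : ∀ t ∈ Icc (0 : ℝ) 1, ‖c t‖ ≤ R) :
    Integrable (fun q : (ℝ × ℝ) × ℝ =>
      (c q.2 - q.1.1 * exp (q.1.2 * I))⁻¹ * (d q.2 * g q.1.1))
      ((polarMeasure r₀ R).prod (volume.restrict (Ioc (0 : ℝ) 1))) := by
  have hm := aestronglyMeasurable_kernel hc hd hg
  refine ⟨hm, ?_⟩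
  obtain ⟨D, hD⟩ := isCompact_Icc.exists_bound_of_continuousOn hd
  obtain ⟨G, hG⟩ := isCompact_Icc.exists_bound_of_continuousOn hg
  rw [HasFiniteIntegral, lintegral_prod_symm _ hm.enorm]
  set B := ENNReal.ofReal r₀⁻¹ *
    (ENNReal.ofReal (2 * R) * ENNReal.ofReal (Real.pi - -Real.pi)) with hB
  have hle : ∀ t ∈ Ioc (0 : ℝ) 1, ∫⁻ p, ‖(c t - p.1 * exp (p.2 * I))⁻¹ * (d t * g p.1)‖ₑ
      ∂polarMeasure r₀ R ≤ ENNReal.ofReal (D * G) * B := by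
    intro t ht
    have ht' := Ioc_subset_Icc_self ht
    refine le_trans ?_ (mul_le_mul_right (lintegral_inv_polar hr (hcR t ht')) _)
    rw [← polarMeasure_eq, ← lintegral_const_mul' _ _ ENNReal.ofReal_ne_top]
    refine lintegral_mono_ae ?_
    filter_upwards [ae_fst_mem r₀ R] with p hp
    rw [enorm_mul, mul_comm]
    refine mul_le_mul_left ?_ _
    rw [← ofReal_norm]
    refine ENNReal.ofReal_le_ofReal ?_
    rw [norm_mul, Complex.norm_real]
    exact mul_le_mul (hD t ht') (hG _ hp) (norm_nonneg _) ((norm_nonneg _).trans (hD t ht'))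
  refine (lintegral_mono_ae ?_).trans_lt (?_ : ∫⁻ _ in Ioc (0 : ℝ) 1,
    ENNReal.ofReal (D * G) * B < ⊤)
  · filter_upwards [ae_restrict_mem measurableSet_Ioc] with t ht
    exact hle t ht
  · rw [lintegral_const, hB]
    refine ENNReal.mul_lt_top ?_ (by simp)
    refine ENNReal.mul_lt_top ENNReal.ofReal_lt_top (ENNReal.mul_lt_top ENNReal.ofReal_lt_top ?_)
    exact ENNReal.mul_lt_top ENNReal.ofReal_lt_top ENNReal.ofReal_lt_top

/-- Integrating over the angle first, only circles with radius below `|c₀|` contribute, each with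
`2π / c₀`. -/
theorem integral_kernel_polar (hr : 0 < r₀) {c₀ d₀ : ℂ} (hc₀ : r₀ ≤ ‖c₀‖) (hcR : ‖c₀‖ ≤ R)
    (hi : Integrable (fun p : ℝ × ℝ => (c₀ - p.1 * exp (p.2 * I))⁻¹ * (d₀ * g p.1))
      (polarMeasure r₀ R)) :
    ∫ p, (c₀ - p.1 * exp (p.2 * I))⁻¹ * (d₀ * g p.1) ∂polarMeasure r₀ R =
      2 * Real.pi * (d₀ / c₀) * (∫ ρ in r₀..‖c₀‖, g ρ : ℝ) := by
  have hc0 : c₀ ≠ 0 := norm_pos_iff.1 (hr.trans_le hc₀)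
  unfold polarMeasure at hi ⊢
  rw [integral_prod _ hi]
  have hin : ∀ᵐ ρ : ℝ ∂(volume.restrict (Icc r₀ R)),
      ∫ φ in Ioo (-Real.pi) Real.pi, (c₀ - ρ * exp (φ * I))⁻¹ * (d₀ * g ρ) =
      (Iio ‖c₀‖).indicator (fun ρ => 2 * Real.pi * (d₀ / c₀) * (g ρ : ℂ)) ρ := by
    have hne : ∀ᵐ ρ : ℝ ∂(volume.restrict (Icc r₀ R)), ρ ≠ ‖c₀‖ := by
      refine ae_restrict_of_ae ?_
      simp [ae_iff]
    filter_upwards [hne, ae_restrict_mem measurableSet_Icc] with ρ hρ hmem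
    rw [integral_mul_const, ← integral_Ioc_eq_integral_Ioo,
      ← intervalIntegral.integral_of_le (by linarith [Real.pi_pos])]
    rcases lt_or_gt_of_ne hρ with h | h
    · rw [indicator_of_mem (mem_Iio.2 h), integral_inv_sub_circle_of_lt (hr.trans_le hmem.1) h]
      field_simp
    · rw [indicator_of_notMem (by simpa using h.le), integral_inv_sub_circle_of_gt hc0 h, zero_mul]
  rw [integral_congr_ae hin, setIntegral_indicator measurableSet_Iio, integral_const_mul,
    show Icc r₀ R ∩ Iio ‖c₀‖ = Ico r₀ ‖c₀‖ by
      ext ρ; simp only [mem_inter_iff, mem_Icc, mem_Iio, mem_Ico]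
      constructor
      · rintro ⟨⟨h1, -⟩, h2⟩; exact ⟨h1, h2⟩
      · rintro ⟨h1, h2⟩; exact ⟨⟨h1, (h2.trans_le hcR).le⟩, h2⟩,
    integral_Ico_eq_integral_Ioc, ← intervalIntegral.integral_of_le hc₀,
    intervalIntegral.integral_ofReal]

/-- Green's formula for one arc. -/
theorem integral_kernel (hc : ContinuousOn c (Icc 0 1)) (hd : ContinuousOn d (Icc 0 1))
    (hg : ContinuousOn g (Icc r₀ R)) (hr : 0 < r₀) (hcr : ∀ t ∈ Icc (0 : ℝ) 1, r₀ ≤ ‖c t‖)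
    (hcR : ∀ t ∈ Icc (0 : ℝ) 1, ‖c t‖ ≤ R) :
    Integrable (fun p : ℝ × ℝ => (∫ t in (0 : ℝ)..1, d t / (c t - p.1 * exp (p.2 * I))) * g p.1)
      (polarMeasure r₀ R) ∧
    ∫ p, (∫ t in (0 : ℝ)..1, d t / (c t - p.1 * exp (p.2 * I))) * g p.1 ∂polarMeasure r₀ R =
      ∫ t in (0 : ℝ)..1, 2 * Real.pi * (d t / c t) * (∫ ρ in r₀..‖c t‖, g ρ : ℝ) := by
  set F : ℝ × ℝ → ℝ → ℂ := fun p t => (c t - p.1 * exp (p.2 * I))⁻¹ * (d t * g p.1) with hF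
  have hi : Integrable (Function.uncurry F)
      ((polarMeasure r₀ R).prod (volume.restrict (Ioc (0 : ℝ) 1))) :=
    integrable_kernel hc hd hg hr hcR
  have he : (fun p : ℝ × ℝ => (∫ t in (0 : ℝ)..1, d t / (c t - p.1 * exp (p.2 * I))) * g p.1) =
      fun p => ∫ t in Ioc (0 : ℝ) 1, F p t := by
    ext p
    rw [← intervalIntegral.integral_mul_const, intervalIntegral.integral_of_le zero_le_one]
    refine integral_congr_ae (Eventually.of_forall fun t => ?_)
    simp only [hF, div_eq_mul_inv]; ring
  rw [he]
  refine ⟨hi.integral_prod_left, ?_⟩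
  rw [integral_integral_swap hi, intervalIntegral.integral_of_le zero_le_one]
  refine integral_congr_ae ?_
  filter_upwards [hi.prod_left_ae, ae_restrict_mem measurableSet_Ioc] with t hti ht
  have ht' := Ioc_subset_Icc_self ht
  exact integral_kernel_polar hr (hcr t ht') (hcR t ht') hti

end Arc

end PlaneCurve


namespace PlaneCurve.ClosedCurve

open Complex Set Filter Topology MeasureTheory

variable {n : ℕ} (C : ClosedCurve n)

/-- Green's formula for the winding number, in polar coordinates. -/
theorem green {g : ℝ → ℝ} {r₀ R : ℝ} (hg : ContinuousOn g (Icc r₀ R)) (hr : 0 < r₀)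
    (hC : ∀ z ∈ C.trace, r₀ ≤ ‖z‖ ∧ ‖z‖ ≤ R) :
    Integrable (fun p : ℝ × ℝ => C.windInt (p.1 * exp (p.2 * I)) * g p.1) (polarMeasure r₀ R) ∧
    ∫ p, C.windInt (p.1 * exp (p.2 * I)) * g p.1 ∂polarMeasure r₀ R =
      I⁻¹ * ∑ k ∈ Finset.range n, ∫ t in (0 : ℝ)..1,
        (C.d k t / C.c k t) * (∫ ρ in r₀..‖C.c k t‖, g ρ : ℝ) := by
  have h := fun k : ℤ => integral_kernel (C.cont_c k) (C.cont_d k) hg hr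
    (fun t ht => (hC _ (C.c_mem_trace k ht)).1) (fun t ht => (hC _ (C.c_mem_trace k ht)).2)
  have he : (fun p : ℝ × ℝ => C.windInt (p.1 * exp (p.2 * I)) * g p.1) = fun p =>
      (2 * Real.pi * I)⁻¹ * ∑ k ∈ Finset.range n,
        (∫ t in (0 : ℝ)..1, C.d k t / (C.c k t - p.1 * exp (p.2 * I))) * g p.1 := by
    ext p; rw [windInt, mul_assoc, Finset.sum_mul]
  have hs := integrable_finsetSum (Finset.range n) fun (k : ℕ) _ => (h k).1
  rw [he]
  refine ⟨hs.const_mul _, ?_⟩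
  rw [integral_const_mul, integral_finsetSum _ fun (k : ℕ) _ => (h k).1,
    Finset.sum_congr rfl fun (k : ℕ) _ => (h k).2, Finset.mul_sum, Finset.mul_sum]
  refine Finset.sum_congr rfl fun k _ => ?_
  rw [← intervalIntegral.integral_const_mul, ← intervalIntegral.integral_const_mul]
  refine intervalIntegral.integral_congr fun t _ => ?_
  have := Real.pi_ne_zero
  simp only [mul_inv]
  field_simp

end PlaneCurve.ClosedCurve

/-! ### The boundary is a null set, and winding numbers describe the region -/

namespace Schwarzschild

open Surface Set Filter Topology MeasureTheory

variable {M : ℝ}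

/-- A Lipschitz image of an interval has Hausdorff dimension at most `1`. -/
theorem GeodesicArc.volume_image_pos (A : GeodesicArc M) : volume (A.pos '' Icc 0 1) = 0 := by
  obtain ⟨K, hK⟩ := isCompact_Icc.exists_bound_of_continuousOn A.continuousOn_vel
  have hl : LipschitzOnWith K.toNNReal A.pos (Icc 0 1) :=
    (convex_Icc (0 : ℝ) 1).lipschitzOnWith_of_nnnorm_hasDerivWithin_le A.hasDeriv_pos fun t ht => by
      rw [← NNReal.coe_le_coe, coe_nnnorm]
      exact (hK t ht).trans (Real.le_coe_toNNReal K)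
  have hd : dimH (A.pos '' Icc 0 1) < ((2 : NNReal) : ENNReal) := by
    refine (hl.dimH_image_le.trans (dimH_mono (subset_univ _))).trans_lt ?_
    rw [Real.dimH_univ]
    norm_num
  refine measure_zero_of_dimH_lt (d := 2) ?_ hd
  have : (μH[(Fintype.card (Fin 2) : ℝ)] : Measure Coord) = volume := hausdorffMeasure_pi_real
  rw [← this]
  simp [Measure.AbsolutelyContinuous.rfl]

namespace GeodesicPolygon

variable {n : ℕ} [NeZero n]

theorem pos_of_mem_boundary (hM : 0 < M) (P : GeodesicPolygon M n) {z : ℂ} (hz : z ∈ P.boundary) :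
    2 * M < ‖z‖ := by
  obtain ⟨i, t, ht, rfl⟩ := mem_iUnion.1 hz
  simp only
  rw [norm_toPlane ((P.edge i).pos_pos hM ht).le]
  exact (P.edge i).outside t ht

/-- In polar coordinates the boundary lifts to countably many translates of the edges by multiples
of `2π`. -/
theorem volume_boundary (hM : 0 < M) (P : GeodesicPolygon M n) :
    volume {x : Coord | 0 < x 0 ∧ toPlane x ∈ P.boundary} = 0 := by
  have hsub : {x : Coord | 0 < x 0 ∧ toPlane x ∈ P.boundary} ⊆
      ⋃ i : Fin n, ⋃ j : ℤ, (fun x => x + ![0, j * (2 * Real.pi)]) ''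
        ((P.edge i).pos '' Icc 0 1) := by
    rintro x ⟨hx, hb⟩
    obtain ⟨i, t, ht, he⟩ := mem_iUnion.1 hb
    obtain ⟨h0, j, hj⟩ := (toPlane_eq_iff hx ((P.edge i).pos_pos hM ht)).1 he.symm
    refine mem_iUnion.2 ⟨i, mem_iUnion.2 ⟨j, _, ⟨t, ht, rfl⟩, ?_⟩⟩
    ext a
    fin_cases a
    · simp [h0]
    · simp [hj]
  refine measure_mono_null hsub (measure_iUnion_null fun i => measure_iUnion_null fun j => ?_)
  rw [image_add_right, measure_preimage_add_right]
  exact (P.edge i).volume_image_pos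

theorem region_eq (hM : 0 < M) (P : GeodesicPolygon M n) : P.region =
    {z | z ∉ P.boundary → (P.toClosedCurve hM).wind z ≠ 0} := by
  ext z
  simp only [region, mem_union, mem_ofPred_eq]
  rw [← P.trace_toClosedCurve hM]
  constructor
  · rintro (h | ⟨h, h'⟩) hz
    · exact absurd h hz
    · exact ((P.toClosedCurve hM).isBounded_component_iff hz).1 h'
  · intro h
    by_cases hz : z ∈ (P.toClosedCurve hM).trace
    · exact Or.inl hz
    · exact Or.inr ⟨hz, ((P.toClosedCurve hM).isBounded_component_iff hz).2 (h hz)⟩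

theorem mem_region_iff (hM : 0 < M) (P : GeodesicPolygon M n) {z : ℂ} (hz : z ∉ P.boundary) :
    z ∈ P.region ↔ (P.toClosedCurve hM).wind z ≠ 0 := by
  rw [P.region_eq hM]; simp [hz]

theorem isClosed_region (hM : 0 < M) (P : GeodesicPolygon M n) : IsClosed P.region := by
  have ho : IsOpen ((P.toClosedCurve hM).traceᶜ ∩ (P.toClosedCurve hM).wind ⁻¹' {0}) :=
    (P.toClosedCurve hM).continuousOn_wind.isOpen_inter_preimage
      (P.toClosedCurve hM).isCompact_trace.isClosed.isOpen_compl (isOpen_discrete _)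
  rw [← isOpen_compl_iff]
  convert! ho using 1
  ext z
  rw [P.region_eq hM, P.trace_toClosedCurve hM]
  simp

theorem exists_bound (hM : 0 < M) (P : GeodesicPolygon M n) :
    ∃ R > 0, (∀ z ∈ P.boundary, ‖z‖ < R) ∧ ∀ z ∈ P.region, ‖z‖ < R := by
  obtain ⟨R, hR, h⟩ := (P.toClosedCurve hM).exists_norm_bound
  have hb : ∀ z ∈ P.boundary, ‖z‖ < R := by
    intro z hz
    rw [← P.trace_toClosedCurve hM] at hz
    obtain ⟨t, rfl⟩ := hz
    exact h t
  refine ⟨R, hR, hb, fun z hz => ?_⟩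
  by_contra hc
  push Not at hc
  have hzb : z ∉ P.boundary := fun h => (hb z h).not_ge hc
  exact (P.mem_region_iff hM hzb).1 hz
    ((P.toClosedCurve hM).wind_eq_zero_of_norm_lt fun t => (h t).trans_le hc)

end GeodesicPolygon

end Schwarzschild


/-! ### Stokes' formula for the connection form -/

namespace Schwarzschild

open Surface Set Filter Topology MeasureTheory

variable {M : ℝ}

theorem continuousOn_connection (hM : 0 < M) : ContinuousOn (connection M) (Ioi (2 * M)) :=
  fun _ hr => (hasDerivAt_connection hM hr).continuousAt.continuousWithinAt

theorem continuousOn_connectionDeriv (hM : 0 < M) :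
    ContinuousOn (connectionDeriv M) (Ioi (2 * M)) := by
  have hl : ContinuousOn (lapse M) (Ioi (2 * M)) :=
    fun _ hr => (hasDerivAt_lapse hM hr).continuousAt.continuousWithinAt
  have h0 : ∀ r ∈ Ioi (2 * M), r ≠ 0 := fun r hr => by
    rw [mem_Ioi] at hr; exact (by linarith : (0 : ℝ) < r).ne'
  have hp : ∀ r ∈ Ioi (2 * M), lapse M r * √(lapse M r) ≠ 0 := fun r hr =>
    (mul_pos (lapse_pos hM hr) (Real.sqrt_pos.2 (lapse_pos hM hr))).ne'
  unfold connectionDeriv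
  exact ((continuousOn_const.div (by fun_prop) fun r hr => pow_ne_zero 2 (h0 r hr)).mul
    (continuousOn_const.sub (continuousOn_const.div continuousOn_id h0))).div (hl.mul hl.sqrt) hp

theorem integral_connectionDeriv (hM : 0 < M) {r₀ r : ℝ} (h0 : 2 * M < r₀) (h : r₀ ≤ r) :
    ∫ ρ in r₀..r, connectionDeriv M ρ = connection M r - connection M r₀ := by
  have hsub : uIcc r₀ r ⊆ Ioi (2 * M) := by
    rw [uIcc_of_le h]; exact fun x hx => h0.trans_le hx.1
  exact intervalIntegral.integral_eq_sub_of_hasDerivAt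
    (fun x hx => hasDerivAt_connection hM (hsub hx))
    ((continuousOn_connectionDeriv hM).mono hsub).intervalIntegrable

/-- The points of `D` with `r ≥ r₀`, in polar coordinates. -/
def polarRegionFrom (r₀ : ℝ) (D : Set ℂ) : Set Coord :=
  {x | r₀ ≤ x 0 ∧ x 1 ∈ Ioc (-Real.pi) Real.pi ∧ toPlane x ∈ D}

theorem continuous_toPlane : Continuous toPlane := by
  unfold toPlane; fun_prop

theorem measurableSet_polarRegionFrom (r₀ : ℝ) {D : Set ℂ} (hD : MeasurableSet D) :
    MeasurableSet (polarRegionFrom r₀ D) := by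
  have h1 : MeasurableSet {x : Coord | r₀ ≤ x 0} :=
    measurableSet_le measurable_const (measurable_pi_apply 0)
  have h2 : MeasurableSet {x : Coord | x 1 ∈ Ioc (-Real.pi) Real.pi} :=
    measurable_pi_apply 1 measurableSet_Ioc
  exact h1.inter (h2.inter (continuous_toPlane.measurable hD))

theorem volume_coord_one_eq (a : ℝ) : volume {x : Coord | x 1 = a} = 0 := by
  have h := (volume_preserving_finTwoArrow ℝ).measure_preimage
    (s := {p : ℝ × ℝ | p.2 = a}) (measurableSet_eq_fun measurable_snd
      measurable_const).nullMeasurableSet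
  have h2 : {p : ℝ × ℝ | p.2 = a} = univ ×ˢ {a} := by ext p; simp
  rw [h2, Measure.volume_eq_prod, Measure.prod_prod, Real.volume_singleton, mul_zero] at h
  rw [← h]
  congr 1
  ext x; simp [MeasurableEquiv.finTwoArrow]

section Transfer

variable {D : Set ℂ} {r₀ R : ℝ}

/-- The sets differ only in the ray `φ = π`, which belongs to the closed end of one angle interval
and not to the other. -/
theorem preimage_polar_ae_eq (hR : ∀ z ∈ D, ‖z‖ ≤ R) (hr : 0 < r₀) :
    (MeasurableEquiv.finTwoArrow (α := ℝ)) ⁻¹' ((Icc r₀ R ×ˢ Ioo (-Real.pi) Real.pi) ∩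
      {p : ℝ × ℝ | (p.1 : ℂ) * Complex.exp (p.2 * Complex.I) ∈ D}) =ᵐ[volume]
      polarRegionFrom r₀ D := by
  have hne : ∀ᵐ x : Coord, x 1 ≠ Real.pi := by
    rw [ae_iff]; simpa using volume_coord_one_eq Real.pi
  filter_upwards [hne] with x hx
  refine propext ?_
  change ((r₀ ≤ x 0 ∧ x 0 ≤ R) ∧ (-Real.pi < x 1 ∧ x 1 < Real.pi)) ∧ toPlane x ∈ D ↔
    r₀ ≤ x 0 ∧ (-Real.pi < x 1 ∧ x 1 ≤ Real.pi) ∧ toPlane x ∈ D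
  constructor
  · rintro ⟨⟨⟨h1, -⟩, h2, h3⟩, h4⟩
    exact ⟨h1, ⟨h2, h3.le⟩, h4⟩
  · rintro ⟨h1, ⟨h2, h3⟩, h4⟩
    refine ⟨⟨⟨h1, ?_⟩, h2, lt_of_le_of_ne h3 hx⟩, h4⟩
    rw [← norm_toPlane (hr.le.trans h1)]
    exact hR _ h4

theorem setIntegral_polarRegionFrom (hR : ∀ z ∈ D, ‖z‖ ≤ R) (hr : 0 < r₀) (hD : MeasurableSet D)
    (g : ℝ → ℝ) :
    ∫ x in polarRegionFrom r₀ D, g (x 0) = ∫ p, {p : ℝ × ℝ | (p.1 : ℂ) *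
      Complex.exp (p.2 * Complex.I) ∈ D}.indicator (fun p => g p.1) p
        ∂PlaneCurve.polarMeasure r₀ R := by
  have hm : MeasurableSet {p : ℝ × ℝ | (p.1 : ℂ) * Complex.exp (p.2 * Complex.I) ∈ D} :=
    Continuous.measurable (by fun_prop) hD
  rw [← setIntegral_congr_set (preimage_polar_ae_eq hR hr), PlaneCurve.polarMeasure_eq,
    setIntegral_indicator hm, ← (volume_preserving_finTwoArrow ℝ).setIntegral_preimage_emb
      MeasurableEquiv.finTwoArrow.measurableEmbedding]
  rfl

theorem integrableOn_polarRegionFrom (hR : ∀ z ∈ D, ‖z‖ ≤ R) (hr : 0 < r₀) {g : ℝ → ℝ}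
    (hg : ContinuousOn g (Icc r₀ R)) :
    IntegrableOn (fun x : Coord => g (x 0)) (polarRegionFrom r₀ D) := by
  have hK : IsCompact (Icc (![r₀, -Real.pi] : Coord) ![R, Real.pi]) := isCompact_Icc
  have hc : ContinuousOn (fun x : Coord => g (x 0)) (Icc (![r₀, -Real.pi] : Coord) ![R, Real.pi]) :=
    hg.comp (by fun_prop) fun x hx => ⟨hx.1 0, hx.2 0⟩
  refine (hc.integrableOn_compact hK).mono_set ?_
  rintro x ⟨h1, h2, h3⟩
  have := hR _ h3
  rw [norm_toPlane (hr.le.trans h1)] at this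
  constructor <;> intro i <;> fin_cases i
  exacts [h1, h2.1.le, this, h2.2]

end Transfer

namespace GeodesicPolygon

variable {n : ℕ} [NeZero n]

/-- The rotation of the polar frame along a polygon as an integral over the inside. -/
theorem sum_rotation (hM : 0 < M) (P : GeodesicPolygon M n) {m : ℤ}
    (hm : ∀ z, z ∉ (P.toClosedCurve hM).trace → (P.toClosedCurve hM).wind z = 0 ∨
      (P.toClosedCurve hM).wind z = m) {r₀ : ℝ} (h2 : 2 * M < r₀)
    (hr : ∀ z ∈ P.boundary, r₀ ≤ ‖z‖) :
    IntegrableOn (fun x : Coord => connectionDeriv M (x 0)) (polarRegionFrom r₀ P.region) ∧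
    ∑ i, (P.edge i).rotation = connection M r₀ * (2 * Real.pi * (P.toClosedCurve hM).wind 0) +
      m * ∫ x in polarRegionFrom r₀ P.region, connectionDeriv M (x 0) := by
  obtain ⟨R, hR0, hRb, hR⟩ := P.exists_bound hM
  have hr0 : 0 < r₀ := by linarith
  have hgc : ContinuousOn (connectionDeriv M) (Icc r₀ R) :=
    (continuousOn_connectionDeriv hM).mono fun x hx => h2.trans_le hx.1
  have hDm := (P.isClosed_region hM).measurableSet
  refine ⟨integrableOn_polarRegionFrom (fun z hz => (hR z hz).le) hr0 hgc, ?_⟩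
  obtain ⟨-, hgreen⟩ := (P.toClosedCurve hM).green hgc hr0 fun z hz => by
    rw [P.trace_toClosedCurve hM] at hz; exact ⟨hr z hz, (hRb z hz).le⟩
  rw [setIntegral_polarRegionFrom (fun z hz => (hR z hz).le) hr0 hDm]
  have hnull : ∀ᵐ p ∂PlaneCurve.polarMeasure r₀ R,
      (p.1 : ℂ) * Complex.exp (p.2 * Complex.I) ∉ P.boundary := by
    have h1 : ∀ᵐ x : Coord, ¬ (0 < x 0 ∧ toPlane x ∈ P.boundary) := by
      rw [ae_iff]; simpa using P.volume_boundary hM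
    have h2 : ∀ᵐ p : ℝ × ℝ, ¬ (0 < p.1 ∧ (p.1 : ℂ) * Complex.exp (p.2 * Complex.I) ∈ P.boundary) :=
      (volume_preserving_finTwoArrow ℝ).symm.quasiMeasurePreserving.ae h1
    have h3 := PlaneCurve.ae_fst_mem r₀ R
    rw [PlaneCurve.polarMeasure_eq] at h3 ⊢
    filter_upwards [ae_restrict_of_ae h2, h3] with p hp1 hp2 hp3
    exact hp1 ⟨hr0.trans_le hp2.1, hp3⟩
  -- Off the null boundary, the winding number is `m` times the indicator function of the region.
  have hwind : ∫ p, (P.toClosedCurve hM).windInt (p.1 * Complex.exp (p.2 * Complex.I)) *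
      (connectionDeriv M p.1 : ℂ) ∂PlaneCurve.polarMeasure r₀ R =
      ((m * ∫ p, {p : ℝ × ℝ | (p.1 : ℂ) * Complex.exp (p.2 * Complex.I) ∈ P.region}.indicator
        (fun p => connectionDeriv M p.1) p ∂PlaneCurve.polarMeasure r₀ R : ℝ) : ℂ) := by
    rw [← integral_const_mul]
    refine Eq.trans (integral_congr_ae ?_) (integral_ofReal (𝕜 := ℂ))
    filter_upwards [hnull] with p hp
    have hp' := hp
    rw [← P.trace_toClosedCurve hM] at hp'
    rw [(P.toClosedCurve hM).windInt_eq hp']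
    by_cases hreg : (p.1 : ℂ) * Complex.exp (p.2 * Complex.I) ∈ P.region
    · rw [indicator_of_mem (by exact hreg),
        (hm _ hp').resolve_left ((P.mem_region_iff hM hp).1 hreg)]
      push_cast; rfl
    · rw [indicator_of_notMem (by exact hreg),
        not_not.1 (mt (P.mem_region_iff hM hp).2 hreg)]
      simp
  rw [hwind] at hgreen
  have him := congrArg Complex.re hgreen
  rw [Complex.ofReal_re, Complex.inv_I, neg_mul, Complex.neg_re, Complex.I_mul_re, neg_neg,
    Complex.im_sum] at him
  rw [him]
  -- Since `Im (dz / z) = dφ`, Green's formula for the density `κ'` gives the integral of `(κ(r) -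
  -- κ(r₀)) dφ` along each edge.
  have hterm : ∀ i : Fin n, (∫ t in (0 : ℝ)..1,
      planeVector ((P.edge i).pos t) ((P.edge i).vel t) / toPlane ((P.edge i).pos t) *
        (∫ ρ in r₀..‖toPlane ((P.edge i).pos t)‖, connectionDeriv M ρ : ℝ)).im =
      (P.edge i).rotation - connection M r₀ * ((P.edge i).pos 1 1 - (P.edge i).pos 0 1) := by
    intro i
    set A := P.edge i
    have hrA : ∀ t ∈ Icc (0 : ℝ) 1, r₀ ≤ A.pos t 0 := fun t ht => by
      have := hr _ (mem_iUnion.2 ⟨i, t, ht, rfl⟩)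
      rwa [norm_toPlane (A.pos_pos hM ht).le] at this
    have hcong : EqOn (fun t => planeVector (A.pos t) (A.vel t) / toPlane (A.pos t) *
        (∫ ρ in r₀..‖toPlane (A.pos t)‖, connectionDeriv M ρ : ℝ))
        (fun t => planeVector (A.pos t) (A.vel t) / toPlane (A.pos t) *
          (connection M (A.pos t 0) - connection M r₀ : ℝ)) (Icc 0 1) := fun t ht => by
      simp only
      rw [norm_toPlane (A.pos_pos hM ht).le, integral_connectionDeriv hM h2 (hrA t ht)]
    have hk : ContinuousOn (fun t => connection M (A.pos t 0)) (Icc 0 1) :=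
      (continuousOn_connection hM).comp (A.continuousOn_coord 0) fun t ht => A.outside t ht
    have hcont : ContinuousOn (fun t => planeVector (A.pos t) (A.vel t) / toPlane (A.pos t) *
          ((connection M (A.pos t 0) - connection M r₀ : ℝ) : ℂ)) (Icc 0 1) := by
      refine (A.continuousOn_planeVector.div (continuous_toPlane.comp_continuousOn
        A.continuousOn_pos) fun t ht h0 => ?_).mul
        (Complex.continuous_ofReal.comp_continuousOn (hk.sub continuousOn_const))
      have := norm_toPlane (A.pos_pos hM ht).le
      rw [show toPlane (A.pos t) = 0 from h0, norm_zero] at this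
      exact (A.pos_pos hM ht).ne this
    have h01 : uIcc (0 : ℝ) 1 = Icc 0 1 := uIcc_of_le zero_le_one
    rw [intervalIntegral.integral_congr (h01 ▸ hcong)]
    have hcomm := Complex.imCLM.intervalIntegral_comp_comm
      (ContinuousOn.intervalIntegrable (μ := volume) (hcont.mono h01.subset))
    rw [Complex.imCLM_apply] at hcomm
    rw [← hcomm]
    have hv : ContinuousOn (fun t => A.vel t 1) (uIcc 0 1) := h01 ▸ A.continuousOn_velCoord 1
    have hderiv : ∫ t in (0 : ℝ)..1, A.vel t 1 = A.pos 1 1 - A.pos 0 1 :=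
      intervalIntegral.integral_eq_sub_of_hasDerivAt_of_le zero_le_one (A.continuousOn_coord 1)
        (fun t ht => (A.hasDeriv_coord 1 (Ioo_subset_Icc_self ht)).hasDerivAt (Icc_mem_nhds ht.1 ht.2))
        hv.intervalIntegrable
    rw [← hderiv, ← intervalIntegral.integral_const_mul, GeodesicArc.rotation,
      ← intervalIntegral.integral_sub (ContinuousOn.intervalIntegrable (μ := volume)
          (show ContinuousOn (fun t => connection M (A.pos t 0) * A.vel t 1) (uIcc 0 1) from
            (h01 ▸ hk).mul hv))
        (ContinuousOn.intervalIntegrable (μ := volume)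
          (show ContinuousOn (fun t => connection M r₀ * A.vel t 1) (uIcc 0 1) from
            continuousOn_const.mul hv))]
    refine intervalIntegral.integral_congr fun t ht => ?_
    have ht' : t ∈ Icc (0 : ℝ) 1 := h01 ▸ ht
    have hne := (A.pos_pos hM ht').ne'
    have hne' : (A.pos t 0 : ℂ) ≠ 0 := by exact_mod_cast hne
    have : planeVector (A.pos t) (A.vel t) / toPlane (A.pos t) =
        flatFrame (A.pos t) (A.vel t) / (A.pos t 0 : ℂ) := by
      rw [planeVector, toPlane]
      have := Complex.exp_ne_zero (A.pos t 1 * Complex.I)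
      field_simp
    simp only [this, Complex.imCLM_apply, Complex.im_mul_ofReal, Complex.div_ofReal_im, flatFrame]
    field_simp
  have hsum : ∑ k ∈ Finset.range n, (∫ t in (0 : ℝ)..1, (P.toClosedCurve hM).d k t /
      (P.toClosedCurve hM).c k t * ((∫ ρ in r₀..‖(P.toClosedCurve hM).c k t‖,
        connectionDeriv M ρ : ℝ) : ℂ)).im =
      ∑ i, ((P.edge i).rotation - connection M r₀ * ((P.edge i).pos 1 1 - (P.edge i).pos 0 1)) := by
    rw [← sum_index]
    exact Finset.sum_congr rfl fun k _ => hterm (index n k)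
  have h0 : (0 : ℂ) ∉ (P.toClosedCurve hM).trace := by
    rw [P.trace_toClosedCurve hM]
    intro h
    have := P.pos_of_mem_boundary hM h
    rw [norm_zero] at this
    linarith
  rw [hsum, Finset.sum_sub_distrib, ← Finset.mul_sum, P.sum_increment hM h0]
  ring

end GeodesicPolygon

end Schwarzschild


/-! ### Orientation, enclosure of the hole, and the Gauss–Bonnet formulas -/

namespace Schwarzschild

open Surface Set Filter Topology MeasureTheory

variable {M : ℝ}

/-- The optical metric is not conformal to the flat one in these coordinates, so the optical normal
need not be a Euclidean normal. It still points to the left, which is all that `wind_near` requires.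
-/
theorem frame_leftNormal_im_pos (hM : 0 < M) {x v : Coord} (hx : 2 * M < x 0) (hv : v ≠ 0) :
    0 < (planeVector x (leftNormal (opticalMetric M) x v) / planeVector x v).im := by
  have h0 : 0 < x 0 := by linarith
  have hf := lapse_pos hM hx
  have hW := flatFrame_ne_zero h0 hv
  have hexp := Complex.exp_ne_zero (x 1 * Complex.I)
  have ha : 0 < areaDensity (opticalMetric M) x := by
    rw [areaDensity, det_metric]; positivity
  have hv' : v 0 ≠ 0 ∨ v 1 ≠ 0 := by
    by_contra! hc
    exact hv (by ext i; fin_cases i; exacts [hc.1, hc.2])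
  rw [planeVector, planeVector, mul_div_mul_right _ _ hexp, Complex.div_im]
  have hn := Complex.normSq_pos.2 hW
  have he : (flatFrame x (leftNormal (opticalMetric M) x v)).im * (flatFrame x v).re -
      (flatFrame x (leftNormal (opticalMetric M) x v)).re * (flatFrame x v).im =
      x 0 / areaDensity (opticalMetric M) x * (v 0 ^ 2 / lapse M (x 0) ^ 2 +
        x 0 ^ 2 / lapse M (x 0) * v 1 ^ 2) := by
    simp only [flatFrame, leftNormal, opticalMetric, Matrix.of_apply, Matrix.cons_val',
      Matrix.cons_val_zero, Matrix.cons_val_one, Matrix.cons_val_fin_one, ← lapse.eq_1]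
    field_simp
    ring
  rw [← sub_div, he]
  refine div_pos (mul_pos (by positivity) ?_) hn
  rcases hv' with h | h <;> positivity

theorem tendsto_leftNormal {x v : Coord} :
    Tendsto (fun h : ℝ => (toPlane (x + h • leftNormal (opticalMetric M) x v) - toPlane x) /
      (h * planeVector x v)) (𝓝[>] 0)
      (𝓝 (planeVector x (leftNormal (opticalMetric M) x v) / planeVector x v)) := by
  set N := leftNormal (opticalMetric M) x v
  have h1 : HasDerivWithinAt (fun h : ℝ => x + h • N) N (Ioi 0) 0 := by
    simpa using ((hasDerivWithinAt_id (0 : ℝ) (Ioi 0)).smul_const N).const_add x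
  have h2 := hasDerivWithinAt_toPlane h1
  simp only [zero_smul, add_zero] at h2
  rw [hasDerivWithinAt_iff_tendsto_slope' (by simp)] at h2
  refine (h2.div_const (planeVector x v)).congr' ?_
  filter_upwards [self_mem_nhdsWithin] with h hh
  have hh' : (h : ℂ) ≠ 0 := by exact_mod_cast (mem_Ioi.1 hh).ne'
  simp only [slope_def_module, sub_zero, zero_smul, add_zero, Complex.real_smul, Complex.ofReal_inv]
  rw [div_mul_eq_div_div]
  congr 1
  field_simp

namespace GeodesicPolygon

variable {n : ℕ} [NeZero n]

/-- The orientation of a geodesic polygon, with the total turning of its tangent. -/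
theorem exists_orientation (hM : 0 < M) (P : GeodesicPolygon M n) : ∃ m : ℤ, (m = 1 ∨ m = -1) ∧
    (P.PositivelyOriented ↔ m = 1) ∧
    (∀ z, z ∉ (P.toClosedCurve hM).trace → (P.toClosedCurve hM).wind z = 0 ∨
      (P.toClosedCurve hM).wind z = m) ∧
    (∃ z, z ∉ P.boundary ∧ z ∈ P.region) ∧
    ∑ i, P.exteriorAngle i =
      2 * Real.pi * (m - (P.toClosedCurve hM).wind 0) + ∑ i, (P.edge i).rotation := by
  obtain ⟨m, hm, hw, ⟨z, hz, hzm⟩, hturn, hside⟩ := (P.toClosedCurve hM).exists_turning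
  have h0 : (0 : ℂ) ∉ (P.toClosedCurve hM).trace := by
    rw [P.trace_toClosedCurve hM]
    intro h
    have := P.pos_of_mem_boundary hM h
    rw [norm_zero] at this
    linarith
  have hleft : ∀ i : Fin n, ∀ t ∈ Ioo (0 : ℝ) 1, ∀ᶠ s in 𝓝[>] (0 : ℝ),
      (toPlane ((P.edge i).pos t + s • leftNormal (opticalMetric M) ((P.edge i).pos t)
        ((P.edge i).vel t)) ∈ P.region ↔ m = 1) := by
    intro i t ht
    obtain ⟨k, rfl⟩ : ∃ k : ℤ, index n k = i := ⟨((ZMod.finEquiv n i).val : ℤ), by simp [index]⟩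
    have hx := (P.edge (index n k)).outside t (Ioo_subset_Icc_self ht)
    have hv := (P.edge (index n k)).vel_ne_zero t (Ioo_subset_Icc_self ht)
    filter_upwards [hside k t ht _ _ (frame_leftNormal_im_pos hM hx hv)
      tendsto_leftNormal] with s hs
    have hb := hs.1
    rw [P.trace_toClosedCurve hM] at hb
    rw [P.mem_region_iff hM hb]
    rcases hm with rfl | rfl <;> constructor <;> intro h <;> omega
  refine ⟨m, hm, ⟨fun hP => ?_, fun h i t ht => ?_⟩, hw, ⟨z, ?_, ?_⟩,
    P.sum_exteriorAngle hM hturn h0⟩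
  · have ht : (1 / 2 : ℝ) ∈ Ioo (0 : ℝ) 1 := by norm_num
    obtain ⟨s, hs1, hs2⟩ := ((hleft 0 _ ht).and (hP 0 _ ht)).exists
    exact hs1.1 hs2
  · filter_upwards [hleft i t ht] with s hs
    exact hs.2 h
  · rwa [← P.trace_toClosedCurve hM]
  · rw [P.mem_region_iff hM (by rwa [← P.trace_toClosedCurve hM]), hzm]
    rcases hm with rfl | rfl <;> simp

theorem wind_eq_wind_zero (hM : 0 < M) (P : GeodesicPolygon M n) {r : ℝ}
    (hr : ∀ z ∈ P.boundary, r ≤ ‖z‖) {z : ℂ} (hz : ‖z‖ < r) :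
    (P.toClosedCurve hM).wind z = (P.toClosedCurve hM).wind 0 := by
  have hr0 : 0 < r := (norm_nonneg z).trans_lt hz
  refine (P.toClosedCurve hM).wind_eq_of_isPreconnected (convex_ball (0 : ℂ) r).isPreconnected ?_
    (by simpa using hz) (Metric.mem_ball_self hr0)
  rw [P.trace_toClosedCurve hM, disjoint_left]
  intro w hw hw'
  exact (hr w hw').not_gt (by simpa using hw)

theorem exists_radius (hM : 0 < M) (P : GeodesicPolygon M n) :
    ∃ r, 2 * M < r ∧ ∀ z ∈ P.boundary, r ≤ ‖z‖ := by
  have hc := (P.toClosedCurve hM).isCompact_trace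
  rw [P.trace_toClosedCurve hM] at hc
  obtain ⟨z, hz, hmin⟩ := hc.exists_isMinOn
    (by rw [← P.trace_toClosedCurve hM]; exact range_nonempty _) continuous_norm.continuousOn
  exact ⟨‖z‖, P.pos_of_mem_boundary hM hz, hmin⟩

theorem enclosesHole_iff (hM : 0 < M) (P : GeodesicPolygon M n) :
    P.EnclosesHole ↔ (P.toClosedCurve hM).wind 0 ≠ 0 := by
  obtain ⟨r, h2, hr⟩ := P.exists_radius hM
  have hb : ∀ z : ℂ, ‖z‖ ≤ 2 * M → z ∉ P.boundary := fun z hz h =>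
    (P.pos_of_mem_boundary hM h).not_ge hz
  constructor
  · intro h
    refine (P.mem_region_iff hM (hb 0 (by simpa using hM.le))).1 (h (by simpa using hM.le))
  · intro h z hz
    rw [mem_closedBall_zero_iff] at hz
    rwa [P.mem_region_iff hM (hb z hz), P.wind_eq_wind_zero hM hr (hz.trans_lt h2)]

/-- The curve may touch the circle of radius `r`, so winding numbers only handle the open disc. The
rest follows because the region is closed. -/
theorem closedBall_subset_region (hM : 0 < M) (P : GeodesicPolygon M n) {r : ℝ} (hr0 : 0 < r)
    (hr : ∀ z ∈ P.boundary, r ≤ ‖z‖) (h : (P.toClosedCurve hM).wind 0 ≠ 0) :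
    Metric.closedBall (0 : ℂ) r ⊆ P.region := by
  rw [← closure_ball _ hr0.ne']
  refine closure_minimal (fun z hz => ?_) (P.isClosed_region hM)
  rw [mem_ball_zero_iff] at hz
  rwa [P.mem_region_iff hM (fun h => (hr z h).not_gt hz), P.wind_eq_wind_zero hM hr hz]

theorem internalAngle_pos (hM : 0 < M) (P : GeodesicPolygon M n) (i : Fin n) :
    0 < P.internalAngle i := by
  have := abs_lt.1 (P.abs_exteriorAngle_lt hM i)
  rw [internalAngle]; linarith

theorem abs_sum_exteriorAngle_lt (hM : 0 < M) (P : GeodesicPolygon M n) :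
    |∑ i, P.exteriorAngle i| < n * Real.pi := by
  refine (Finset.abs_sum_le_sum_abs _ _).trans_lt ?_
  have := Finset.sum_lt_sum_of_nonempty (Finset.univ_nonempty (α := Fin n))
    fun i _ => P.abs_exteriorAngle_lt hM i
  simpa using this

theorem sum_internalAngle (P : GeodesicPolygon M n) :
    ∑ i, P.internalAngle i = n * Real.pi - ∑ i, P.exteriorAngle i := by
  simp [internalAngle, Finset.sum_sub_distrib]

theorem connectionDeriv_integral_nonneg (hM : 0 < M) {r : ℝ} (hr : 2 * M < r) (D : Set ℂ)
    (hD : MeasurableSet D) : 0 ≤ ∫ x in polarRegionFrom r D, connectionDeriv M (x 0) :=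
  setIntegral_nonneg (measurableSet_polarRegionFrom r hD) fun _ hx =>
    (connectionDeriv_pos hM (hr.trans_le hx.1)).le

/-- With winding number `0`, the exterior angles sum to `m (2π + ∫ κ')`, of absolute value at least
`2π`. One or two angles smaller than `π` cannot reach that. -/
theorem wind_zero_ne_zero (hM : 0 < M) (P : GeodesicPolygon M n) (hn : n ≤ 2) :
    (P.toClosedCurve hM).wind 0 ≠ 0 := by
  intro h0
  obtain ⟨m, hm, -, hw, -, hsum⟩ := P.exists_orientation hM
  obtain ⟨r, h2, hr⟩ := P.exists_radius hM
  obtain ⟨-, hrot⟩ := P.sum_rotation hM hw h2 hr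
  have hpos := connectionDeriv_integral_nonneg hM h2 _ (P.isClosed_region hM).measurableSet
  rw [h0] at hsum hrot
  have hlt := abs_lt.1 (P.abs_sum_exteriorAngle_lt hM)
  have hn' : (n : ℝ) ≤ 2 := by exact_mod_cast hn
  have hnpi : n * Real.pi ≤ 2 * Real.pi := by nlinarith [Real.pi_pos]
  rw [hsum, hrot] at hlt
  rcases hm with rfl | rfl
  · push_cast at hlt; linarith [hlt.2]
  · push_cast at hlt; linarith [hlt.1]

theorem setIntegral_curvature (hM : 0 < M) {r : ℝ} (hr : 2 * M < r) {D : Set ℂ}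
    (hD : MeasurableSet D)
    (hi : IntegrableOn (fun x : Coord => connectionDeriv M (x 0)) (polarRegionFrom r D)) :
    IntegrableOn (curvatureDensity M) (polarRegionFrom r D) ∧
    ∫ x in polarRegionFrom r D, curvatureDensity M x =
      -∫ x in polarRegionFrom r D, connectionDeriv M (x 0) := by
  have hm := measurableSet_polarRegionFrom r hD
  have he : EqOn (curvatureDensity M) (fun x : Coord => -connectionDeriv M (x 0))
      (polarRegionFrom r D) := fun x hx => curvatureDensity_eq hM (hr.trans_le hx.1)
  refine ⟨hi.neg.congr_fun (fun x hx => (he hx).symm) hm, ?_⟩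
  rw [setIntegral_congr_fun hm he, integral_neg]

theorem polarRegion_region (hM : 0 < M) (P : GeodesicPolygon M n) {r : ℝ} (h2 : 2 * M < r)
    (hr : ∀ z ∈ P.boundary, r ≤ ‖z‖) (h : (P.toClosedCurve hM).wind 0 = 0) :
    polarRegion M P.region = polarRegionFrom r P.region := by
  ext x
  refine ⟨fun hx => ⟨?_, hx.2⟩, fun hx => ⟨h2.trans_le hx.1, hx.2⟩⟩
  by_contra hc
  push Not at hc
  have hn := norm_toPlane (show 0 ≤ x 0 by linarith [hx.1])
  have hb : toPlane x ∉ P.boundary := fun hb => (hr _ hb).not_gt (by rwa [hn])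
  refine (P.mem_region_iff hM hb).1 hx.2.2 ?_
  rw [P.wind_eq_wind_zero hM hr (by rwa [hn]), h]

/-- This makes the curvature inequality for triangles strict. -/
theorem volume_polarRegion_pos (hM : 0 < M) (P : GeodesicPolygon M n)
    (h : (P.toClosedCurve hM).wind 0 = 0) : 0 < volume (polarRegion M P.region) := by
  obtain ⟨r, h2, hr⟩ := P.exists_radius hM
  obtain ⟨-, -, -, -, ⟨z, hzb, hzr⟩, -⟩ := P.exists_orientation hM
  set U := (P.toClosedCurve hM).traceᶜ ∩ (P.toClosedCurve hM).wind ⁻¹' {0}ᶜ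
  have hU : IsOpen U := (P.toClosedCurve hM).continuousOn_wind.isOpen_inter_preimage
      (P.toClosedCurve hM).isCompact_trace.isClosed.isOpen_compl (isOpen_discrete _)
  have hUr : ∀ w ∈ U, w ∈ P.region := fun w hw => by
    rw [P.region_eq hM]; exact fun _ => hw.2
  set V : Set Coord := toPlane ⁻¹' U ∩ {x | 0 < x 0} ∩ {x | x 1 ∈ Ioo (-Real.pi) Real.pi}
  have hV : IsOpen V := ((hU.preimage continuous_toPlane).inter
    (isOpen_lt continuous_const (continuous_apply 0))).inter
    (isOpen_Ioo.preimage (continuous_apply 1))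
  have hsub : V ⊆ polarRegion M P.region := by
    rintro x ⟨⟨hx1, hx2⟩, hx3⟩
    refine ⟨?_, Ioo_subset_Ioc_self hx3, hUr _ hx1⟩
    by_contra hc
    push Not at hc
    have hn := norm_toPlane (le_of_lt hx2)
    refine hx1.2 ?_
    rw [mem_singleton_iff, P.wind_eq_wind_zero hM hr (by rw [hn]; linarith), h]
  refine (hV.measure_pos volume ?_).trans_le (measure_mono hsub)
  have hzU : z ∈ U := ⟨by rwa [mem_compl_iff, P.trace_toClosedCurve hM], (P.mem_region_iff hM hzb).1 hzr⟩
  have hz0 : 0 < ‖z‖ := by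
    refine norm_pos_iff.2 ?_
    rintro rfl
    exact hzU.2 h
  have hcont : Continuous fun φ : ℝ => toPlane ![‖z‖, φ] := by
    unfold toPlane
    simp only [Matrix.cons_val_zero, Matrix.cons_val_one]
    fun_prop
  have harg : toPlane ![‖z‖, z.arg] = z := by simp [toPlane, Complex.norm_mul_exp_arg_mul_I]
  -- Decreasing the angle slightly leaves the ray `φ = π`, so a point in the open polar domain is
  -- obtained.
  have h1 : ∀ᶠ φ in 𝓝[<] z.arg, toPlane ![‖z‖, φ] ∈ U :=
    nhdsWithin_le_nhds (hcont.continuousAt (hU.mem_nhds (by rwa [harg])))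
  have h2 : ∀ᶠ φ in 𝓝[<] z.arg, φ ∈ Ioo (-Real.pi) z.arg :=
    Ioo_mem_nhdsLT (Complex.neg_pi_lt_arg z)
  obtain ⟨φ, hφ1, hφ2⟩ := (h1.and h2).exists
  exact ⟨![‖z‖, φ], ⟨hφ1, by simpa using hz0⟩, by simpa using hφ2.1,
    by simpa using hφ2.2.trans_le (Complex.arg_le_pi z)⟩

/-- Here `m = 1` and the winding number around the centre is `0`, so the term with `κ(r₀)` drops out
and the exterior angle sum is `2π + ∫ κ'`. -/
theorem gaussBonnet_of_not_enclosesHole (hM : 0 < M) (P : GeodesicPolygon M n)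
    (hP : P.PositivelyOriented) (h : ¬ P.EnclosesHole) :
    CurvatureIntegrable M P.region ∧
    ∑ i, P.internalAngle i = (n - 2) * Real.pi + totalCurvature M P.region ∧
    ∑ i, P.internalAngle i < (n - 2) * Real.pi := by
  rw [P.enclosesHole_iff hM, not_not] at h
  obtain ⟨m, -, hor, hw, -, hsum⟩ := P.exists_orientation hM
  obtain rfl := hor.1 hP
  obtain ⟨r, h2, hr⟩ := P.exists_radius hM
  obtain ⟨hi, hrot⟩ := P.sum_rotation hM hw h2 hr
  have hDm := (P.isClosed_region hM).measurableSet
  obtain ⟨hc, hcv⟩ := setIntegral_curvature hM h2 hDm hi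
  have hpos : 0 < ∫ x in polarRegionFrom r P.region, connectionDeriv M (x 0) := by
    have hm := measurableSet_polarRegionFrom r hDm
    rw [setIntegral_pos_iff_support_of_nonneg_ae _ hi]
    · have : Function.support (fun x : Coord => connectionDeriv M (x 0)) ∩
          polarRegionFrom r P.region = polarRegionFrom r P.region :=
        inter_eq_right.2 fun x hx => (connectionDeriv_pos hM (h2.trans_le hx.1)).ne'
      rw [this, ← P.polarRegion_region hM h2 hr h]
      exact P.volume_polarRegion_pos hM h
    · filter_upwards [ae_restrict_mem hm] with x hx
      exact (connectionDeriv_pos hM (h2.trans_le hx.1)).le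
  rw [CurvatureIntegrable, totalCurvature, P.polarRegion_region hM h2 hr h, hcv,
    P.sum_internalAngle, hsum, hrot, h]
  refine ⟨hc, by push_cast; ring, ?_⟩
  push_cast
  linarith

theorem polarRegion_regionWithHole (hM : 0 < M) (P : GeodesicPolygon M n) :
    polarRegion M P.regionWithHole = polarRegionFrom (3 * M) P.region := by
  ext x
  constructor
  · rintro ⟨h1, h2, h3, h4⟩
    rw [mem_ball_zero_iff, norm_toPlane (by linarith), not_lt] at h4
    exact ⟨h4, h2, h3⟩
  · rintro ⟨h1, h2, h3⟩
    refine ⟨by linarith, h2, h3, ?_⟩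
    rwa [mem_ball_zero_iff, norm_toPlane (by linarith), not_lt]

/-- The integrand is positive, so the region may be enlarged to a round annulus, for which the
integral is `2π κ(R)`. -/
theorem integral_connectionDeriv_lt (hM : 0 < M) {D : Set ℂ} {R : ℝ}
    (hR : ∀ z ∈ D, ‖z‖ ≤ R) (h3 : 3 * M ≤ R) :
    ∫ x in polarRegionFrom (3 * M) D, connectionDeriv M (x 0) < 2 * Real.pi := by
  have h0 : 0 < 3 * M := by linarith
  have hgc : ContinuousOn (connectionDeriv M) (Icc (3 * M) R) :=
    (continuousOn_connectionDeriv hM).mono fun x hx => by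
      have := hx.1; rw [mem_Ioi]; linarith
  have hB : ∀ z ∈ Metric.closedBall (0 : ℂ) R, ‖z‖ ≤ R := fun z hz => by simpa using hz
  have hBm := (Metric.isClosed_closedBall (x := (0 : ℂ)) (ε := R)).measurableSet
  have hle : ∫ x in polarRegionFrom (3 * M) D, connectionDeriv M (x 0) ≤
      ∫ x in polarRegionFrom (3 * M) (Metric.closedBall 0 R), connectionDeriv M (x 0) := by
    refine setIntegral_mono_set (integrableOn_polarRegionFrom hB h0 hgc) ?_ ?_
    · filter_upwards [ae_restrict_mem (measurableSet_polarRegionFrom _ hBm)] with x hx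
      exact (connectionDeriv_pos hM (by linarith [hx.1])).le
    · exact LE.le.eventuallyLE fun x hx => ⟨hx.1, hx.2.1, by simpa using hR _ hx.2.2⟩
  refine hle.trans_lt ?_
  rw [setIntegral_polarRegionFrom hB h0 hBm]
  have he : ∀ᵐ p ∂PlaneCurve.polarMeasure (3 * M) R, {p : ℝ × ℝ | (p.1 : ℂ) *
      Complex.exp (p.2 * Complex.I) ∈ Metric.closedBall (0 : ℂ) R}.indicator
        (fun p => connectionDeriv M p.1) p = connectionDeriv M p.1 := by
    filter_upwards [PlaneCurve.ae_fst_mem (3 * M) R] with p hp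
    refine indicator_of_mem ?_ _
    have : 0 ≤ p.1 := h0.le.trans hp.1
    simpa [Complex.norm_exp_ofReal_mul_I, abs_of_nonneg this] using hp.2
  rw [integral_congr_ae he, PlaneCurve.polarMeasure, integral_fun_fst, integral_Icc_eq_integral_Ioc,
    ← intervalIntegral.integral_of_le h3, integral_connectionDeriv hM (by linarith) h3,
    connection_three hM, sub_zero]
  have hvol : (volume.restrict (Ioo (-Real.pi) Real.pi)).real univ = 2 * Real.pi := by
    rw [measureReal_restrict_apply_univ, Real.volume_real_Ioo_of_le (by linarith [Real.pi_pos])]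
    ring
  rw [hvol, smul_eq_mul]
  have := connection_lt_one hM h3
  nlinarith [Real.pi_pos]

/-- Turning number and winding number are both `1` and cancel, which reflects that the annulus has
Euler characteristic zero. With `r₀ = 3M` the inner circle contributes nothing. -/
theorem gaussBonnet_of_enclosesPhotonCircle (hM : 0 < M) (P : GeodesicPolygon M n)
    (hP : P.PositivelyOriented) (h : P.EnclosesPhotonCircle) :
    CurvatureIntegrable M P.regionWithHole ∧
    ∑ i, P.internalAngle i = n * Real.pi + totalCurvature M P.regionWithHole ∧
    (n - 2) * Real.pi < ∑ i, P.internalAngle i := by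
  have hr : ∀ z ∈ P.boundary, 3 * M ≤ ‖z‖ := fun z hz => by
    by_contra hc
    push Not at hc
    exact (h (by simpa using hc.le)).2 hz
  have h0 : (P.toClosedCurve hM).wind 0 ≠ 0 := by
    have := h (Metric.mem_closedBall_self (by linarith))
    exact (P.mem_region_iff hM this.2).1 this.1
  have hz0 : (0 : ℂ) ∉ (P.toClosedCurve hM).trace := by
    rw [P.trace_toClosedCurve hM]
    exact (h (Metric.mem_closedBall_self (by linarith))).2
  obtain ⟨m, -, hor, hw, -, hsum⟩ := P.exists_orientation hM
  obtain rfl := hor.1 hP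
  obtain ⟨hi, hrot⟩ := P.sum_rotation hM hw (by linarith : 2 * M < 3 * M) hr
  have hDm := (P.isClosed_region hM).measurableSet
  obtain ⟨hc, hcv⟩ := setIntegral_curvature hM (by linarith : 2 * M < 3 * M) hDm hi
  obtain ⟨R, hR0, hRb, hR⟩ := P.exists_bound hM
  have h3 : 3 * M ≤ max R (3 * M) := le_max_right _ _
  have hlt := integral_connectionDeriv_lt hM
    (fun z hz => (hR z hz).le.trans (le_max_left R (3 * M))) h3
  have hw1 := (hw 0 hz0).resolve_left h0
  rw [CurvatureIntegrable, totalCurvature, P.polarRegion_regionWithHole hM, hcv,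
    P.sum_internalAngle, hsum, hrot, hw1, connection_three hM]
  refine ⟨hc, by push_cast; ring, ?_⟩
  push_cast
  linarith

end GeodesicPolygon

end Schwarzschild


/-! ## Geodesic arcs that wind around the photon circle -/

namespace Schwarzschild

open Surface Set Filter Topology MeasureTheory

/-- An autonomous equation on the line with a positive bounded right-hand side, solved between two
given points in unit time by a change of speed. -/
theorem exists_flow {F : ℝ → ℝ} (hF : Continuous F) (hpos : ∀ x, 0 < F x) {C : ℝ}
    (hC : ∀ x, F x ≤ C) {a b : ℝ} (hab : a < b) : ∃ S > 0, ∃ x : ℝ → ℝ, x 0 = a ∧ x 1 = b ∧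
      StrictMono x ∧ ∀ t, HasDerivAt x (S * F (x t)) t := by
  have hFi : Continuous fun x => (F x)⁻¹ := hF.inv₀ fun x => (hpos x).ne'
  -- `T` is the time to reach `x`. The bound `F ≤ C` makes it grow at least linearly, so it is a
  -- bijection of the line and its inverse solves the equation.
  set T : ℝ → ℝ := fun x => ∫ s in (0 : ℝ)..x, (F s)⁻¹ with hT
  have hTd : ∀ x, HasDerivAt T (F x)⁻¹ x := fun x => hFi.integral_hasStrictDerivAt 0 x |>.hasDerivAt
  have hTm : StrictMono T := strictMono_of_deriv_pos fun x => by
    rw [(hTd x).deriv]; exact inv_pos.2 (hpos x)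
  have hC0 : 0 < C := (hpos 0).trans_le (hC 0)
  have hmon : Monotone fun x => T x - C⁻¹ * x := by
    have hd : ∀ x, HasDerivAt (fun x => T x - C⁻¹ * x) ((F x)⁻¹ - C⁻¹ * 1) x := fun x =>
      (hTd x).sub ((hasDerivAt_id x).const_mul _)
    refine monotone_of_deriv_nonneg (fun x => (hd x).differentiableAt) fun x => ?_
    rw [(hd x).deriv, mul_one, sub_nonneg]
    exact inv_anti₀ (hpos x) (hC x)
  have hT0 : T 0 = 0 := by simp [hT]
  have hTc : Continuous T := continuous_iff_continuousAt.2 fun x => (hTd x).continuousAt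
  have hsurj : Function.Surjective T := by
    refine hTc.surjective ?_ ?_
    · refine tendsto_atTop_mono' _ ?_ (tendsto_id.const_mul_atTop (inv_pos.2 hC0))
      filter_upwards [eventually_ge_atTop (0 : ℝ)] with x hx
      have := hmon hx
      simp only [hT0, mul_zero, sub_zero] at this
      simp only [id]; linarith
    · refine tendsto_atBot_mono' _ ?_ (tendsto_id.const_mul_atBot (inv_pos.2 hC0))
      filter_upwards [eventually_le_atBot (0 : ℝ)] with x hx
      have := hmon hx
      simp only [hT0, mul_zero, sub_zero] at this
      simp only [id]; linarith
  set e := hTm.orderIsoOfSurjective T hsurj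
  have hgT : ∀ x, e.symm (T x) = x := fun x => e.symm_apply_apply x
  have hTg : ∀ y, T (e.symm y) = y := fun y => e.apply_symm_apply y
  have hg : ∀ y, HasDerivAt e.symm (F (e.symm y)) y := fun y => by
    have := HasDerivAt.of_local_left_inverse (f := T) (g := e.symm) (a := y)
      e.symm.continuous.continuousAt (hTd _) (inv_pos.2 (hpos _)).ne' (Eventually.of_forall hTg)
    simpa using this
  have hS : 0 < T b - T a := sub_pos.2 (hTm hab)
  refine ⟨T b - T a, hS, fun t => e.symm (T a + (T b - T a) * t), ?_, ?_, ?_, fun t => ?_⟩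
  · simp [hgT]
  · simp [hgT]
  · intro s t hst
    exact e.symm.strictMono (by nlinarith)
  · have h1 : HasDerivAt (fun t => T a + (T b - T a) * t) (T b - T a) t := by
      simpa using ((hasDerivAt_id t).const_mul (T b - T a)).const_add (T a)
    have := (hg (T a + (T b - T a) * t)).comp t h1
    rwa [mul_comm] at this

/-- For orbits with perihelion at `3M / r = 1 - 1 / 800`, the function `3M / r`. -/
noncomputable def orbitInv (x : ℝ) : ℝ := 1 - 1 / 800 - x ^ 2

/-- For these orbits, the square of `2 dx / dφ`. -/
noncomputable def orbitSpeed (x : ℝ) : ℝ :=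
  1 / 400 + x ^ 2 - 1 / 320000 - x ^ 2 / 400 - 2 / 3 * (x ^ 2) ^ 2

/-- The nearest point in `[-1 / 2, 1 / 2]`. -/
noncomputable def clamp (x : ℝ) : ℝ := max (-(1 / 2)) (min x (1 / 2))

theorem clamp_mem (x : ℝ) : clamp x ∈ Icc (-(1 / 2) : ℝ) (1 / 2) :=
  ⟨le_max_left _ _, max_le (by norm_num) (min_le_right _ _)⟩

theorem clamp_of_mem {x : ℝ} (h : x ∈ Icc (-(1 / 2) : ℝ) (1 / 2)) : clamp x = x := by
  rw [clamp, min_eq_left h.2, max_eq_right h.1]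

theorem continuous_clamp : Continuous clamp := by unfold clamp; fun_prop

theorem sq_le_of_mem {x : ℝ} (h : x ∈ Icc (-(1 / 2) : ℝ) (1 / 2)) : x ^ 2 ≤ 1 / 4 := by
  nlinarith [h.1, h.2]

theorem orbitInv_mem {x : ℝ} (h : x ∈ Icc (-(1 / 2) : ℝ) (1 / 2)) :
    1 / 2 < orbitInv x ∧ orbitInv x < 1 := by
  have := sq_le_of_mem h
  unfold orbitInv
  constructor <;> nlinarith [sq_nonneg x]

theorem orbitSpeed_pos {x : ℝ} (h : x ∈ Icc (-(1 / 2) : ℝ) (1 / 2)) : 0 < orbitSpeed x := by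
  have := sq_le_of_mem h
  unfold orbitSpeed
  nlinarith [sq_nonneg x]

theorem orbitSpeed_le (x : ℝ) : orbitSpeed x ≤ 1 / 400 + x ^ 2 := by
  unfold orbitSpeed; nlinarith [sq_nonneg x, sq_nonneg (x ^ 2)]

/-- Clamping gives a positive continuous speed on the whole line, so that angle and flow are defined
globally; the orbit itself stays where clamping has no effect. -/
theorem orbitSpeed_clamp_pos (x : ℝ) : 0 < √(orbitSpeed (clamp x)) :=
  Real.sqrt_pos.2 (orbitSpeed_pos (clamp_mem x))

theorem continuous_orbitSpeed_clamp : Continuous fun x => √(orbitSpeed (clamp x)) := by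
  have := continuous_clamp
  unfold orbitSpeed; fun_prop

/-- The polar angle along the orbit, from the perihelion on. -/
noncomputable def orbitAngle (x : ℝ) : ℝ := ∫ s in (0 : ℝ)..x, 2 / √(orbitSpeed (clamp s))

theorem hasDerivAt_orbitAngle (x : ℝ) :
    HasDerivAt orbitAngle (2 / √(orbitSpeed (clamp x))) x := by
  have : Continuous fun s => 2 / √(orbitSpeed (clamp s)) :=
    continuous_const.div continuous_orbitSpeed_clamp fun s => (orbitSpeed_clamp_pos s).ne'
  exact (this.integral_hasStrictDerivAt 0 x).hasDerivAt

theorem strictMono_orbitAngle : StrictMono orbitAngle := strictMono_of_deriv_pos fun x => by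
  rw [(hasDerivAt_orbitAngle x).deriv]; exact div_pos two_pos (orbitSpeed_clamp_pos x)

theorem orbitAngle_neg (x : ℝ) : orbitAngle (-x) = -orbitAngle x := by
  have hc : ∀ s, orbitSpeed (clamp (-s)) = orbitSpeed (clamp s) := by
    intro s
    have : clamp (-s) = -clamp s := by
      unfold clamp
      simp only [max_def, min_def]
      split_ifs <;> linarith
    rw [this, orbitSpeed, orbitSpeed, neg_sq]
  have h := intervalIntegral.integral_comp_neg (a := 0) (b := x)
    (fun s => 2 / √(orbitSpeed (clamp s)))
  simp only [hc, neg_zero] at h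
  rw [orbitAngle, orbitAngle, h, intervalIntegral.integral_symm]

/-- The perihelion is chosen so that `orbitSpeed x ≤ (1 / 20)² + x² ≤ (1 / 20 + x)²` for `x ≥ 0`.
The angle swept out is then at least `2 log 11 ≥ 4 > π`, enough for a loop. -/
theorem four_le_orbitAngle : 4 ≤ orbitAngle (1 / 2) := by
  have hd : ∀ x ∈ Icc (0 : ℝ) (1 / 2), HasDerivAt (fun x => orbitAngle x - 2 * Real.log (1 / 20 + x))
      (2 / √(orbitSpeed (clamp x)) - 2 * (1 / (1 / 20 + x))) x := by
    intro x hx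
    have h0 : (1 / 20 + x : ℝ) ≠ 0 := by linarith [hx.1]
    exact (hasDerivAt_orbitAngle x).sub
      ((((hasDerivAt_id x).const_add (1 / 20)).log h0).const_mul 2)
  have hmon : MonotoneOn (fun x => orbitAngle x - 2 * Real.log (1 / 20 + x)) (Icc 0 (1 / 2)) := by
    refine monotoneOn_of_deriv_nonneg (convex_Icc _ _)
      (fun x hx => (hd x hx).continuousAt.continuousWithinAt)
      (fun x hx => (hd x (interior_subset hx)).differentiableAt.differentiableWithinAt) ?_
    intro x hx
    have hx' := interior_subset hx
    have hmem : x ∈ Icc (-(1 / 2) : ℝ) (1 / 2) := ⟨by linarith [hx'.1], hx'.2⟩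
    rw [(hd x hx').deriv, clamp_of_mem hmem, sub_nonneg, mul_one_div]
    refine div_le_div_of_nonneg_left zero_le_two (Real.sqrt_pos.2 (orbitSpeed_pos hmem)) ?_
    rw [Real.sqrt_le_left (by linarith [hx'.1])]
    nlinarith [orbitSpeed_le x, hx'.1]
  have h := hmon (left_mem_Icc.2 (by norm_num)) (right_mem_Icc.2 (by norm_num))
    (by norm_num : (0 : ℝ) ≤ 1 / 2)
  have h0 : orbitAngle 0 = 0 := by simp [orbitAngle]
  simp only [h0, add_zero] at h
  have hlog : Real.log (1 / 20 + 1 / 2) - Real.log (1 / 20) = Real.log 11 := by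
    rw [← Real.log_div (by norm_num) (by norm_num)]; norm_num
  have h2 : 2 ≤ Real.log 11 := by
    rw [Real.le_log_iff_exp_le (by norm_num)]
    have := Real.exp_one_lt_d9
    have he : Real.exp 2 = Real.exp 1 * Real.exp 1 := by rw [← Real.exp_add]; norm_num
    rw [he]
    nlinarith [Real.exp_pos 1]
  linarith

theorem exists_orbitAngle_eq {θ : ℝ} (h0 : 0 < θ) (hθ : θ ≤ Real.pi) :
    ∃ X ∈ Icc (0 : ℝ) (1 / 2), 0 < X ∧ orbitAngle X = θ := by
  have hz : orbitAngle 0 = 0 := by simp [orbitAngle]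
  have hc : ContinuousOn orbitAngle (Icc 0 (1 / 2)) := fun x _ =>
    (hasDerivAt_orbitAngle x).continuousAt.continuousWithinAt
  obtain ⟨X, hX, he⟩ := intermediate_value_Icc (by norm_num : (0 : ℝ) ≤ 1 / 2) hc
    (show θ ∈ Icc (orbitAngle 0) (orbitAngle (1 / 2)) from
      ⟨by rw [hz]; exact h0.le, hθ.trans (Real.pi_le_four.trans four_le_orbitAngle)⟩)
  refine ⟨X, hX, lt_of_le_of_ne hX.1 ?_, he⟩
  rintro rfl
  rw [hz] at he
  exact h0.ne he

end Schwarzschild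


/-! ### The orbits satisfy the geodesic equation -/

namespace Schwarzschild

open Surface Set Filter Topology MeasureTheory

variable {M : ℝ}

theorem hasDerivAt_orbitInv (x : ℝ) : HasDerivAt orbitInv (-(2 * x)) x := by
  exact ((hasDerivAt_pow 2 x).const_sub (1 - 1 / 800)).congr_deriv (by simp)

/-- For `w = 3M/r = w₀ - x²` the first integral of the orbit equation reads `dw/dφ = -x √Q`, where
`Q = orbitSpeed x`. With `dφ = 2 dx / √Q`, this derivative is the equation `d²w/dφ² = w² - w`. The
parameter `x` passes smoothly through the perihelion, where `dw/dφ` vanishes. -/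
theorem hasDerivAt_mul_sqrt_orbitSpeed {x : ℝ} (h : x ∈ Icc (-(1 / 2) : ℝ) (1 / 2)) :
    HasDerivAt (fun x => x * √(orbitSpeed x))
      (2 * (1 - orbitInv x) * orbitInv x / √(orbitSpeed x)) x := by
  have hQ := orbitSpeed_pos h
  have hd : HasDerivAt orbitSpeed (2 * x - 2 * x / 400 - 2 / 3 * (2 * x ^ 2 * (2 * x))) x := by
    have h2 : HasDerivAt (fun x : ℝ => x ^ 2) (2 * x) x := by simpa using hasDerivAt_pow 2 x
    have := (((h2.const_add (1 / 400)).sub_const (1 / 320000)).sub (h2.div_const 400)).sub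
      ((h2.pow 2).const_mul (2 / 3))
    refine this.congr_deriv ?_
    norm_num
  refine ((hasDerivAt_id x).mul (hd.sqrt hQ.ne')).congr_deriv ?_
  have hs := Real.sqrt_pos.2 hQ
  have hsq : √(orbitSpeed x) ^ 2 = orbitSpeed x := Real.sq_sqrt hQ.le
  simp only [id]
  field_simp
  rw [hsq, orbitSpeed, orbitInv]
  ring

/-- The coordinate velocity along the orbit, with respect to `S` times a fixed affine parameter. -/
noncomputable def orbitVel (M S x : ℝ) : Coord :=
  ![S * ((1 - 2 / 3 * orbitInv x) * (x * √(orbitSpeed x))) / (3 * M),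
    S * ((1 - 2 / 3 * orbitInv x) * orbitInv x ^ 2) / (9 * M ^ 2)]

/-- The speed of the parameter `x` along the orbit. -/
noncomputable def orbitFlow (M x : ℝ) : ℝ :=
  √(orbitSpeed x) / 2 * ((1 - 2 / 3 * orbitInv x) * orbitInv x ^ 2 / (9 * M ^ 2))

theorem hasDerivAt_orbitPos (hM : 0 < M) {S t : ℝ} {x : ℝ → ℝ}
    (hx : HasDerivAt x (S * orbitFlow M (x t)) t) (h : x t ∈ Icc (-(1 / 2) : ℝ) (1 / 2)) :
    HasDerivAt (fun t => (![3 * M / orbitInv (x t), orbitAngle (x t)] : Coord))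
      (orbitVel M S (x t)) t := by
  have hw := (orbitInv_mem h).1
  have hw0 : orbitInv (x t) ≠ 0 := by linarith
  have hs := Real.sqrt_pos.2 (orbitSpeed_pos h)
  rw [hasDerivAt_pi]
  intro i
  fin_cases i
  · have := ((hasDerivAt_orbitInv (x t)).comp t hx).inv hw0 |>.const_mul (3 * M)
    refine this.congr_deriv ?_
    simp only [orbitVel, orbitFlow, Function.comp, Fin.zero_eta, Matrix.cons_val_zero]
    field_simp
    ring
  · refine ((hasDerivAt_orbitAngle (x t)).comp t hx).congr_deriv ?_
    rw [clamp_of_mem h]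
    simp only [orbitVel, orbitFlow, Fin.mk_one, Matrix.cons_val_one, Matrix.cons_val_fin_one]
    field_simp

/-- The velocity is normalized by the conserved angular momentum `r² φ' / (1 - 2M/r) = S`, which is
the angular equation; the radial one is the orbit equation. -/
theorem hasDerivAt_orbitVel (hM : 0 < M) {S t φ : ℝ} {x : ℝ → ℝ}
    (hx : HasDerivAt x (S * orbitFlow M (x t)) t) (h : x t ∈ Icc (-(1 / 2) : ℝ) (1 / 2)) :
    HasDerivAt (fun t => orbitVel M S (x t)) (geodesicAccel (opticalMetric M)
      ![3 * M / orbitInv (x t), φ] (orbitVel M S (x t))) t := by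
  obtain ⟨hw, hw1⟩ := orbitInv_mem h
  have hw0 : 0 < orbitInv (x t) := by linarith
  have hs := Real.sqrt_pos.2 (orbitSpeed_pos h)
  have hf : 0 < 1 - 2 / 3 * orbitInv (x t) := by linarith
  have hout : 2 * M < (![3 * M / orbitInv (x t), φ] : Coord) 0 := by
    simp only [Matrix.cons_val_zero]
    rw [lt_div_iff₀ hw0]; nlinarith
  rw [geodesicAccel_opticalMetric hM hout]
  simp only [Matrix.cons_val_zero]
  have hrr : 3 * M / orbitInv (x t) * (3 * M / orbitInv (x t) - 2 * M) =
      9 * M ^ 2 * (1 - 2 / 3 * orbitInv (x t)) / orbitInv (x t) ^ 2 := by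
    field_simp; ring
  have hr3 : 3 * M / orbitInv (x t) - 3 * M = 3 * M * (1 - orbitInv (x t)) / orbitInv (x t) := by
    field_simp
  rw [hrr, hr3]
  have hd1 := ((hasDerivAt_orbitInv (x t)).comp t hx).const_mul (2 / 3) |>.const_sub 1
  have hdw := (hasDerivAt_orbitInv (x t)).comp t hx
  have hdP := (hasDerivAt_mul_sqrt_orbitSpeed h).comp t hx
  rw [hasDerivAt_pi]
  intro i
  fin_cases i
  · refine (((hd1.mul hdP).const_mul S).div_const (3 * M)).congr_deriv ?_
    simp only [orbitVel, orbitFlow, Function.comp, Fin.zero_eta, Matrix.cons_val_zero,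
      Matrix.cons_val_one, Matrix.cons_val_fin_one]
    generalize √(orbitSpeed (x t)) = q at *
    generalize orbitInv (x t) = w at *
    generalize hfw : 1 - 2 / 3 * w = f at *
    field_simp
    ring
  · refine (((hd1.mul (hdw.pow 2)).const_mul S).div_const (9 * M ^ 2)).congr_deriv ?_
    simp only [orbitVel, orbitFlow, Function.comp, Fin.mk_one, Matrix.cons_val_zero,
      Matrix.cons_val_one, Matrix.cons_val_fin_one, Pi.pow_apply]
    generalize √(orbitSpeed (x t)) = q at *
    generalize orbitInv (x t) = w at *
    obtain ⟨f, hfw⟩ : ∃ f, 1 - 2 / 3 * w = f := ⟨_, rfl⟩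
    rw [hfw] at hf ⊢
    obtain rfl : w = 3 / 2 * (1 - f) := by linarith
    field_simp
    ring

theorem orbitFlow_clamp_pos (hM : 0 < M) (x : ℝ) : 0 < orbitFlow M (clamp x) := by
  have hs := Real.sqrt_pos.2 (orbitSpeed_pos (clamp_mem x))
  obtain ⟨hw, hw1⟩ := orbitInv_mem (clamp_mem x)
  have : 0 < 1 - 2 / 3 * orbitInv (clamp x) := by linarith
  have : 0 < orbitInv (clamp x) := by linarith
  unfold orbitFlow
  positivity

theorem continuous_orbitFlow : Continuous (orbitFlow M) := by
  unfold orbitFlow orbitInv orbitSpeed; fun_prop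

/-- A geodesic arc outside the photon circle, symmetric with respect to its perihelion, with polar
angles from `-θ` to `θ`. -/
theorem exists_arc (hM : 0 < M) {θ : ℝ} (h0 : 0 < θ) (hθ : θ ≤ Real.pi) : ∃ A : GeodesicArc M,
    (∀ t ∈ Icc (0 : ℝ) 1, 3 * M < A.pos t 0) ∧
    A.pos 0 1 = -θ ∧ A.pos 1 1 = θ ∧ StrictMono (fun t => A.pos t 1) ∧ A.pos 0 0 = A.pos 1 0 ∧
    A.vel 0 0 = -A.vel 1 0 ∧ 0 < A.vel 1 0 ∧ A.vel 0 1 = A.vel 1 1 ∧ 0 < A.vel 1 1 := by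
  obtain ⟨X, hX, hX0, hXθ⟩ := exists_orbitAngle_eq h0 hθ
  obtain ⟨C, hC⟩ := isCompact_Icc.exists_bound_of_continuousOn
    (continuous_orbitFlow (M := M)).continuousOn (s := Icc (-(1 / 2)) (1 / 2))
  -- The solution of the clamped flow increases from `-X` to `X`, so it stays in the range where
  -- clamping is the identity.
  obtain ⟨S, hS, x, hx0, hx1, hxm, hxd⟩ := exists_flow
    (continuous_orbitFlow (M := M) |>.comp continuous_clamp) (orbitFlow_clamp_pos hM)
    (fun y => (le_abs_self _).trans (hC _ (clamp_mem y))) (by linarith : -X < X)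
  have hmem : ∀ t ∈ Icc (0 : ℝ) 1, x t ∈ Icc (-(1 / 2) : ℝ) (1 / 2) := fun t ht => by
    have h1 := hxm.monotone ht.1
    have h2 := hxm.monotone ht.2
    rw [hx0] at h1
    rw [hx1] at h2
    exact ⟨by linarith [hX.2], by linarith [hX.2]⟩
  have hxd' : ∀ t ∈ Icc (0 : ℝ) 1, HasDerivAt x (S * orbitFlow M (x t)) t := fun t ht => by
    have := hxd t
    rwa [Function.comp, clamp_of_mem (hmem t ht)] at this
  have hr : ∀ t ∈ Icc (0 : ℝ) 1, 3 * M < 3 * M / orbitInv (x t) := fun t ht => by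
    obtain ⟨hw, hw1⟩ := orbitInv_mem (hmem t ht)
    rw [lt_div_iff₀ (by linarith)]
    nlinarith
  have hXm : X ∈ Icc (-(1 / 2) : ℝ) (1 / 2) := ⟨by linarith, hX.2⟩
  have hneg1 : orbitInv (-X) = orbitInv X := by simp [orbitInv]
  have hneg2 : orbitSpeed (-X) = orbitSpeed X := by simp [orbitSpeed]
  obtain ⟨hw, hw1⟩ := orbitInv_mem hXm
  have hw0 : 0 < orbitInv X := by linarith
  have hf : 0 < 1 - 2 / 3 * orbitInv X := by linarith
  have hs := Real.sqrt_pos.2 (orbitSpeed_pos hXm)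
  have hv1 : ∀ t ∈ Icc (0 : ℝ) 1, 0 < orbitVel M S (x t) 1 := fun t ht => by
    obtain ⟨hw, hw1⟩ := orbitInv_mem (hmem t ht)
    have : 0 < orbitInv (x t) := by linarith
    have : 0 < 1 - 2 / 3 * orbitInv (x t) := by linarith
    simp only [orbitVel, Matrix.cons_val_one, Matrix.cons_val_fin_one]
    positivity
  refine ⟨⟨fun t => ![3 * M / orbitInv (x t), orbitAngle (x t)], fun t => orbitVel M S (x t),
    fun t ht => ?_, fun t ht => (hasDerivAt_orbitPos hM (hxd' t ht) (hmem t ht)).hasDerivWithinAt,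
    fun t ht => (hasDerivAt_orbitVel hM (hxd' t ht) (hmem t ht)).hasDerivWithinAt,
    fun t ht h => ?_⟩, ?_, ?_, ?_, ?_, ?_, ?_, ?_, ?_, ?_⟩
  · exact lt_trans (by linarith) (hr t ht)
  · exact (hv1 t ht).ne' (by rw [h]; rfl)
  · exact hr
  · simp [hx0, orbitAngle_neg, hXθ]
  · simp [hx1, hXθ]
  · exact strictMono_orbitAngle.comp hxm
  · simp [hx0, hx1, hneg1]
  · simp [hx0, hx1, orbitVel, hneg1, hneg2, neg_div]
  · simp only [hx1, orbitVel, Matrix.cons_val_zero]; positivity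
  · simp [hx0, hx1, orbitVel, hneg1]
  · exact hv1 1 (by simp)

end Schwarzschild


/-! ### Regular polygons around the photon circle -/

namespace Schwarzschild

open Surface Set Filter Topology MeasureTheory

variable {M : ℝ}

/-- The image of a geodesic arc under a rotation. -/
noncomputable def GeodesicArc.rotate (hM : 0 < M) (A : GeodesicArc M) (α : ℝ) : GeodesicArc M where
  pos t := A.pos t + ![0, α]
  vel := A.vel
  outside t ht := by simpa using A.outside t ht
  hasDeriv_pos t ht := (A.hasDeriv_pos t ht).add_const _
  hasDeriv_vel t ht := by
    have h := A.hasDeriv_vel t ht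
    rw [geodesicAccel_opticalMetric hM (A.outside t ht)] at h
    rw [geodesicAccel_opticalMetric hM (by simpa using A.outside t ht)]
    simpa using h
  vel_ne_zero := A.vel_ne_zero

/-- Congruent arcs that wind once around the center in total form a geodesic polygon that encloses
the photon circle, with all internal angles in `(0, π)`. -/
theorem exists_polygon (hM : 0 < M) (n : ℕ) [NeZero n] : ∃ P : GeodesicPolygon M n,
    P.PositivelyOriented ∧ P.EnclosesPhotonCircle ∧
      ∀ i, 0 < P.internalAngle i ∧ P.internalAngle i < Real.pi := by
  have hn : (1 : ℝ) ≤ n := by exact_mod_cast NeZero.one_le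
  have hn0 : (0 : ℝ) < n := by linarith
  have hpi := Real.pi_pos
  obtain ⟨A, hA3, hA0, hA1, hAm, hr, hv0, hv0', hv1, hv1'⟩ := exists_arc hM
    (div_pos hpi hn0) (div_le_self hpi.le hn)
  have h0I : (0 : ℝ) ∈ Icc (0 : ℝ) 1 := by simp
  have h1I : (1 : ℝ) ∈ Icc (0 : ℝ) 1 := by simp
  -- Each arc spans the angle `2π / n`, and successive arcs are rotated by that angle.
  set E : Fin n → GeodesicArc M := fun i => A.rotate hM (2 * Real.pi * (i : ℕ) / n)
  have hE0 : ∀ i t, (E i).pos t 0 = A.pos t 0 := fun i t => add_zero _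
  have hE1 : ∀ i t, (E i).pos t 1 = A.pos t 1 + 2 * Real.pi * (i : ℕ) / n := fun i t => rfl
  have hEp : ∀ i, ∀ t ∈ Icc (0 : ℝ) 1, 0 < (E i).pos t 0 := fun i t ht => (E i).pos_pos hM ht
  let P : GeodesicPolygon M n :=
    { edge := E
      closed := by
        intro i
        rw [toPlane_eq_iff (hEp _ _ h1I) (hEp _ _ h0I), hE0, hE0, hE1, hE1, hA0, hA1]
        -- The quotient is `1` for the last edge and `0` otherwise: only there does the angle
        -- coordinate jump, by `2π`.
        refine ⟨hr.symm, (((i : ℕ) + 1) / n : ℕ), ?_⟩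
        have hval : ((i + 1 : Fin n) : ℕ) = ((i : ℕ) + 1) % n := by
          rw [Fin.val_add, Fin.val_one', Nat.add_mod_mod]
        have hdiv : (((i : ℕ) + 1) % n : ℕ) + (n : ℝ) * (((i : ℕ) + 1) / n : ℕ) = (i : ℕ) + 1 := by
          exact_mod_cast Nat.mod_add_div ((i : ℕ) + 1) n
        rw [hval]
        generalize ((i : ℕ) + 1) % n = r at hdiv ⊢
        generalize ((i : ℕ) + 1) / n = q at hdiv ⊢
        push_cast
        field_simp
        linear_combination (-2 : ℝ) * hdiv
      simple := by
        intro i j s hs t ht h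
        have hs' := Ico_subset_Icc_self hs
        have ht' := Ico_subset_Icc_self ht
        obtain ⟨-, k, hk⟩ := (toPlane_eq_iff (hEp _ _ hs') (hEp _ _ ht')).1 h
        rw [hE1, hE1] at hk
        have s1 := hAm.monotone hs.1
        have s2 := hAm hs.2
        have t1 := hAm.monotone ht.1
        have t2 := hAm ht.2
        simp only [hA0, hA1] at s1 s2 t1 t2
        have hk' : A.pos s 1 - A.pos t 1 =
            2 * (Real.pi / n) * (((j : ℕ) : ℤ) + k * n - ((i : ℕ) : ℤ) : ℤ) := by
          push_cast
          field_simp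
          field_simp at hk
          linear_combination hk
        have hq : 0 < Real.pi / n := div_pos hpi hn0
        -- Along an arc the angle stays in a half-open interval of length `2π / n`, so two values
        -- that differ by a multiple of `2π / n` are equal.
        have hz : (((j : ℕ) : ℤ) + k * n - ((i : ℕ) : ℤ) : ℤ) = 0 := by
          generalize (((j : ℕ) : ℤ) + k * n - ((i : ℕ) : ℤ) : ℤ) = z at hk'
          have h1 : (z : ℝ) < 1 := by by_contra hc; push Not at hc; nlinarith
          have h2 : (-1 : ℝ) < z := by by_contra hc; push Not at hc; nlinarith
          have h1' : z < 1 := by exact_mod_cast h1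
          have h2' : -1 < z := by exact_mod_cast h2
          omega
        rw [hz, Int.cast_zero, mul_zero, sub_eq_zero] at hk'
        refine ⟨?_, hAm.injective hk'⟩
        have hi : ((i : ℕ) : ℤ) < n := by exact_mod_cast i.2
        have hj : ((j : ℕ) : ℤ) < n := by exact_mod_cast j.2
        have hk0 : k = 0 := by
          by_contra hc
          rcases lt_or_gt_of_ne hc with h | h <;> nlinarith
        rw [hk0] at hz
        exact Fin.ext (by omega) }
  have hPb : ∀ z ∈ P.boundary, 3 * M < ‖z‖ := fun z hz => by
    obtain ⟨i, t, ht, rfl⟩ := mem_iUnion.1 hz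
    simp only
    rw [norm_toPlane (hEp i t ht).le, hE0]
    exact hA3 t ht
  have hball : ∀ z : ℂ, ‖z‖ ≤ 3 * M → z ∉ P.boundary := fun z hz h => (hPb z h).not_ge hz
  have h0b : (0 : ℂ) ∉ P.boundary := hball 0 (by rw [norm_zero]; linarith)
  have hw0 : (P.toClosedCurve hM).wind 0 = 1 := by
    have h := P.sum_increment hM (by rwa [P.trace_toClosedCurve hM])
    have hinc : ∀ i, (P.edge i).pos 1 1 - (P.edge i).pos 0 1 = 2 * (Real.pi / n) := fun i => by
      change (E i).pos 1 1 - (E i).pos 0 1 = _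
      rw [hE1, hE1, hA0, hA1]; ring
    rw [Finset.sum_congr rfl fun i _ => hinc i] at h
    simp only [Finset.sum_const, Finset.card_univ, Fintype.card_fin, nsmul_eq_mul] at h
    have : ((P.toClosedCurve hM).wind 0 : ℝ) = 1 := by
      field_simp at h
      linarith
    exact_mod_cast this
  refine ⟨P, ?_, fun z hz => ?_, fun i => ⟨P.internalAngle_pos hM i, ?_⟩⟩
  · obtain ⟨m, -, hor, hw, -, -⟩ := P.exists_orientation hM
    have := hw 0 (by rwa [P.trace_toClosedCurve hM])
    rw [hw0] at this
    exact hor.2 (by omega)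
  · have hz' := hball z (by simpa using hz)
    refine ⟨?_, hz'⟩
    rw [P.mem_region_iff hM hz', (P.toClosedCurve hM).wind_eq_of_isPreconnected
      (convex_closedBall (0 : ℂ) (3 * M)).isPreconnected ?_ hz
      (Metric.mem_closedBall_self (by linarith)), hw0]
    · exact one_ne_zero
    · rw [P.trace_toClosedCurve hM, disjoint_left]
      exact fun w hw => hball w (by simpa using hw)
  · rw [GeodesicPolygon.internalAngle, sub_lt_self_iff, GeodesicPolygon.exteriorAngle,
      signedAngle_eq hM ((P.edge (i + 1)).outside 0 h0I)]
    have hx := (P.edge (i + 1)).outside 0 h0I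
    have hx0 := (P.edge (i + 1)).pos_pos hM h0I
    have hl := lapse_pos hM hx
    have hls := Real.sqrt_pos.2 hl
    generalize (P.edge (i + 1)).pos 0 = x at *
    change 0 < Complex.arg (starRingEnd ℂ (frame M x (A.vel 1)) * frame M x (A.vel 0))
    -- At a corner the radial velocity changes sign from outward to inward while the positive
    -- angular velocity is kept, so the tangent turns left.
    have him : 0 < (starRingEnd ℂ (frame M x (A.vel 1)) * frame M x (A.vel 0)).im := by
      simp only [frame, Complex.mul_im, Complex.conj_re, Complex.conj_im, hv0, hv1]
      have h1 : 0 < A.vel 1 0 / lapse M (x 0) := by positivity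
      have h2 : 0 < x 0 * A.vel 1 1 / √(lapse M (x 0)) := by positivity
      rw [neg_div]
      nlinarith [mul_pos h1 h2]
    refine lt_of_le_of_ne (Complex.arg_nonneg_iff.2 him.le) fun h => ?_
    have := (Complex.arg_eq_zero_iff.1 h.symm).2
    exact him.ne' this

end Schwarzschild

theorem mainTheorem4 (M : ℝ) (hM : 0 < M) :
    -- the Gauss curvature
    (∀ x : Surface.Coord, 2 * M < x 0 →
      Surface.gaussCurvature (Schwarzschild.opticalMetric M) x
          = -(2 * M / x 0 ^ 3) * (1 - 3 * M / (2 * x 0)) ∧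
      Surface.gaussCurvature (Schwarzschild.opticalMetric M) x < 0) ∧
    -- (i) triangles that do not enclose the hole
    (∀ P : Schwarzschild.GeodesicPolygon M 3, P.PositivelyOriented → ¬ P.EnclosesHole →
      (∀ i, 0 < P.internalAngle i) ∧
      Schwarzschild.CurvatureIntegrable M P.region ∧
      ∑ i, P.internalAngle i = Real.pi + Schwarzschild.totalCurvature M P.region ∧
      ∑ i, P.internalAngle i < Real.pi) ∧
    -- (ii) every digon encloses the hole
    (∀ P : Schwarzschild.GeodesicPolygon M 2, P.EnclosesHole ∧
      ((∀ z ∈ P.boundary, 3 * M ≤ ‖z‖) → Metric.closedBall (0 : ℂ) (3 * M) ⊆ P.region)) ∧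
    -- (iii) every loop encloses the hole
    (∀ P : Schwarzschild.GeodesicPolygon M 1, P.EnclosesHole ∧
      ((∀ z ∈ P.boundary, 3 * M ≤ ‖z‖) → Metric.closedBall (0 : ℂ) (3 * M) ⊆ P.region)) ∧
    -- (iv) triangles that enclose the circular geodesic
    (∀ P : Schwarzschild.GeodesicPolygon M 3, P.PositivelyOriented → P.EnclosesPhotonCircle →
      (∀ i, 0 < P.internalAngle i) ∧
      Schwarzschild.CurvatureIntegrable M P.regionWithHole ∧
      ∑ i, P.internalAngle i = 3 * Real.pi + Schwarzschild.totalCurvature M P.regionWithHole ∧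
      Real.pi < ∑ i, P.internalAngle i) ∧
    -- (v) digons that enclose the circular geodesic
    ((∀ P : Schwarzschild.GeodesicPolygon M 2, P.PositivelyOriented → P.EnclosesPhotonCircle →
        (∀ i, 0 < P.internalAngle i) ∧
        Schwarzschild.CurvatureIntegrable M P.regionWithHole ∧
        ∑ i, P.internalAngle i = 2 * Real.pi + Schwarzschild.totalCurvature M P.regionWithHole ∧
        0 < ∑ i, P.internalAngle i) ∧
      ∃ P : Schwarzschild.GeodesicPolygon M 2, P.PositivelyOriented ∧ P.EnclosesPhotonCircle ∧
        ∀ i, 0 < P.internalAngle i ∧ P.internalAngle i < Real.pi) ∧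
    -- (vi) loops that enclose the circular geodesic
    ((∀ P : Schwarzschild.GeodesicPolygon M 1, P.PositivelyOriented → P.EnclosesPhotonCircle →
        0 < P.internalAngle 0 ∧
        Schwarzschild.CurvatureIntegrable M P.regionWithHole ∧
        P.internalAngle 0 = Real.pi + Schwarzschild.totalCurvature M P.regionWithHole) ∧
      ∃ P : Schwarzschild.GeodesicPolygon M 1, P.PositivelyOriented ∧ P.EnclosesPhotonCircle ∧
        0 < P.internalAngle 0 ∧ P.internalAngle 0 < Real.pi) := by
  have h1 : ((3 : ℕ) - 2 : ℝ) = 1 := by norm_num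
  refine ⟨fun x hx => ?_, fun P hP hH => ?_, fun P => ⟨?_, fun hr => ?_⟩, fun P => ⟨?_, fun hr => ?_⟩,
    fun P hP hC => ?_, ⟨fun P hP hC => ?_, Schwarzschild.exists_polygon hM 2⟩,
    ⟨fun P hP hC => ?_, ?_⟩⟩
  · have hx0 : 0 < x 0 := by linarith
    have h := Schwarzschild.gaussCurvature_opticalMetric hM hx
    refine ⟨h, ?_⟩
    rw [h]
    have : 3 * M / (2 * x 0) < 1 := by rw [div_lt_one (by positivity)]; linarith
    have : 0 < 1 - 3 * M / (2 * x 0) := by linarith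
    rw [neg_mul, neg_lt_zero]
    positivity
  · obtain ⟨hc, hs, hlt⟩ := P.gaussBonnet_of_not_enclosesHole hM hP hH
    rw [h1, one_mul] at hs hlt
    exact ⟨P.internalAngle_pos hM, hc, hs, hlt⟩
  · exact (P.enclosesHole_iff hM).2 (P.wind_zero_ne_zero hM le_rfl)
  · exact P.closedBall_subset_region hM (by linarith) hr (P.wind_zero_ne_zero hM le_rfl)
  · exact (P.enclosesHole_iff hM).2 (P.wind_zero_ne_zero hM one_le_two)
  · exact P.closedBall_subset_region hM (by linarith) hr (P.wind_zero_ne_zero hM one_le_two)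
  · obtain ⟨hc, hs, hlt⟩ := P.gaussBonnet_of_enclosesPhotonCircle hM hP hC
    rw [h1, one_mul] at hlt
    exact ⟨P.internalAngle_pos hM, hc, by exact_mod_cast hs, hlt⟩
  · obtain ⟨hc, hs, hlt⟩ := P.gaussBonnet_of_enclosesPhotonCircle hM hP hC
    refine ⟨P.internalAngle_pos hM, hc, by exact_mod_cast hs, ?_⟩
    simpa using hlt
  · obtain ⟨hc, hs, -⟩ := P.gaussBonnet_of_enclosesPhotonCircle hM hP hC
    refine ⟨P.internalAngle_pos hM 0, hc, ?_⟩
    simpa using hs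
  · obtain ⟨P, hP, hC, ha⟩ := Schwarzschild.exists_polygon hM 1
    exact ⟨P, hP, hC, ha 0⟩
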